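/- Let $r\ge 2$ and let $n,m\ge 1$ be coprime integers, with $n>m$ if $r=2$ and $n\ge m$ if $r\ge 3$. An $r$-uniform hypergraph $A$ is a set together with a set $R[A]$ of $r$-element subsets of it; substructures are induced ones. For a finite $r$-uniform hypergraph $X$ put $\delta(X)=n|X|-m|R[X]|$. For a hypergraph $A$, all of whose finite substructures have non-negative $\delta$, and a finite $X\subseteq A$, put $d_A(X)=\min\{\delta(Y): X\subseteq Y\subseteq A,\ Y \text{ finite}\}$; for $Z\subseteq A$ put $d_A(X/Z)=\min\{d_A(X\cup Y)-d_A(Y): Y\subseteq Z \text{ finite}\}$ and ${\rm cl}^d_A(Z)=\{a\in A: d_A(\{a\}/Z)=0\}$. Write $Z\le_d A$ if ${\rm cl}^d_A(Z)=Z$. Let $f:\mathbb{R}^{\ge0}\to\mathbb{R}^{\ge0}$ be continuous and strictly increasing with $f(x)\to\infty$ as $x\to\infty$, $f(0)=0$ and $f(1)=n$. Let $\mathcal{C}_f$ be the class of finite $r$-uniform hypergraphs $A$ such that $\delta(X)\ge 0$ and $\delta(X)\ge f(|X|)$ for all $X\subseteq A$. Suppose that $f$ is good, that is, $(\mathcal{C}_f,\le_d)$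 has the free amalgamation property: if $A_0\le_d A_1$ and $A_0\le_d A_2$ with $A_1,A_2\in\mathcal{C}_f$, then the free amalgam $F=A_1\coprod_{A_0}A_2$ (the disjoint union over $A_0$, with only the relations of $A_1$ and of $A_2$) is in $\mathcal{C}_f$ and $A_1,A_2\le_d F$. Suppose also that some structure in $\mathcal{C}_f$ has a hyperedge (equivalently $f(r)\le nr-m$). Let $M_f$ be the generic structure of $(\mathcal{C}_f,\le_d)$: the countable hypergraph, unique up to isomorphism, all of whose finite substructures are in $\mathcal{C}_f$, which is the union of a chain of finite $d$-closed subsets, and which has the property that whenever $X\le_d M_f$ is finite and $X\le_d B\in\mathcal{C}_f$, there is an embedding $\alpha:B\to M_f$ which is the identity on $X$ and satisfies $\alpha(B)\le_d M_f$. Write $G={\rm Aut}(M_f)$, $d=d_{M_f}$, ${\rm cl}^d={\rm cl}^d_{M_f}$ and $\mathcal{X}=\{{\rm cl}^d(X): X\subseteq M_f\text{ finite}\}$. For $A\in\mathcal{X}$, an element $b\in M_f$ is basic over $A$ if $b\notin A$ and, whenever $A\subseteq C\in\mathcal{X}$ and $d(b/C)<d(b/A)$, then $b\in C$. Suppose that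 $M_f$ is monodimensional: for every $A\in\mathcal{X}$ and every $b$ basic over $A$, with $D$ the orbit of $b$ under the pointwise stabiliser of $A$ in $G$, there is $B\in\mathcal{X}$ with $A\subseteq B$ and $M_f={\rm cl}^d(B\cup D)$. Then for every $1\ne g\in G$, every element of $G$ is a product of $192$ conjugates of $g^{\pm1}$ (each factor being a conjugate of $g$ or of $g^{-1}$). In particular, $G$ is a simple group. -/

import Mathlib

open scoped NNReal

/-- An `r`-uniform hypergraph on `V`: the structures in a signature with one `r`-ary relation
symbol `R` that is symmetric and holds only of tuples with distinct entries, given by the set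
`R[V]` of the `r`-subsets on which `R` holds. -/
@[ext]
structure UHypergraph (r : ℕ) (V : Type*) where
  edges : Set (Finset V)
  card_eq : ∀ e ∈ edges, e.card = r

namespace UHypergraph

variable {r : ℕ} {V W : Type*}

/-- The induced substructure on a subset. -/
def induce (H : UHypergraph r V) (S : Set V) : UHypergraph r S where
  edges := {e | e.map (Function.Embedding.subtype (· ∈ S)) ∈ H.edges}
  card_eq e he := by
    have h := H.card_eq _ he
    rwa [Finset.card_map] at h

/-- `φ` is an embedding of structures (an isomorphism onto the induced substructure on its
range). -/
def IsEmb (H : UHypergraph r V) (K : UHypergraph r W) (φ : V ↪ W) : Prop :=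
  ∀ e : Finset V, e ∈ H.edges ↔ e.map φ ∈ K.edges

/-- The automorphism group, as a subgroup of the group of all permutations. -/
def Aut (H : UHypergraph r V) : Subgroup (Equiv.Perm V) where
  carrier := {σ | H.IsEmb H σ.toEmbedding}
  one_mem' := by
    intro e
    have : e.map (Equiv.toEmbedding (1 : Equiv.Perm V)) = e :=
      Finset.map_refl
    rw [this]
  mul_mem' := by
    intro σ τ hσ hτ e
    rw [hτ e, hσ (e.map τ.toEmbedding), Finset.map_map]
    rfl
  inv_mem' := by
    intro σ hσ e
    rw [hσ (e.map (σ⁻¹).toEmbedding), Finset.map_map]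
    have : e.map ((σ⁻¹).toEmbedding.trans σ.toEmbedding) = e := by
      ext x; simp
    rw [this]

open Classical in
/-- The predimension `δ(X) = n |X| - m |R[X]|` of (the substructure on) a finite set `X`. -/
noncomputable def predim (n m : ℕ) (H : UHypergraph r V) (X : Finset V) : ℤ :=
  n * (X.card : ℤ) - m * ((X.powerset.filter (· ∈ H.edges)).card : ℤ)

/-- The dimension `d(X)` of a finite set `X` in `H`: the least predimension of a finite set
containing `X`. -/
noncomputable def dim (n m : ℕ) (H : UHypergraph r V) (X : Finset V) : ℤ :=
  sInf {k | ∃ Y : Finset V, X ⊆ Y ∧ k = predim n m H Y}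

open Classical in
/-- `d(X/Z) = min {d(X ∪ Y) - d(Y) : Y ⊆ Z finite}` for an arbitrary set `Z`. -/
noncomputable def relDim (n m : ℕ) (H : UHypergraph r V) (X : Finset V) (Z : Set V) : ℤ :=
  sInf {k | ∃ Y : Finset V, (Y : Set V) ⊆ Z ∧ k = dim n m H (X ∪ Y) - dim n m H Y}

/-- The `d`-closure `cl^d(Z) = {a : d(a/Z) = 0}`, computed in `H`. -/
def dcl (n m : ℕ) (H : UHypergraph r V) (Z : Set V) : Set V :=
  {a | relDim n m H {a} Z = 0}

/-- `Z ≤_d H`: the set `Z` is `d`-closed in `H`. -/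
def DClosed (n m : ℕ) (H : UHypergraph r V) (Z : Set V) : Prop :=
  dcl n m H Z = Z

/-- The class `C_0` of finite structures in which every subset has non-negative predimension. -/
def InC0 (n m : ℕ) (H : UHypergraph r V) : Prop :=
  Finite V ∧ ∀ X : Finset V, 0 ≤ predim n m H X

/-- The class `C_f`: the structures in `C_0` with `δ(X) ≥ f(|X|)` for every subset `X`. -/
def InCf (n m : ℕ) (f : ℝ≥0 → ℝ≥0) (H : UHypergraph r V) : Prop :=
  InC0 n m H ∧ ∀ X : Finset V, (f (X.card : ℝ≥0) : ℝ) ≤ (predim n m H X : ℝ)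

/-- `F` is the free amalgam of its substructures on `A₁` and `A₂` over their common part
`A₁ ∩ A₂`: its points are those of `A₁` and `A₂`, and its only relations are those on `A₁`
and those on `A₂`. -/
def IsFreeAmalgam (F : UHypergraph r V) (A₁ A₂ : Set V) : Prop :=
  A₁ ∪ A₂ = Set.univ ∧ ∀ e ∈ F.edges, (e : Set V) ⊆ A₁ ∨ (e : Set V) ⊆ A₂

/-- The free `≤_d`-amalgamation property of `C_f`: if `A₀ ≤_d A₁, A₂` are in `C_f` then the free
amalgam `F` of `A₁` and `A₂` over `A₀` is in `C_f` and `A₁, A₂ ≤_d F`.  Every amalgamation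
problem is, up to isomorphism, of the form `A₀ = A₁ ∩ A₂ ⊆ A₁, A₂ ⊆ F` used here. -/
def HasFreeAmalgamation (r n m : ℕ) (f : ℝ≥0 → ℝ≥0) : Prop :=
  ∀ (V : Type) (F : UHypergraph r V) (A₁ A₂ : Set V), F.IsFreeAmalgam A₁ A₂ →
    InCf n m f (F.induce A₁) → InCf n m f (F.induce A₂) →
    DClosed n m (F.induce A₁) (Subtype.val ⁻¹' (A₁ ∩ A₂)) →
    DClosed n m (F.induce A₂) (Subtype.val ⁻¹' (A₁ ∩ A₂)) →
    InCf n m f F ∧ DClosed n m F A₁ ∧ DClosed n m F A₂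

/-- `f` is a good control function: continuous, (strictly) increasing, tending to infinity, and
such that `C_f` has the free `≤_d`-amalgamation property. -/
structure IsGood (r n m : ℕ) (f : ℝ≥0 → ℝ≥0) : Prop where
  continuous : Continuous f
  strictMono : StrictMono f
  tendsto : Filter.Tendsto f Filter.atTop Filter.atTop
  amalgamation : HasFreeAmalgamation r n m f

/-- `H` is the generic structure `M_f` of `(C_f, ≤_d)`: it is countable, its finite substructures
are in `C_f`, it is the union of a chain of finite `d`-closed sets, and whenever `X ≤_d H` is
finite and `X ≤_d K ∈ C_f`, there is an embedding of `K` into `H` over `X` whose image is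
`d`-closed in `H`.  These properties determine `H` up to isomorphism. -/
structure IsGeneric (n m : ℕ) (f : ℝ≥0 → ℝ≥0) (H : UHypergraph r V) : Prop where
  countable : Countable V
  age : ∀ S : Set V, S.Finite → InCf n m f (H.induce S)
  chain : ∃ S : ℕ → Set V, Monotone S ∧ (∀ i, (S i).Finite ∧ DClosed n m H (S i)) ∧
    ⋃ i, S i = Set.univ
  extension : ∀ X : Set V, X.Finite → DClosed n m H X →
    ∀ (B : Type) (K : UHypergraph r B), InCf n m f K →
    ∀ ι : X ↪ B, (H.induce X).IsEmb K ι → DClosed n m K (Set.range ι) →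
    ∃ φ : B ↪ V, K.IsEmb H φ ∧ DClosed n m H (Set.range φ) ∧ ∀ x : X, φ (ι x) = x

/-- The family `𝒳` of the `d`-closures of finite sets. -/
def closedFam (n m : ℕ) (H : UHypergraph r V) : Set (Set V) :=
  {A | ∃ X : Finset V, A = dcl n m H X}

/-- `b` is basic over `A`. -/
def IsBasic (n m : ℕ) (H : UHypergraph r V) (b : V) (A : Set V) : Prop :=
  b ∉ A ∧ ∀ C ∈ closedFam n m H, A ⊆ C → relDim n m H {b} C < relDim n m H {b} A → b ∈ C

/-- `orb(b/A)`: the orbit of `b` under the pointwise stabiliser of `A` in the automorphism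
group. -/
def orb (H : UHypergraph r V) (b : V) (A : Set V) : Set V :=
  {c | ∃ σ ∈ H.Aut, (∀ a ∈ A, σ a = a) ∧ σ b = c}

/-- `H` is monodimensional: for every `A ∈ 𝒳` and every basic orbit `D` over `A` there is
`B ∈ 𝒳` containing `A` such that `cl^d(B, D)` is everything. -/
def Monodimensional (n m : ℕ) (H : UHypergraph r V) : Prop :=
  ∀ A ∈ closedFam n m H, ∀ b : V, IsBasic n m H b A →
    ∃ B ∈ closedFam n m H, A ⊆ B ∧ dcl n m H (B ∪ H.orb b A) = Set.univ

end UHypergraph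

/-!
The finite closed sets of the generic structure, with the dimension `d`, form a geometry on which
the automorphism group acts, and free amalgamation over a common closed part is a stationary
independence relation for it.

Say that an automorphism moves maximally if every type over a closed set `X` has a realisation `A`
that is independent from its image `g A` over `X`, with `g A` independent from `A` over `g X`. If
`k` moves maximally, then four conjugates of `k` compose to any prescribed finite map in generic
position, so a back-and-forth construction writes every automorphism as a product of four conjugates
of `k` and four conjugates of `k⁻¹`.

Let `g` be unbounded: no finite set `B` has `g x ∈ cl (B ∪ {x})` for all points `x`. By
monodimensionality, any finite set lies in the closure of basic points of one fixed kind together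
with finitely many others, and `g` can be made to move such basic points independently of each
other. Hence `g` moves all types to ones that are independent in the sense of the dimension, and
then `u⁻¹ g⁻¹ u g` moves maximally for generic `u`, by Baire category. This gives products of
`2 * 8 = 16` conjugates of `g` and `g⁻¹`, and pairs `g g⁻¹` fill up the remaining `176` factors.

A bounded automorphism is trivial, because every point lies on an edge that is free over that point
from any given finite set.
-/

open scoped Pointwise

section GroupAction

variable {G V : Type*} [Group G] [MulAction G V]

theorem inv_smul_eq_self {σ : G} {x : V} (h : σ • x = x) : σ⁻¹ • x = x :=
  inv_smul_eq_iff.2 h.symm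

theorem conj_smul_eq_smul {e g : G} {x : V} (hx : e • x = x) (hgx : e • g • x = g • x) :
    (e * g * e⁻¹) • x = g • x := by
  rw [mul_smul, mul_smul, inv_smul_eq_self hx, hgx]

theorem inv_conj_mul_inv_eq_conj_inv_conj (k w e : G) :
    (w * e⁻¹)⁻¹ * k * (w * e⁻¹) = e * (w⁻¹ * k * w) * e⁻¹ := by
  group

theorem smul_finset_congr [DecidableEq V] {σ τ : G} {X : Finset V}
    (h : ∀ x ∈ X, σ • x = τ • x) : σ • X = τ • X :=
  Finset.image_congr h

theorem smul_finset_eq_self [DecidableEq V] {σ : G} {X : Finset V}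
    (h : ∀ x ∈ X, σ • x = x) : σ • X = X := by
  rw [smul_finset_congr (τ := 1) (by simpa only [one_smul] using h), one_smul]

variable (G V) in
/-- The image of `G` in the symmetric group of `V` is closed: a sequence `u` that stabilises along
an exhaustion `F` of `V` has a limit in `G`, provided that the limit is surjective, which is what
the last condition ensures. -/
def ClosedAction : Prop :=
  ∀ (u : ℕ → G) (F : ℕ → Finset V), Monotone F →
    (∀ k, ∀ x ∈ F k, u (k + 1) • x = u k • x) → (∀ x, ∃ k, x ∈ F k) →
    (∀ x, ∃ k, (u k)⁻¹ • x ∈ F k) → ∃ v : G, ∀ k, ∀ x ∈ F k, v • x = u k • x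

/-- Baire category for a closed action: countably many conditions, each of which holds on an open
dense set of group elements, hold simultaneously for some group element. -/
theorem ClosedAction.exists_forall_of_dense (hG : ClosedAction G V) [Countable V] {ι : Type*}
    [Countable ι] (P : ι → G → Prop)
    (hP : ∀ (i : ι) (h : G) (D : Finset V), ∃ (h' : G) (D' : Finset V), D ⊆ D' ∧
      (∀ x ∈ D, h' • x = h • x) ∧ ∀ h'' : G, (∀ x ∈ D', h'' • x = h' • x) → P i h'') :
    ∃ h : G, ∀ i, P i h := by
  classical
  rcases isEmpty_or_nonempty ι with hι | hι
  · exact ⟨1, fun i => hι.elim i⟩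
  rcases isEmpty_or_nonempty V with hV | hV
  · refine ⟨1, fun i => ?_⟩
    obtain ⟨h', D', -, -, h⟩ := hP i 1 ∅
    exact h 1 fun x => hV.elim x
  obtain ⟨a, ha⟩ := exists_surjective_nat ι
  obtain ⟨y, hy⟩ := exists_surjective_nat V
  choose approx dom dom_sub approx_eq approx_spec using hP
  let grow : ℕ → G × Finset V → Finset V := fun k s => s.2 ∪ {y k, s.1⁻¹ • y k}
  let stage : ℕ → G × Finset V := fun k => Nat.rec (1, ∅)
    (fun k s => (approx (a k) s.1 (grow k s), dom (a k) s.1 (grow k s))) k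
  have grow_sub : ∀ k, grow k (stage k) ⊆ (stage (k + 1)).2 := fun k => dom_sub _ _ _
  have agree : ∀ k, ∀ x ∈ grow k (stage k), (stage (k + 1)).1 • x = (stage k).1 • x :=
    fun k => approx_eq _ _ _
  obtain ⟨v, hv⟩ := hG (fun k => (stage k).1) (fun k => (stage k).2)
    (monotone_nat_of_le_succ fun k => Finset.subset_union_left.trans (grow_sub k))
    (fun k x hx => agree k x (Finset.mem_union_left _ hx))
    (fun x => by
      obtain ⟨k, rfl⟩ := hy x
      exact ⟨k + 1, grow_sub k (by simp [grow])⟩)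
    (fun x => by
      obtain ⟨k, rfl⟩ := hy x
      have mem : (stage k).1⁻¹ • y k ∈ grow k (stage k) := by simp [grow]
      refine ⟨k + 1, ?_⟩
      rw [inv_smul_eq_iff.2 ((smul_inv_smul _ _).symm.trans (agree k _ mem).symm)]
      exact grow_sub k mem)
  refine ⟨v, fun i => ?_⟩
  obtain ⟨k, rfl⟩ := ha i
  exact approx_spec (a k) (stage k).1 (grow k (stage k)) v (hv (k + 1))

end GroupAction

/-- A `G`-invariant, monotone, submodular dimension `d` on the finite subsets of a `G`-set, for
which the closure `cl X`, the set of all points that do not raise the dimension of `X`, is finite,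
and empty for `X = ∅`. -/
structure DimGeometry (G V : Type*) [Group G] [MulAction G V] [DecidableEq V] where
  d : Finset V → ℤ
  cl : Finset V → Finset V
  d_mono : ∀ {X Y}, X ⊆ Y → d X ≤ d Y
  d_submod : ∀ X Y, d (X ∪ Y) + d (X ∩ Y) ≤ d X + d Y
  d_smul : ∀ (σ : G) X, d (σ • X) = d X
  mem_cl_iff : ∀ {x X}, x ∈ cl X ↔ d (insert x X) ≤ d X
  cl_empty : cl ∅ = ∅

namespace DimGeometry

variable {G V : Type*} [Group G] [MulAction G V] [DecidableEq V] (S : DimGeometry G V)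

theorem subset_cl (X : Finset V) : X ⊆ S.cl X := fun x hx =>
  S.mem_cl_iff.2 (by rw [Finset.insert_eq_self.2 hx])

theorem d_union_of_subset_cl {X Y : Finset V} (h : Y ⊆ S.cl X) : S.d (X ∪ Y) = S.d X := by
  induction Y using Finset.induction_on with
  | empty => rw [Finset.union_empty]
  | insert y Y _ ih =>
    rw [Finset.insert_subset_iff] at h
    have hy : S.d (insert y X) ≤ S.d X := S.mem_cl_iff.1 h.1
    have submod := S.d_submod (X ∪ Y) (insert y X)
    have mono : S.d X ≤ S.d ((X ∪ Y) ∩ insert y X) :=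
      S.d_mono (Finset.subset_inter Finset.subset_union_left (Finset.subset_insert _ _))
    have e : X ∪ Y ∪ insert y X = X ∪ insert y Y := by grind
    rw [e, ih h.2] at submod
    exact le_antisymm (by linarith) (S.d_mono Finset.subset_union_left)

theorem d_cl (X : Finset V) : S.d (S.cl X) = S.d X := by
  rw [← Finset.union_eq_right.2 (S.subset_cl X), S.d_union_of_subset_cl subset_rfl]

theorem d_eq {X Y : Finset V} (h : X ⊆ Y) (h' : Y ⊆ S.cl X) : S.d Y = S.d X :=
  le_antisymm (S.d_cl X ▸ S.d_mono h') (S.d_mono h)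

theorem cl_subset_cl {X Y : Finset V} (h : X ⊆ S.cl Y) : S.cl X ⊆ S.cl Y := by
  intro x hx
  have submod := S.d_submod (S.cl Y) (insert x X)
  have mono : S.d X ≤ S.d (S.cl Y ∩ insert x X) :=
    S.d_mono (Finset.subset_inter h (Finset.subset_insert _ _))
  have sub : insert x Y ⊆ S.cl Y ∪ insert x X := by
    have := S.subset_cl Y
    grind
  have hx' := S.mem_cl_iff.1 hx
  rw [S.mem_cl_iff]
  linarith [S.d_mono sub, S.d_cl Y]

theorem cl_mono {X Y : Finset V} (h : X ⊆ Y) : S.cl X ⊆ S.cl Y :=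
  S.cl_subset_cl (h.trans (S.subset_cl Y))

theorem cl_cl (X : Finset V) : S.cl (S.cl X) = S.cl X :=
  (S.cl_subset_cl subset_rfl).antisymm (S.subset_cl _)

theorem subset_cl_union_left {X Y : Finset V} : X ⊆ S.cl (X ∪ Y) :=
  Finset.subset_union_left.trans (S.subset_cl _)

theorem subset_cl_union_right {X Y : Finset V} : Y ⊆ S.cl (X ∪ Y) :=
  Finset.subset_union_right.trans (S.subset_cl _)

theorem smul_mem_cl_smul {σ : G} {x : V} {X : Finset V} (h : x ∈ S.cl X) :
    σ • x ∈ S.cl (σ • X) := by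
  rw [S.mem_cl_iff, ← Finset.smul_finset_insert, S.d_smul, S.d_smul]
  exact S.mem_cl_iff.1 h

theorem smul_cl (σ : G) (X : Finset V) : σ • S.cl X = S.cl (σ • X) := by
  refine subset_antisymm (fun x hx => ?_) fun x hx => ?_
  · obtain ⟨y, hy, rfl⟩ := Finset.mem_smul_finset.1 hx
    exact S.smul_mem_cl_smul hy
  · rw [← Finset.inv_smul_mem_iff]
    simpa only [inv_smul_smul] using S.smul_mem_cl_smul (σ := σ⁻¹) hx

theorem cl_smul_eq {X : Finset V} (h : S.cl X = X) (σ : G) : S.cl (σ • X) = σ • X := by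
  rw [← S.smul_cl, h]

/-- The relative dimension `d(A/B)`. -/
def rel (A B : Finset V) : ℤ := S.d (A ∪ B) - S.d B

theorem rel_nonneg (A B : Finset V) : 0 ≤ S.rel A B :=
  sub_nonneg.2 (S.d_mono Finset.subset_union_right)

theorem rel_anti (A : Finset V) {B B' : Finset V} (h : B ⊆ B') : S.rel A B' ≤ S.rel A B := by
  have submod := S.d_submod (A ∪ B) B'
  have mono : S.d B ≤ S.d ((A ∪ B) ∩ B') :=
    S.d_mono (Finset.subset_inter Finset.subset_union_right h)
  rw [Finset.union_assoc, Finset.union_eq_right.2 h] at submod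
  unfold rel
  linarith

theorem rel_mono {A A' : Finset V} (B : Finset V) (h : A ⊆ A') : S.rel A B ≤ S.rel A' B :=
  sub_le_sub_right (S.d_mono (Finset.union_subset_union_left h)) _

theorem rel_union (A A' B : Finset V) :
    S.rel (A ∪ A') B = S.rel A' B + S.rel A (A' ∪ B) := by
  unfold rel
  rw [Finset.union_assoc]
  ring

theorem rel_congr_right (A : Finset V) {B B' : Finset V} (h : B ⊆ B') (h' : B' ⊆ S.cl B) :
    S.rel A B' = S.rel A B := by
  unfold rel
  rw [S.d_eq h h', S.d_eq (Finset.union_subset_union_right (s := A) h)]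
  exact Finset.union_subset S.subset_cl_union_left
    (h'.trans (S.cl_mono Finset.subset_union_right))

theorem rel_cl_right (A B : Finset V) : S.rel A (S.cl B) = S.rel A B :=
  S.rel_congr_right A (S.subset_cl B) subset_rfl

theorem rel_smul (σ : G) (A B : Finset V) : S.rel (σ • A) (σ • B) = S.rel A B := by
  unfold rel
  rw [← Finset.smul_finset_union, S.d_smul, S.d_smul]

theorem rel_eq_zero_of_subset {A B : Finset V} (h : A ⊆ S.cl B) : S.rel A B = 0 := by
  unfold rel
  rw [S.d_eq Finset.subset_union_right (Finset.union_subset h (S.subset_cl B)), sub_self]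

theorem mem_cl_of_rel_le {x : V} {B : Finset V} (h : S.rel {x} B ≤ 0) : x ∈ S.cl B :=
  S.mem_cl_iff.2 (sub_nonpos.1 h)

/-- `A` and `C` are independent over `B` in the sense of the dimension. -/
def DimIndep (A B C : Finset V) : Prop := S.rel A (B ∪ C) = S.rel A B

variable {S}

theorem dimIndep_iff {A B C : Finset V} :
    S.DimIndep A B C ↔ S.d (A ∪ B ∪ C) + S.d B = S.d (A ∪ B) + S.d (B ∪ C) := by
  unfold DimIndep rel
  rw [← Finset.union_assoc]
  constructor <;> intro h <;> linarith

theorem dimIndep_of_le {A B C : Finset V} (h : S.rel A B ≤ S.rel A (B ∪ C)) :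
    S.DimIndep A B C :=
  le_antisymm (S.rel_anti A Finset.subset_union_left) h

namespace DimIndep

theorem symm {A B C : Finset V} (h : S.DimIndep A B C) : S.DimIndep C B A := by
  rw [dimIndep_iff] at *
  rw [show C ∪ B ∪ A = A ∪ B ∪ C by ac_rfl, Finset.union_comm C B, Finset.union_comm B A]
  linarith

theorem smul (σ : G) {A B C : Finset V} (h : S.DimIndep A B C) :
    S.DimIndep (σ • A) (σ • B) (σ • C) := by
  unfold DimIndep at *
  rw [← Finset.smul_finset_union, S.rel_smul, S.rel_smul, h]

theorem mono_right {A B C C' : Finset V} (h : S.DimIndep A B C) (hC : C' ⊆ S.cl (C ∪ B)) :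
    S.DimIndep A B C' := by
  apply dimIndep_of_le
  rw [← h, ← S.rel_cl_right A (B ∪ C)]
  refine S.rel_anti A (Finset.union_subset S.subset_cl_union_left ?_)
  rwa [Finset.union_comm B C]

theorem mono {A B C A' C' : Finset V} (h : S.DimIndep A B C) (hA : A' ⊆ S.cl (A ∪ B))
    (hC : C' ⊆ S.cl (C ∪ B)) : S.DimIndep A' B C' :=
  ((h.mono_right hC).symm.mono_right hA).symm

theorem between {A B B' B'' C : Finset V} (h : S.DimIndep A B B'') (h' : S.DimIndep A B'' C)
    (h₁ : B ⊆ B') (h₂ : B' ⊆ S.cl B'') : S.DimIndep A B' C := by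
  have sub : B' ∪ C ⊆ S.cl (B'' ∪ C) :=
    Finset.union_subset (h₂.trans (S.cl_mono Finset.subset_union_left)) S.subset_cl_union_right
  apply dimIndep_of_le
  calc S.rel A B' ≤ S.rel A B := S.rel_anti A h₁
    _ = S.rel A (B ∪ B'') := Eq.symm h
    _ ≤ S.rel A B'' := S.rel_anti A Finset.subset_union_right
    _ = S.rel A (S.cl (B'' ∪ C)) := by rw [S.rel_cl_right, h']
    _ ≤ S.rel A (B' ∪ C) := S.rel_anti A sub

theorem mem_cl {A B C : Finset V} (h : S.DimIndep A B C) {x : V} (hA : x ∈ S.cl (A ∪ B))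
    (hC : x ∈ S.cl (C ∪ B)) : x ∈ S.cl B := by
  have self_indep : S.DimIndep {x} B {x} :=
    h.mono (Finset.singleton_subset_iff.2 hA) (Finset.singleton_subset_iff.2 hC)
  apply S.mem_cl_of_rel_le
  rw [← self_indep, S.rel_eq_zero_of_subset S.subset_cl_union_right]

end DimIndep

end DimGeometry

/-! ### Maximally moving elements -/

/-- A dimension geometry with a stationary independence relation: `Ind A B C` says that `A` is
independent from `C` over `B`. It refines independence in the sense of the dimension. -/
structure IndepGeometry (G V : Type*) [Group G] [MulAction G V] [DecidableEq V] extends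
    DimGeometry G V where
  Ind : Finset V → Finset V → Finset V → Prop
  ind_smul : ∀ (σ : G) {A B C}, Ind A B C → Ind (σ • A) (σ • B) (σ • C)
  ind_symm : ∀ {A B C}, Ind A B C → Ind C B A
  ind_mono : ∀ {A B C A' C'}, Ind A B C → A' ⊆ cl (A ∪ B) → C' ⊆ cl (C ∪ B) → Ind A' B C'
  ind_trans : ∀ {A B C B₁ D}, Ind A B C → Ind A B₁ D → cl B₁ = cl (B ∪ C) → Ind A B (C ∪ D)
  ind_exists : ∀ A B C, ∃ σ : G, (∀ x ∈ cl B, σ • x = x) ∧ Ind (σ • A) B C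
  ind_stationary : ∀ {A B C} (α β : G), Ind A B C → Ind (α • A) (α • B) (β • C) →
    (∀ x ∈ cl B, α • x = β • x) →
    ∃ γ : G, (∀ x ∈ cl (A ∪ B), γ • x = α • x) ∧ ∀ x ∈ cl (C ∪ B), γ • x = β • x
  dimIndep_of_ind : ∀ {A B C}, Ind A B C → toDimGeometry.DimIndep A B C
  ind_of_dimIndep : ∀ {A B C D}, toDimGeometry.DimIndep A B C → toDimGeometry.DimIndep D B C →
    Ind A (B ∪ C) D → Ind A B D

namespace IndepGeometry

variable {G V : Type*} [Group G] [MulAction G V] [DecidableEq V] {S : IndepGeometry G V}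

theorem Ind.subset {A B C A' C' : Finset V} (h : S.Ind A B C) (hA : A' ⊆ A) (hC : C' ⊆ C) :
    S.Ind A' B C' :=
  S.ind_mono h (hA.trans S.subset_cl_union_left) (hC.trans S.subset_cl_union_left)

theorem Ind.trans_right {A B C D B₁ : Finset V} (h : S.Ind A B C) (h' : S.Ind A B₁ D)
    (e : S.cl B₁ = S.cl (B ∪ C)) : S.Ind A B D :=
  (S.ind_trans h h' e).subset subset_rfl Finset.subset_union_right

variable (S) in
theorem ind_empty_left (B C : Finset V) : S.Ind ∅ B C := by
  obtain ⟨σ, -, h⟩ := S.ind_exists ∅ B C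
  rwa [Finset.smul_finset_empty] at h

variable (S) in
/-- `g` moves maximally: over every closed `X`, every type has a realisation `A` such that `A` is
independent from `g A` over `X`, and `g A` is independent from `A` over `g X`. -/
def MovesMax (g : G) : Prop :=
  ∀ X T : Finset V, S.cl X = X → ∃ σ : G, (∀ x ∈ X, σ • x = x) ∧
    S.Ind (σ • T) X (g • σ • T) ∧ S.Ind (g • σ • T) (g • X) (σ • T)

namespace MovesMax

variable {g h : G}

theorem inv (hg : S.MovesMax g) : S.MovesMax g⁻¹ := by
  intro X T hX
  obtain ⟨σ, hσ, ind, ind'⟩ := hg (g⁻¹ • X) (g⁻¹ • T) (S.cl_smul_eq hX _)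
  have eT : (g * σ * g⁻¹) • T = g • σ • g⁻¹ • T := by simp only [mul_smul]
  rw [smul_inv_smul] at ind'
  refine ⟨g * σ * g⁻¹, fun x hx => ?_, ?_, ?_⟩
  · rw [mul_smul, mul_smul, hσ _ (Finset.smul_mem_smul_finset hx), smul_inv_smul]
  · rwa [eT, inv_smul_smul]
  · rwa [eT, inv_smul_smul]

theorem conj (hg : S.MovesMax g) (u : G) : S.MovesMax (u * g * u⁻¹) := by
  intro X T hX
  obtain ⟨σ, hσ, ind, ind'⟩ := hg (u⁻¹ • X) (u⁻¹ • T) (S.cl_smul_eq hX _)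
  have eT : (u * σ * u⁻¹) • T = u • σ • u⁻¹ • T := by simp only [mul_smul]
  have egT : (u * g * u⁻¹) • u • σ • u⁻¹ • T = u • g • σ • u⁻¹ • T := by
    simp only [mul_smul, inv_smul_smul]
  have egX : (u * g * u⁻¹) • X = u • g • u⁻¹ • X := by simp only [mul_smul]
  refine ⟨u * σ * u⁻¹, fun x hx => ?_, ?_, ?_⟩
  · rw [mul_smul, mul_smul, hσ _ (Finset.smul_mem_smul_finset hx), smul_inv_smul]
  · rw [eT, egT]
    simpa only [smul_inv_smul] using S.ind_smul u ind
  · rw [eT, egT, egX]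
    exact S.ind_smul u ind'

theorem inv_conj (hg : S.MovesMax g) (u : G) : S.MovesMax (u⁻¹ * g * u) := by
  simpa only [inv_inv] using hg.conj u⁻¹

theorem exists_smul_ind (hg : S.MovesMax g) {X T : Finset V} (hT : S.Ind T X (g • X)) :
    ∃ σ : G, (∀ x ∈ X ∪ g • X, σ • x = x) ∧ S.Ind (g • σ • T) (g • X) (σ • T) := by
  obtain ⟨σ, hσ, -, ind⟩ := hg (S.cl (X ∪ g • X)) T (S.cl_cl _)
  have fix : ∀ x ∈ X ∪ g • X, σ • x = x := fun x hx => hσ x (S.subset_cl _ hx)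
  have ind_gX := S.ind_smul g (S.ind_smul σ hT)
  rw [smul_finset_eq_self fun x hx => fix x (Finset.mem_union_left _ hx),
    smul_finset_eq_self fun x hx => fix x (Finset.mem_union_right _ hx)] at ind_gX
  refine ⟨σ, fix, ind_gX.trans_right ind ?_⟩
  rw [S.smul_cl, S.cl_cl, Finset.smul_finset_union]

theorem exists_conj_eq (hg : S.MovesMax g) {X T : Finset V} (hX : S.cl X = X)
    (hXT : X ⊆ T) {θ : G} (hθ : ∀ x ∈ X, θ • x = g • x) (hT : S.Ind T X (g • X))
    (hθT : S.Ind (θ • T) (g • X) T) :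
    ∃ e : G, (∀ x ∈ X ∪ g • X, e • x = x) ∧ ∀ x ∈ T, (e * g * e⁻¹) • x = θ • x := by
  obtain ⟨σ, hσ, ind⟩ := hg.exists_smul_ind hT
  have fix : ∀ x ∈ X, σ • x = x := fun x hx => hσ x (Finset.mem_union_left _ hx)
  have fix_g : ∀ x ∈ g • X, σ • x = x := fun x hx => hσ x (Finset.mem_union_right _ hx)
  have fix_θ : ∀ x ∈ g • X, (θ * σ⁻¹ * g⁻¹) • x = x := by
    intro x hx
    obtain ⟨y, hy, rfl⟩ := Finset.mem_smul_finset.1 hx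
    rw [mul_smul, mul_smul, inv_smul_smul, inv_smul_eq_self (fix y hy), hθ y hy]
  obtain ⟨e, e_left, e_right⟩ := S.ind_stationary (θ * σ⁻¹ * g⁻¹) σ⁻¹ ind (by
      rw [smul_finset_eq_self fix_θ]
      simpa only [mul_smul, inv_smul_smul] using hθT) (by
      rw [S.cl_smul_eq hX g]
      intro x hx
      rw [fix_θ x hx, inv_smul_eq_self (fix_g x hx)])
  have X_sub : X ⊆ σ • T := by
    rw [← smul_finset_eq_self fix]
    exact Finset.smul_finset_subset_smul_finset hXT
  refine ⟨e, fun x hx => ?_, fun x hx => ?_⟩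
  · have mem : x ∈ σ • T ∪ g • X := Finset.union_subset_union_left X_sub hx
    rw [e_right x (S.subset_cl _ mem), inv_smul_eq_self (hσ x hx)]
  · have mem : σ • x ∈ σ • T := Finset.smul_mem_smul_finset hx
    have inv_e : e⁻¹ • x = σ • x := by
      rw [inv_smul_eq_iff, e_right _ (S.subset_cl_union_left mem), inv_smul_smul]
    rw [mul_smul, mul_smul, inv_e,
      e_left _ (S.subset_cl_union_left (Finset.smul_mem_smul_finset mem))]
    simp only [mul_smul, inv_smul_smul]

theorem exists_conj_ind (hg : S.MovesMax g) {X X' : Finset V}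
    (hX' : S.Ind (g • X ∪ X') (g • X) (g • (g • X ∪ X'))) (T : Finset V) :
    ∃ e : G, (∀ x ∈ X ∪ g • X, e • x = x) ∧ S.Ind ((e * g * e⁻¹) • T) (g • X) X' := by
  set Z := S.cl (X ∪ (g • X ∪ X')) with hZ
  obtain ⟨σ, hσ, -, ind⟩ := hg Z (Z ∪ T) (S.cl_cl _)
  have fix : ∀ x ∈ X ∪ (g • X ∪ X'), σ • x = x := fun x hx => hσ x (S.subset_cl _ hx)
  have fix_X' : ∀ x ∈ X', σ • x = x := fun x hx => fix x (by simp [hx])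
  have fix_gX : ∀ x ∈ g • X, σ • x = x := fun x hx => fix x (by simp [hx])
  have X'_sub : X' ⊆ σ • (Z ∪ T) := by
    rw [← smul_finset_eq_self fix_X']
    refine Finset.smul_finset_subset_smul_finset (subset_trans ?_ Finset.subset_union_left)
    exact Finset.subset_union_right.trans S.subset_cl_union_right
  have ind_gZ : S.Ind X' (g • Z) (g • σ • T) :=
    (S.ind_symm ind).subset X'_sub (Finset.smul_finset_subset_smul_finset
      (Finset.smul_finset_subset_smul_finset Finset.subset_union_right))
  have ind_gX : S.Ind X' (g • X) (g • σ • T) := by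
    refine (hX'.subset Finset.subset_union_right subset_rfl).trans_right ind_gZ ?_
    rw [hZ, S.smul_cl, S.cl_cl, Finset.smul_finset_union]
  refine ⟨σ⁻¹, fun x hx => inv_smul_eq_self (fix x ?_), ?_⟩
  · exact Finset.union_subset_union_right Finset.subset_union_left hx
  · have := S.ind_symm (S.ind_smul σ⁻¹ ind_gX)
    rw [smul_finset_eq_self fun x hx => inv_smul_eq_self (fix_X' x hx),
      smul_finset_eq_self fun x hx => inv_smul_eq_self (fix_gX x hx)] at this
    simpa only [mul_smul, inv_inv] using this

theorem exists_conj_ind_smul (hg : S.MovesMax g) {X : Finset V} (hX : S.cl X = X)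
    (T : Finset V) :
    ∃ e : G, (∀ x ∈ X, e • x = x) ∧ S.Ind T X ((e * g * e⁻¹) • T) := by
  obtain ⟨σ, hσ, ind, -⟩ := hg X T hX
  have fix : ∀ x ∈ X, σ⁻¹ • x = x := fun x hx => inv_smul_eq_self (hσ x hx)
  refine ⟨σ⁻¹, fix, ?_⟩
  have := S.ind_smul σ⁻¹ ind
  rw [smul_finset_eq_self fix, inv_smul_smul] at this
  simpa only [mul_smul, inv_inv] using this

/-- The two maps meet in a copy of the middle set that is free over `g • X` from both ends. -/
theorem exists_conj_mul_conj_eq (hg : S.MovesMax g) (hh : S.MovesMax h) {X A : Finset V}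
    (hX : S.cl X = X) (hXA : X ⊆ A) {φ : G} (hφ : ∀ x ∈ X, φ • x = h • g • x)
    (hA : S.Ind A X (g • X)) (hφA : S.Ind (φ • A) (h • g • X) (g • X)) :
    ∃ a b : G, (∀ x ∈ X ∪ g • X, a • x = x) ∧ (∀ x ∈ g • X ∪ h • g • X, b • x = x) ∧
      ∀ x ∈ A, (b * h * b⁻¹) • (a * g * a⁻¹) • x = φ • x := by
  have φX : φ • X = h • g • X := by
    rw [smul_finset_congr (τ := h * g) (by simpa only [mul_smul] using hφ), mul_smul]
  have cl_gX : S.cl (g • X) = g • X := S.cl_smul_eq hX g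
  obtain ⟨τ, hτ, ind⟩ := S.ind_exists (g • A) (g • X) (A ∪ φ • A)
  rw [cl_gX] at hτ
  obtain ⟨a, fix_a, ha⟩ := hg.exists_conj_eq (θ := τ * g) hX hXA
    (fun x hx => by rw [mul_smul, hτ _ (Finset.smul_mem_smul_finset hx)]) hA
    (by
      rw [mul_smul]
      exact ind.subset subset_rfl Finset.subset_union_left)
  obtain ⟨b, fix_b, hb⟩ := hh.inv.exists_conj_eq (θ := τ * g * φ⁻¹) (X := h • g • X)
    (T := φ • A) (S.cl_smul_eq cl_gX h)
    (φX ▸ Finset.smul_finset_subset_smul_finset hXA)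
    (fun x hx => by
      rw [← φX] at hx
      obtain ⟨y, hy, rfl⟩ := Finset.mem_smul_finset.1 hx
      rw [mul_smul, mul_smul, inv_smul_smul, hφ y hy, inv_smul_smul,
        hτ _ (Finset.smul_mem_smul_finset hy)])
    (by rwa [inv_smul_smul])
    (by
      rw [inv_smul_smul, mul_smul, mul_smul, inv_smul_smul]
      exact ind.subset subset_rfl Finset.subset_union_right)
  rw [inv_smul_smul, Finset.union_comm] at fix_b
  refine ⟨a, b, fix_a, fix_b, fun x hx => ?_⟩
  have hbx := hb _ (Finset.smul_mem_smul_finset hx)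
  rw [← conj_inv, inv_smul_eq_iff, mul_smul (τ * g), inv_smul_smul] at hbx
  rw [ha x hx, hbx]

/-- The hypotheses `p₁` and `p₄` say that the first and the last map of the chain
`X → X₁ → X₂ → X₃ → X₄` are in generic position. -/
theorem exists_conj_prod_eq {g₁ g₂ g₃ g₄ : G} (h₁ : S.MovesMax g₁) (h₂ : S.MovesMax g₂)
    (h₃ : S.MovesMax g₃) (h₄ : S.MovesMax g₄) {X X₁ X₂ X₃ X₄ : Finset V} (hX : S.cl X = X)
    (e₁ : g₁ • X = X₁) (e₂ : g₂ • X₁ = X₂) (e₃ : g₃ • X₂ = X₃) (e₄ : g₄ • X₃ = X₄)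
    (p₁ : S.Ind (X₁ ∪ X₂) X₁ (g₁ • (X₁ ∪ X₂))) (p₄ : S.Ind (X₂ ∪ X₃) X₃ (g₄⁻¹ • (X₂ ∪ X₃)))
    {T : Finset V} (hXT : X ⊆ T) {θ : G} (hθ : ∀ x ∈ X, θ • x = g₄ • g₃ • g₂ • g₁ • x) :
    ∃ a₁ a₂ a₃ a₄ : G, (∀ x ∈ X ∪ X₁, a₁ • x = x) ∧ (∀ x ∈ X₁ ∪ X₂, a₂ • x = x) ∧
      (∀ x ∈ X₂ ∪ X₃, a₃ • x = x) ∧ (∀ x ∈ X₃ ∪ X₄, a₄ • x = x) ∧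
      ∀ x ∈ T, (a₄ * g₄ * a₄⁻¹) • (a₃ * g₃ * a₃⁻¹) • (a₂ * g₂ * a₂⁻¹) • (a₁ * g₁ * a₁⁻¹) • x =
        θ • x := by
  subst e₁ e₂ e₃ e₄
  obtain ⟨a₁, fix₁, ind₁⟩ := h₁.exists_conj_ind p₁ T
  obtain ⟨a₄, fix₄, ind₄⟩ := h₄.inv.exists_conj_ind (X := g₄ • g₃ • g₂ • g₁ • X)
    (X' := g₂ • g₁ • X) (by rwa [inv_smul_smul, Finset.union_comm]) (θ • T)
  rw [inv_smul_smul, Finset.union_comm] at fix₄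
  rw [inv_smul_smul, ← conj_inv] at ind₄
  set k₁ := a₁ * g₁ * a₁⁻¹
  set k₄ := a₄ * g₄ * a₄⁻¹
  have k₁_eq : ∀ x ∈ X, k₁ • x = g₁ • x := fun x hx =>
    conj_smul_eq_smul (fix₁ x (Finset.mem_union_left _ hx))
      (fix₁ _ (Finset.mem_union_right _ (Finset.smul_mem_smul_finset hx)))
  have k₄_eq : ∀ x ∈ g₃ • g₂ • g₁ • X, k₄ • x = g₄ • x := fun x hx =>
    conj_smul_eq_smul (fix₄ x (Finset.mem_union_left _ hx))
      (fix₄ _ (Finset.mem_union_right _ (Finset.smul_mem_smul_finset hx)))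
  obtain ⟨a₂, a₃, fix₂, fix₃, h⟩ := h₂.exists_conj_mul_conj_eq h₃ (X := g₁ • X) (A := k₁ • T)
    (φ := k₄⁻¹ * θ * k₁⁻¹) (S.cl_smul_eq hX g₁)
    (by
      rw [← smul_finset_congr k₁_eq]
      exact Finset.smul_finset_subset_smul_finset hXT)
    (fun x hx => by
      obtain ⟨y, hy, rfl⟩ := Finset.mem_smul_finset.1 hx
      rw [← k₁_eq y hy, mul_smul, mul_smul, inv_smul_smul, hθ y hy, inv_smul_eq_iff, k₄_eq,
        k₁_eq y hy]
      simpa only [k₁_eq y hy, Finset.smul_mem_smul_finset_iff] using hy)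
    ind₁ (by simpa only [mul_smul, inv_smul_smul] using ind₄)
  refine ⟨a₁, a₂, a₃, a₄, fix₁, fix₂, fix₃, fix₄, fun x hx => ?_⟩
  rw [h _ (Finset.smul_mem_smul_finset hx), mul_smul (k₄⁻¹ * θ), inv_smul_smul, mul_smul k₄⁻¹,
    smul_inv_smul]

end MovesMax

end IndepGeometry

namespace IndepGeometry

/-- Four group elements `w i`, used to conjugate a fixed element `k`, and a finite set `X`, on
which the conjugates are applied successively. It is a finite approximation to four conjugates of
`k`: only the values of `w i` on `dom k i` matter. -/
structure Chain (G V : Type*) where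
  w : Fin 4 → G
  X : Finset V

namespace Chain

section Group

variable {G V : Type*} [Group G] (k : G) (c : Chain G V)

/-- The conjugate of `k` by `(w i)⁻¹`. -/
def conj (i : Fin 4) : G := (c.w i)⁻¹ * k * c.w i

/-- The product of the first `i` conjugates, the first one acting first. -/
def partialProd : Fin 5 → G := Fin.induction 1 fun i γ => c.conj k i * γ

/-- The product of the four conjugates. -/
def prod : G := c.partialProd k 4

theorem partialProd_succ (i : Fin 4) :
    c.partialProd k i.succ = c.conj k i * c.partialProd k i.castSucc :=
  rfl

theorem prod_eq_mul : c.prod k = c.conj k 3 * c.conj k 2 * c.conj k 1 * c.conj k 0 := by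
  change c.conj k 3 * (c.conj k 2 * (c.conj k 1 * (c.conj k 0 * 1))) = _
  simp only [mul_one, mul_assoc]

variable {c} in
theorem prod_congr {c' : Chain G V} (h : c'.w = c.w) : c'.prod k = c.prod k := by
  simp only [prod_eq_mul, conj, h]

variable {k c} in
theorem conj_smul_congr [MulAction G V] {c' : Chain G V} {i : Fin 4} {x : V}
    (h : c'.w i • x = c.w i • x) (h' : c'.w i • c.conj k i • x = c.w i • c.conj k i • x) :
    c'.conj k i • x = c.conj k i • x := by
  rw [conj, mul_smul, mul_smul, inv_smul_eq_iff, h, h']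
  simp only [conj, mul_smul, smul_inv_smul]

end Group

variable {G V : Type*} [Group G] [MulAction G V] [DecidableEq V] {S : IndepGeometry G V}

variable (k : G) (c c' : Chain G V)

/-- The image of `X` under the first `i` conjugates. -/
def img (i : Fin 5) : Finset V := c.partialProd k i • c.X

/-- The source and the target of the `i`-th conjugate in the chain. -/
def dom (i : Fin 4) : Finset V := c.img k i.castSucc ∪ c.img k i.succ

/-- The chain `c'` has the larger set, and agrees with `c` on the sets occurring in `c`. -/
structure Extends : Prop where
  sub : c.X ⊆ c'.X
  eq : ∀ i, ∀ x ∈ c.dom k i, c'.w i • x = c.w i • x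

/-- The first and the last map of the chain are in generic position. -/
structure Prepared (S : IndepGeometry G V) : Prop where
  closed : S.cl c.X = c.X
  ind_first : S.Ind (c.dom k 1) (c.img k 1) (c.conj k 0 • c.dom k 1)
  ind_last : S.Ind (c.dom k 2) (c.img k 3) ((c.conj k 3)⁻¹ • c.dom k 2)

/-- The point `y` is in the domain and range of all the maps determined by the chain. -/
structure Covers (y : V) : Prop where
  mem : y ∈ c.X
  mem_dom : ∀ i, y ∈ c.dom k i
  inv_smul_mem_dom : ∀ i, (c.w i)⁻¹ • y ∈ c.dom k i

theorem img_zero : c.img k 0 = c.X :=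
  one_smul G c.X

theorem img_succ (i : Fin 4) : c.img k i.succ = c.conj k i • c.img k i.castSucc := by
  rw [img, partialProd_succ, mul_smul, img]

theorem cl_img (h : S.cl c.X = c.X) (i : Fin 5) : S.cl (c.img k i) = c.img k i :=
  S.cl_smul_eq h _

variable {k c c'}

namespace Extends

theorem conj_eq (h : Extends k c c') {i : Fin 4} {x : V} (hx : x ∈ c.img k i.castSucc) :
    c'.conj k i • x = c.conj k i • x := by
  refine conj_smul_congr (h.eq i x (Finset.mem_union_left _ hx))
    (h.eq i _ (Finset.mem_union_right _ ?_))
  rw [img_succ]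
  exact Finset.smul_mem_smul_finset hx

theorem partialProd_eq (h : Extends k c c') (i : Fin 5) {x : V} (hx : x ∈ c.X) :
    c'.partialProd k i • x = c.partialProd k i • x := by
  induction i using Fin.induction with
  | zero => rfl
  | succ i ih =>
    rw [partialProd_succ, partialProd_succ, mul_smul, mul_smul, ih,
      h.conj_eq (Finset.smul_mem_smul_finset hx)]

theorem prod_eq (h : Extends k c c') {x : V} (hx : x ∈ c.X) : c'.prod k • x = c.prod k • x :=
  h.partialProd_eq 4 hx

theorem img_sub (h : Extends k c c') (i : Fin 5) : c.img k i ⊆ c'.img k i := by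
  rw [img, ← smul_finset_congr fun x hx => h.partialProd_eq i hx]
  exact Finset.smul_finset_subset_smul_finset h.sub

theorem dom_sub (h : Extends k c c') (i : Fin 4) : c.dom k i ⊆ c'.dom k i :=
  Finset.union_subset_union (h.img_sub _) (h.img_sub _)

theorem trans {c'' : Chain G V} (h : Extends k c c') (h' : Extends k c' c'') :
    Extends k c c'' where
  sub := h.sub.trans h'.sub
  eq i x hx := by rw [h'.eq i x (h.dom_sub i hx), h.eq i x hx]

end Extends

theorem Covers.of_extends {y : V} (h : Extends k c c') (hc : c.Covers k y) : c'.Covers k y where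
  mem := h.sub hc.mem
  mem_dom i := h.dom_sub i (hc.mem_dom i)
  inv_smul_mem_dom i := by
    have mem := hc.inv_smul_mem_dom i
    rw [inv_smul_eq_iff.2 ((smul_inv_smul _ y).symm.trans (h.eq i _ mem).symm)]
    exact h.dom_sub i mem

theorem Prepared.exists_extends (hk : S.MovesMax k) (hc : c.Prepared k S) {T : Finset V}
    (hT : c.X ⊆ T) {θ : G} (hθ : ∀ x ∈ c.X, θ • x = c.prod k • x) :
    ∃ c' : Chain G V, Extends k c c' ∧ c'.X = T ∧ ∀ x ∈ T, c'.prod k • x = θ • x := by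
  have moves : ∀ i, S.MovesMax (c.conj k i) := fun i => hk.inv_conj _
  obtain ⟨a₀, a₁, a₂, a₃, fix₀, fix₁, fix₂, fix₃, h⟩ :=
    (moves 0).exists_conj_prod_eq (moves 1) (moves 2) (moves 3) hc.closed
      (by rw [← c.img_zero k]; exact (c.img_succ k 0).symm) (c.img_succ k 1).symm
      (c.img_succ k 2).symm (c.img_succ k 3).symm hc.ind_first hc.ind_last hT
      (by simpa only [prod_eq_mul, mul_smul] using hθ)
  have fix : ∀ i, ∀ x ∈ c.dom k i, (![a₀, a₁, a₂, a₃] i)⁻¹ • x = x := by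
    intro i x hx
    refine inv_smul_eq_self ?_
    fin_cases i
    · exact fix₀ x (c.img_zero k ▸ hx)
    exacts [fix₁ x hx, fix₂ x hx, fix₃ x hx]
  refine ⟨⟨fun i => c.w i * (![a₀, a₁, a₂, a₃] i)⁻¹, T⟩, ⟨hT, fun i x hx => ?_⟩, rfl,
    fun x hx => ?_⟩
  · rw [mul_smul, fix i x hx]
  · rw [← h x hx, prod_eq_mul]
    simp only [conj, inv_conj_mul_inv_eq_conj_inv_conj]
    simp only [mul_smul]
    rfl

variable (S k c) in
theorem exists_closed_img_supset (F : Finset V) :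
    ∃ X, S.cl X = X ∧ ∀ i, F ⊆ img k ⟨c.w, X⟩ i := by
  refine ⟨S.cl (Finset.univ.biUnion fun i => (c.partialProd k i)⁻¹ • F), S.cl_cl _, fun i => ?_⟩
  change F ⊆ c.partialProd k i • _
  rw [Finset.subset_smul_finset_iff]
  exact (Finset.subset_biUnion_of_mem (fun i => (c.partialProd k i)⁻¹ • F)
    (Finset.mem_univ i)).trans (S.subset_cl _)

variable (c) in
theorem exists_prepared_of_closed (hk : S.MovesMax k) (hc : S.cl c.X = c.X) :
    ∃ c' : Chain G V, c'.Prepared k S ∧ c'.img k 1 = c.img k 1 ∧ c'.img k 3 = c.img k 3 ∧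
      ∀ i, ∀ x ∈ c.img k 1 ∩ c.img k 3, c'.w i • x = c.w i • x := by
  obtain ⟨e, fix_e, ind_first⟩ :=
    (hk.inv_conj (c.w 0)).exists_conj_ind_smul (c.cl_img k hc 1) (c.dom k 1)
  obtain ⟨e', fix_e', ind_last⟩ :=
    (hk.inv_conj (c.w 3)).inv.exists_conj_ind_smul (c.cl_img k hc 3) (c.dom k 2)
  rw [← conj_inv, ← inv_conj_mul_inv_eq_conj_inv_conj] at ind_last
  rw [← inv_conj_mul_inv_eq_conj_inv_conj] at ind_first
  let w := ![c.w 0 * e⁻¹, c.w 1, c.w 2, c.w 3 * e'⁻¹]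
  let c' : Chain G V := ⟨w, ((w 0)⁻¹ * k * w 0)⁻¹ • c.img k 1⟩
  have img₁ : c'.img k 1 = c.img k 1 := by
    refine (c'.img_succ k 0).trans ?_
    rw [Fin.castSucc_zero, img_zero]
    exact smul_inv_smul _ _
  have img₂ : c'.img k 2 = c.img k 2 :=
    (c'.img_succ k 1).trans ((congrArg (c.conj k 1 • ·) img₁).trans (c.img_succ k 1).symm)
  have img₃ : c'.img k 3 = c.img k 3 :=
    (c'.img_succ k 2).trans ((congrArg (c.conj k 2 • ·) img₂).trans (c.img_succ k 2).symm)
  have dom₁ : c'.dom k 1 = c.dom k 1 := congrArg₂ (· ∪ ·) img₁ img₂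
  have dom₂ : c'.dom k 2 = c.dom k 2 := congrArg₂ (· ∪ ·) img₂ img₃
  refine ⟨c', ⟨S.cl_smul_eq (c.cl_img k hc 1) _, ?_, ?_⟩, img₁, img₃, fun i x hx => ?_⟩
  · rwa [dom₁, img₁]
  · rwa [dom₂, img₃]
  · obtain ⟨hx₁, hx₃⟩ := Finset.mem_inter.1 hx
    fin_cases i
    · exact (mul_smul _ _ _).trans (congrArg (c.w 0 • ·) (inv_smul_eq_self (fix_e x hx₁)))
    · rfl
    · rfl
    · exact (mul_smul _ _ _).trans (congrArg (c.w 3 • ·) (inv_smul_eq_self (fix_e' x hx₃)))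

theorem exists_extends_prepared (hk : S.MovesMax k) (c : Chain G V) (y : V) :
    ∃ c' : Chain G V, Extends k c c' ∧ c'.Prepared k S ∧ c'.Covers k y := by
  let F : Finset V := Finset.univ.biUnion (c.dom k) ∪ {y, c.conj k 0 • y} ∪
    Finset.univ.image fun i => (c.w i)⁻¹ • y
  obtain ⟨X, hX, F_sub⟩ := exists_closed_img_supset S k c F
  obtain ⟨c', prepared, img₁, img₃, w_eq⟩ := exists_prepared_of_closed ⟨c.w, X⟩ hk hX
  replace w_eq : ∀ i, ∀ x ∈ F, c'.w i • x = c.w i • x := fun i x hx =>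
    w_eq i x (Finset.mem_inter.2 ⟨F_sub 1 hx, F_sub 3 hx⟩)
  have sub₁ : F ⊆ c'.img k 1 := img₁ ▸ F_sub 1
  have sub₃ : F ⊆ c'.img k 3 := img₃ ▸ F_sub 3
  have sub_dom : ∀ i, F ⊆ c'.dom k i := by
    intro i
    fin_cases i
    exacts [sub₁.trans Finset.subset_union_right, sub₁.trans Finset.subset_union_left,
      sub₃.trans Finset.subset_union_right, sub₃.trans Finset.subset_union_left]
  have dom_sub : ∀ i, c.dom k i ⊆ F := fun i x hx => by
    simp only [F, Finset.mem_union, Finset.mem_biUnion]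
    exact Or.inl (Or.inl ⟨i, Finset.mem_univ i, hx⟩)
  have y_mem : y ∈ F := by simp [F]
  have inv_mem : ∀ i, (c.w i)⁻¹ • y ∈ F := fun i => by simp [F]
  have mem_X : ∀ x ∈ F, c.conj k 0 • x ∈ F → x ∈ c'.X := by
    intro x hx hx'
    have e : c'.img k 1 = c'.conj k 0 • c'.X := c'.img_zero k ▸ c'.img_succ k 0
    rw [← Finset.smul_mem_smul_finset_iff (c'.conj k 0), ← e,
      conj_smul_congr (w_eq 0 x hx) (w_eq 0 _ hx')]
    exact sub₁ hx'
  refine ⟨c', ⟨fun x hx => ?_, fun i x hx => w_eq i x (dom_sub i hx)⟩, prepared,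
    ⟨mem_X y y_mem (by simp [F]), fun i => sub_dom i y_mem, fun i => ?_⟩⟩
  · rw [← c.img_zero k] at hx
    refine mem_X x (dom_sub 0 (Finset.mem_union_left _ hx))
      (dom_sub 0 (Finset.mem_union_right _ ?_))
    rw [img_succ]
    exact Finset.smul_mem_smul_finset hx
  · rw [inv_smul_eq_iff.2 ((smul_inv_smul _ y).symm.trans (w_eq i _ (inv_mem i)).symm)]
    exact sub_dom i (inv_mem i)

theorem exists_limit (hG : ClosedAction G V) (c : ℕ → Chain G V)
    (hext : ∀ j, Extends k (c j) (c (j + 1))) (hcov : ∀ y, ∃ j, (c j).Covers k y) :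
    ∃ c' : Chain G V, ∀ j, ∀ x ∈ (c j).X, c'.prod k • x = (c j).prod k • x := by
  have limit : ∀ i, ∃ v : G, ∀ j, ∀ x ∈ (c j).dom k i, v • x = (c j).w i • x := fun i =>
    hG (fun j => (c j).w i) (fun j => (c j).dom k i)
      (monotone_nat_of_le_succ fun j => (hext j).dom_sub i) (fun j => (hext j).eq i)
      (fun y => (hcov y).imp fun j h => h.mem_dom i)
      (fun y => (hcov y).imp fun j h => h.inv_smul_mem_dom i)
  choose v hv using limit
  refine ⟨⟨v, ∅⟩, fun j x hx => ?_⟩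
  have ext : Extends k (c j) ⟨v, (c j).X⟩ := ⟨subset_rfl, fun i => hv i j⟩
  rw [← ext.prod_eq hx]
  exact congrArg (· • x) (prod_congr k rfl)

/-- The chains `α` and `β` on the same set approximate a factorisation
`h = β.prod k * (α.prod k)⁻¹`, and `α` is ready to be extended. -/
structure Factors (S : IndepGeometry G V) (k h : G) (α β : Chain G V) : Prop where
  prepared : α.Prepared k S
  X_eq : α.X = β.X
  prod_eq : ∀ x ∈ α.X, β.prod k • x = h • α.prod k • x

namespace Factors

variable {h : G} {α β : Chain G V}

theorem exists_extends_swap (hk : S.MovesMax k) (hαβ : Factors S k h α β) (y : V) :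
    ∃ α' β' : Chain G V, Extends k α α' ∧ Extends k β β' ∧ β'.Covers k y ∧
      Factors S k h⁻¹ β' α' := by
  obtain ⟨β', ext, prepared, covers⟩ := exists_extends_prepared hk β y
  obtain ⟨α', ext', X_eq, prod_eq⟩ := hαβ.prepared.exists_extends hk (T := β'.X)
    (θ := h⁻¹ * β'.prod k) (hαβ.X_eq ▸ ext.sub) (fun x hx => by
      rw [mul_smul, ext.prod_eq (hαβ.X_eq ▸ hx), hαβ.prod_eq x hx, inv_smul_smul])
  exact ⟨α', β', ext', ext, covers, prepared, X_eq.symm, fun x hx => by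
    rw [prod_eq x hx, mul_smul]⟩

theorem exists_extends (hk : S.MovesMax k) (hαβ : Factors S k h α β) (y : V) :
    ∃ α' β' : Chain G V, Extends k α α' ∧ Extends k β β' ∧ α'.Covers k y ∧ β'.Covers k y ∧
      Factors S k h α' β' := by
  obtain ⟨α', β', extα, extβ, covβ, factors⟩ := hαβ.exists_extends_swap hk y
  obtain ⟨β'', α'', extβ', extα', covα, factors'⟩ := factors.exists_extends_swap hk y
  rw [inv_inv] at factors'
  exact ⟨α'', β'', extα.trans extα', extβ.trans extβ', covα, covβ.of_extends extβ', factors'⟩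

variable (S k h) in
theorem of_empty (w : Fin 4 → G) : Factors S k h ⟨w, ∅⟩ ⟨w, ∅⟩ where
  prepared := by
    have img_empty : ∀ i, img k ⟨w, (∅ : Finset V)⟩ i = ∅ := fun i => Finset.smul_finset_empty _
    have dom_empty : ∀ i, dom k ⟨w, (∅ : Finset V)⟩ i = ∅ := fun i => by
      rw [dom, img_empty, img_empty, Finset.union_empty]
    constructor
    · exact S.cl_empty
    · rw [dom_empty]
      exact S.ind_empty_left _ _
    · rw [dom_empty]
      exact S.ind_empty_left _ _
  X_eq := rfl
  prod_eq x hx := absurd hx (Finset.notMem_empty x)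

end Factors

end Chain

variable {G V : Type*} [Group G] [MulAction G V] [DecidableEq V] {S : IndepGeometry G V}

/-- Back and forth: the chains on the two sides are extended alternately, so that they converge to
conjugates of `k` by group elements. -/
theorem MovesMax.exists_eq_prod (hG : ClosedAction G V) [Countable V] [FaithfulSMul G V] {k : G}
    (hk : S.MovesMax k) (h : G) : ∃ α β : Chain G V, h = β.prod k * (α.prod k)⁻¹ := by
  let State := {s : Chain G V × Chain G V // Chain.Factors S k h s.1 s.2}
  have exists_next : ∀ (s : State) (y : V), ∃ s' : State, Chain.Extends k s.1.1 s'.1.1 ∧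
      Chain.Extends k s.1.2 s'.1.2 ∧ s'.1.1.Covers k y ∧ s'.1.2.Covers k y := by
    rintro ⟨⟨α, β⟩, hαβ⟩ y
    obtain ⟨α', β', extα, extβ, covα, covβ, hαβ'⟩ := hαβ.exists_extends hk y
    exact ⟨⟨(α', β'), hαβ'⟩, extα, extβ, covα, covβ⟩
  choose next extα extβ covα covβ using exists_next
  let s₀ : State := ⟨(⟨1, ∅⟩, ⟨1, ∅⟩), Chain.Factors.of_empty S k h 1⟩
  rcases isEmpty_or_nonempty V with hV | hV
  · exact ⟨s₀.1.1, s₀.1.2, FaithfulSMul.eq_of_smul_eq_smul (α := V) fun x => hV.elim x⟩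
  obtain ⟨y, hy⟩ := exists_surjective_nat V
  let stage : ℕ → State := fun j => Nat.rec s₀ (fun i s => next s (y i)) j
  have covers : ∀ x, ∃ j, (stage j).1.1.Covers k x ∧ (stage j).1.2.Covers k x := by
    intro x
    obtain ⟨j, rfl⟩ := hy x
    exact ⟨j + 1, covα _ _, covβ _ _⟩
  obtain ⟨α, hα⟩ := Chain.exists_limit hG (fun j => (stage j).1.1) (fun j => extα _ _)
    (fun x => (covers x).imp fun j h => h.1)
  obtain ⟨β, hβ⟩ := Chain.exists_limit hG (fun j => (stage j).1.2) (fun j => extβ _ _)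
    (fun x => (covers x).imp fun j h => h.2)
  refine ⟨α, β, eq_mul_inv_of_mul_eq (FaithfulSMul.eq_of_smul_eq_smul (α := V) fun x => ?_)⟩
  obtain ⟨j, covers_j, -⟩ := covers x
  have factors := (stage j).2
  rw [mul_smul, hα j x covers_j.mem, hβ j x (factors.X_eq ▸ covers_j.mem),
    factors.prod_eq x covers_j.mem]

end IndepGeometry

namespace IndepGeometry

variable {G V : Type*} [Group G] [MulAction G V] [DecidableEq V] {S : IndepGeometry G V}

variable (S) in
/-- `k` moves every type over a closed set to one that is independent from it in the sense of the
dimension. -/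
def DimMoves (k : G) : Prop :=
  ∀ X T : Finset V, S.cl X = X → ∃ σ : G, (∀ x ∈ X, σ • x = x) ∧ S.DimIndep (σ • T) X (k • σ • T)

variable (S) in
/-- `g` moves the type of `T` over `X` maximally. -/
def MovesTypeMax (g : G) (X T : Finset V) : Prop :=
  ∃ σ : G, (∀ x ∈ X, σ • x = x) ∧ S.Ind (σ • T) X (g • σ • T) ∧ S.Ind (g • σ • T) (g • X) (σ • T)

namespace DimMoves

variable {k : G}

theorem exists_ind (hk : S.DimMoves k) {X Y : Finset V} (hXY : X ⊆ Y) (hY : S.cl Y = Y)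
    (T : Finset V) : ∃ σ : G, (∀ x ∈ S.cl X, σ • x = x) ∧
      S.Ind (σ • T) X Y ∧ S.DimIndep (σ • T) Y (k • σ • T) := by
  obtain ⟨σ, fix_σ, ind⟩ := S.ind_exists T X Y
  obtain ⟨τ, fix_τ, dimIndep⟩ := hk Y (σ • T) hY
  refine ⟨τ * σ, fun x hx => ?_, ?_, ?_⟩
  · rw [mul_smul, fix_σ x hx, fix_τ x (hY ▸ S.cl_mono hXY hx)]
  · have := S.ind_smul τ ind
    rwa [smul_finset_eq_self fix_τ, smul_finset_eq_self fun x hx => fix_τ x (hXY hx),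
      ← mul_smul] at this
  · rwa [mul_smul]

theorem exists_ind_smul (hk : S.DimMoves k) {X D : Finset V} (hXD : X ⊆ D) (T : Finset V) :
    ∃ σ : G, (∀ x ∈ S.cl X, σ • x = x) ∧ S.Ind (σ • T) X D ∧ S.Ind (k • σ • T) (k • X) D ∧
      S.DimIndep (σ • T) D (k • σ • T) := by
  have D_sub : D ⊆ S.cl (D ∪ k⁻¹ • D) := S.subset_cl_union_left
  obtain ⟨σ, fix, ind, dimIndep⟩ := hk.exists_ind (hXD.trans D_sub) (S.cl_cl _) T
  have D_sub_smul : D ⊆ k • S.cl (D ∪ k⁻¹ • D) := by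
    rw [Finset.subset_smul_finset_iff]
    exact S.subset_cl_union_right
  exact ⟨σ, fix, ind.subset subset_rfl D_sub, (S.ind_smul k ind).subset subset_rfl D_sub_smul,
    (S.dimIndep_of_ind ind).between dimIndep hXD (D_sub.trans (S.subset_cl _))⟩

theorem exists_conj_ind (hk : S.DimMoves k) {D X Y T : Finset V} (hD : S.cl D = D) (hXD : X ⊆ D)
    (hYD : Y ⊆ D) (hT : S.Ind T X D) {h : G} (hY : k • h • Y = h • X) :
    ∃ u : G, (∀ x ∈ D, u • x = h • x) ∧ S.Ind ((u⁻¹ * k⁻¹ * u) • T) Y D ∧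
      S.DimIndep ((u⁻¹ * k⁻¹ * u) • T) D T := by
  have cl_hD : S.cl (h • D) = h • D := S.cl_smul_eq hD h
  obtain ⟨τ, fix, ind, dimIndep⟩ := hk.exists_ind (X := h • D) (Y := S.cl (h • D ∪ k • h • D))
    S.subset_cl_union_left (S.cl_cl _) (h • T)
  rw [cl_hD] at fix
  have u_eq : ∀ x ∈ D, (τ * h) • x = h • x := fun x hx => by
    rw [mul_smul, fix _ (Finset.smul_mem_smul_finset hx)]
  generalize hu : τ * h = u at u_eq
  rw [← mul_smul, hu] at ind dimIndep
  have uD : u • D = h • D := smul_finset_congr u_eq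
  have uY : u • Y = h • Y := smul_finset_congr fun x hx => u_eq x (hYD hx)
  have hX_sub : h • X ⊆ k • h • D :=
    hY ▸ Finset.smul_finset_subset_smul_finset (Finset.smul_finset_subset_smul_finset hYD)
  have ind_cl : S.Ind (u • T) (h • X) (S.cl (h • D ∪ k • h • D)) := by
    have ind_hD := S.ind_smul u hT
    rw [uD, smul_finset_congr fun x hx => u_eq x (hXD hx)] at ind_hD
    refine ind_hD.trans_right ind ?_
    rw [Finset.union_eq_right.2 (Finset.smul_finset_subset_smul_finset hXD)]
  have ind_uT : S.Ind (u • T) (h • X) (k • h • D) :=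
    ind_cl.subset subset_rfl S.subset_cl_union_right
  have dimIndep_uT : S.DimIndep (u • T) (k • h • D) (k • u • T) :=
    (S.dimIndep_of_ind ind_cl).between dimIndep hX_sub
      (S.subset_cl_union_right.trans (S.subset_cl _))
  refine ⟨u, u_eq, ?_, ?_⟩
  · simpa only [← hY, ← uD, ← uY, mul_smul, inv_smul_smul] using
      S.ind_smul u⁻¹ (S.ind_smul k⁻¹ ind_uT)
  · simpa only [← uD, mul_smul, inv_smul_smul] using (dimIndep_uT.smul k⁻¹).smul u⁻¹

end DimMoves

theorem exists_smul_ind_of_dimIndep {A X D E Y B : Finset V} (hX : X ⊆ D) (hY : Y ⊆ D)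
    (hA : S.Ind A X D) (hE : S.Ind E Y D) (hAB : S.DimIndep A D B) (hEB : S.DimIndep E D B) :
    ∃ ρ : G, (∀ x ∈ D ∪ B, ρ • x = x) ∧ S.Ind A X (ρ • E) ∧ S.Ind (ρ • E) Y A := by
  obtain ⟨ρ, fix, ind⟩ := S.ind_exists E (D ∪ B) A
  replace fix : ∀ x ∈ D ∪ B, ρ • x = x := fun x hx => fix x (S.subset_cl _ hx)
  have fix_D : ∀ x ∈ D, ρ • x = x := fun x hx => fix x (Finset.mem_union_left _ hx)
  have fix_B : ∀ x ∈ B, ρ • x = x := fun x hx => fix x (Finset.mem_union_right _ hx)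
  have dimIndep := hEB.smul ρ
  rw [smul_finset_eq_self fix_D, smul_finset_eq_self fix_B] at dimIndep
  have ind_D : S.Ind A D (ρ • E) := S.ind_of_dimIndep hAB dimIndep (S.ind_symm ind)
  have ind_Y := S.ind_smul ρ hE
  rw [smul_finset_eq_self fix_D, smul_finset_eq_self fun x hx => fix_D x (hY hx)] at ind_Y
  exact ⟨ρ, fix, hA.trans_right ind_D (by rw [Finset.union_eq_right.2 hX]),
    ind_Y.trans_right (S.ind_symm ind_D) (by rw [Finset.union_eq_right.2 hY])⟩

/-- An open dense condition on `h`, to which `ClosedAction.exists_forall_of_dense` applies. -/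
theorem DimMoves.movesTypeMax_dense {k : G} (hk : S.DimMoves k) {X : Finset V}
    (hX : S.cl X = X) (T : Finset V) (h : G) (D : Finset V) :
    ∃ (h' : G) (D' : Finset V), D ⊆ D' ∧ (∀ x ∈ D, h' • x = h • x) ∧
      ∀ h'' : G, (∀ x ∈ D', h'' • x = h' • x) → S.MovesTypeMax (h''⁻¹ * k⁻¹ * h'' * k) X T := by
  set Y := h⁻¹ • k⁻¹ • h • k • X with hY
  set D₀ := S.cl (D ∪ X ∪ k • X ∪ Y)
  have sub_D₀ : D ∪ X ∪ k • X ∪ Y ⊆ D₀ := S.subset_cl _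
  simp only [Finset.union_subset_iff] at sub_D₀
  obtain ⟨⟨⟨D_sub, X_sub⟩, kX_sub⟩, Y_sub⟩ := sub_D₀
  obtain ⟨σ, fix_σ, ind_A, ind_kA, dimIndep_A⟩ := hk.exists_ind_smul X_sub T
  rw [hX] at fix_σ
  set A := σ • T with hA
  obtain ⟨u, u_eq, ind_E, dimIndep_E⟩ := hk.exists_conj_ind (S.cl_cl _) kX_sub Y_sub ind_kA
    (h := h) (by simp only [hY, smul_inv_smul])
  set E := (u⁻¹ * k⁻¹ * u) • k • A with hE
  obtain ⟨ρ, fix_ρ, ind, ind'⟩ :=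
    exists_smul_ind_of_dimIndep X_sub Y_sub ind_A ind_E dimIndep_A dimIndep_E
  have eq_u : ∀ x ∈ D₀ ∪ k • A, (u * ρ⁻¹) • x = u • x := fun x hx => by
    rw [mul_smul, inv_smul_eq_self (fix_ρ x hx)]
  have eq_h : ∀ x ∈ D₀, (u * ρ⁻¹) • x = h • x := fun x hx => by
    rw [eq_u x (Finset.mem_union_left _ hx), u_eq x hx]
  refine ⟨u * ρ⁻¹, D₀ ∪ k • A ∪ ρ • E,
    D_sub.trans (Finset.subset_union_left.trans Finset.subset_union_left),
    fun x hx => eq_h x (D_sub hx), fun v hv => ⟨σ, fix_σ, ?_⟩⟩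
  have v_eq_h : ∀ x ∈ D₀, v • x = h • x := fun x hx => by rw [hv x (by simp [hx]), eq_h x hx]
  have v_kA : v • k • A = u • k • A := smul_finset_congr fun x hx => by
    rw [hv x (by simp [hx]), eq_u x (Finset.mem_union_right _ hx)]
  have v_E : v • ρ • E = k⁻¹ • u • k • A := by
    rw [smul_finset_congr fun x hx => hv x (Finset.mem_union_right _ hx), ← mul_smul,
      inv_mul_cancel_right, hE]
    simp only [mul_smul, smul_inv_smul]
  have comm_A : (v⁻¹ * k⁻¹ * v * k) • A = ρ • E := by
    simp only [mul_smul]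
    rw [v_kA, ← v_E, inv_smul_smul]
  have comm_X : (v⁻¹ * k⁻¹ * v * k) • X = Y := by
    simp only [mul_smul]
    rw [smul_finset_congr fun x hx => v_eq_h x (kX_sub hx), inv_smul_eq_iff,
      smul_finset_congr fun x hx => v_eq_h x (Y_sub hx), hY, smul_inv_smul]
  rw [← hA, comm_A, comm_X]
  exact ⟨ind, ind'⟩

theorem DimMoves.exists_movesMax (hG : ClosedAction G V) [Countable V] {k : G}
    (hk : S.DimMoves k) : ∃ h : G, S.MovesMax (h⁻¹ * k⁻¹ * h * k) := by
  obtain ⟨h, hh⟩ := hG.exists_forall_of_dense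
    (ι := {X : Finset V // S.cl X = X} × Finset V)
    (fun i h => S.MovesTypeMax (h⁻¹ * k⁻¹ * h * k) i.1 i.2)
    fun i h D => hk.movesTypeMax_dense i.1.2 i.2 h D
  exact ⟨h, fun X T hX => hh (⟨X, hX⟩, T)⟩

end IndepGeometry

/-! ### Monodimensional geometries -/

namespace IndepGeometry

open MulAction

variable {G V : Type*} [Group G] [MulAction G V] [DecidableEq V] {S : IndepGeometry G V}

variable (S) in
/-- `b` is basic over `A`: the dimension of `b` drops only over the closed sets that contain `b`. -/
def Basic (b : V) (A : Finset V) : Prop :=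
  b ∉ A ∧ ∀ C, S.cl C = C → A ⊆ C → S.rel {b} C < S.rel {b} A → b ∈ C

variable (S) in
/-- Over every closed set, any basic orbit together with some finite set spans everything. -/
def IsMonodimensional : Prop :=
  ∀ A b, S.cl A = A → S.Basic b A → ∃ B, A ⊆ B ∧ ∀ x, ∃ F : Finset V,
    (∀ y ∈ F, y ∈ orbit (fixingSubgroup G (A : Set V)) b) ∧ x ∈ S.cl (B ∪ F)

variable (S) in
/-- `g` is bounded: modulo some finite set, it moves every point within its own closure. -/
def IsBounded (g : G) : Prop :=
  ∃ B, ∀ x, g • x ∈ S.cl (insert x B)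

theorem smul_mem_cl_union {g : G} {B B' F : Finset V} {x : V} (hB : g • B ⊆ B')
    (hF : ∀ y ∈ F, g • y ∈ S.cl (insert y B')) (hx : x ∈ S.cl (B ∪ F)) :
    g • x ∈ S.cl (B' ∪ F) := by
  refine S.cl_subset_cl ?_ (S.smul_mem_cl_smul hx)
  rw [Finset.smul_finset_union]
  refine Finset.union_subset (hB.trans S.subset_cl_union_left) fun w hw => ?_
  obtain ⟨y, hy, rfl⟩ := Finset.mem_smul_finset.1 hw
  exact S.cl_mono (Finset.insert_subset (Finset.mem_union_right _ hy) Finset.subset_union_left)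
    (hF y hy)

variable (S) in
theorem exists_smul_notMem_cl {x : V} {R : Finset V} (hx : x ∉ S.cl R) (W : Finset V) :
    ∃ ρ : G, (∀ y ∈ S.cl R, ρ • y = y) ∧ ρ • x ∉ S.cl W := by
  obtain ⟨ρ, fix, ind⟩ := S.ind_exists {x} R W
  rw [Finset.smul_finset_singleton] at ind
  refine ⟨ρ, fix, fun h => hx ?_⟩
  have mem_R : ρ • x ∈ S.cl R := (S.dimIndep_of_ind ind).mem_cl
    (S.subset_cl _ (by simp)) (S.cl_mono Finset.subset_union_left h)
  rwa [← smul_finset_eq_self fix, Finset.smul_mem_smul_finset_iff] at mem_R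

namespace Basic

variable {b : V} {A C Z : Finset V}

theorem rel_eq (hb : S.Basic b A) (hAC : A ⊆ S.cl C) (hC : b ∉ S.cl C) :
    S.rel {b} C = S.rel {b} A := by
  rw [← S.rel_cl_right]
  refine le_antisymm (S.rel_anti _ hAC) (not_lt.1 fun h => hC (hb.2 _ (S.cl_cl _) hAC h))

theorem smul (hb : S.Basic b A) (σ : G) : S.Basic (σ • b) (σ • A) := by
  refine ⟨fun h => hb.1 (Finset.smul_mem_smul_finset_iff _ |>.1 h), fun C hC hAC hlt => ?_⟩
  have hlt' : S.rel {b} (σ⁻¹ • C) < S.rel {b} A := by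
    rwa [← S.rel_smul σ {b}, ← S.rel_smul σ {b}, smul_inv_smul, Finset.smul_finset_singleton]
  rw [← Finset.mem_inv_smul_finset_iff]
  exact hb.2 _ (S.cl_smul_eq hC _) (by rwa [Finset.subset_smul_finset_iff, inv_inv]) hlt'

theorem of_mem_orbit (hb : S.Basic b A) {c : V}
    (hc : c ∈ orbit (fixingSubgroup G (A : Set V)) b) : S.Basic c A := by
  obtain ⟨σ, rfl⟩ := mem_orbit_iff.1 hc
  have fix : ∀ a ∈ A, (σ : G) • a = a := (mem_fixingSubgroup_iff G).1 σ.2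
  have := hb.smul (σ : G)
  rwa [smul_finset_eq_self fix] at this

theorem of_subset (hb : S.Basic b A) (hAZ : A ⊆ Z) (hZ : b ∉ Z) : S.Basic b Z :=
  ⟨hZ, fun C hC hZC hlt => hb.2 C hC (hAZ.trans hZC) (hlt.trans_le (S.rel_anti _ hAZ))⟩

end Basic

namespace IsMonodimensional

/-- Otherwise `g` would move every point of the basic orbit within its closure, hence would be
bounded: any point `y` is in the closure of a finite part `F` of the orbit, and choosing two copies
of `F` that are independent over `y` shows that `g y` is in the closure of `y`. -/
theorem exists_notMem (hm : S.IsMonodimensional) {g : G} (hg : ¬S.IsBounded g) {Z : Finset V}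
    (hZ : S.cl Z = Z) {x : V} (hx : S.Basic x Z) :
    ∃ τ : G, (∀ z ∈ Z, τ • z = z) ∧ g • τ • x ∉ S.cl (insert (τ • x) Z) := by
  by_contra! H
  obtain ⟨B, hZB, hB⟩ := hm Z x hZ hx
  have smul_mem : ∀ (F : Finset V) (y : V), (∀ z ∈ F, z ∈ orbit (fixingSubgroup G (Z : Set V)) x) →
      y ∈ S.cl (B ∪ F) → g • y ∈ S.cl (B ∪ g • B ∪ F) := by
    intro F y hF hy
    refine smul_mem_cl_union Finset.subset_union_right (fun z hz => ?_) hy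
    obtain ⟨σ, rfl⟩ := mem_orbit_iff.1 (hF z hz)
    exact S.cl_mono (Finset.insert_subset_insert _ (hZB.trans Finset.subset_union_left))
      (H σ ((mem_fixingSubgroup_iff G).1 σ.2))
  refine hg ⟨B ∪ g • B, fun y => ?_⟩
  obtain ⟨F, hF, hy⟩ := hB y
  obtain ⟨σ, fix, ind⟩ := S.ind_exists F (insert y (B ∪ g • B)) F
  replace fix : ∀ z ∈ insert y (B ∪ g • B), σ • z = z := fun z hz => fix z (S.subset_cl _ hz)
  have fix_B : ∀ z ∈ B, σ • z = z := fun z hz => fix z (by simp [hz])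
  have hσF : ∀ z ∈ σ • F, z ∈ orbit (fixingSubgroup G (Z : Set V)) x := by
    intro z hz
    obtain ⟨w, hw, rfl⟩ := Finset.mem_smul_finset.1 hz
    exact mapsTo_smul_orbit (⟨σ, (mem_fixingSubgroup_iff G).2 fun a ha => fix_B a (hZB ha)⟩ :
      fixingSubgroup G (Z : Set V)) x (hF w hw)
  have hσy : y ∈ S.cl (B ∪ σ • F) := by
    have := S.smul_mem_cl_smul (σ := σ) hy
    rwa [Finset.smul_finset_union, smul_finset_eq_self fix_B,
      fix y (Finset.mem_insert_self _ _)] at this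
  have union_sub : ∀ F' : Finset V, B ∪ g • B ∪ F' ⊆ F' ∪ insert y (B ∪ g • B) := fun F' => by
    rw [Finset.union_comm _ F']
    exact Finset.union_subset_union_right (Finset.subset_insert _ _)
  exact (S.dimIndep_of_ind ind).mem_cl (S.cl_mono (union_sub _) (smul_mem _ y hσF hσy))
    (S.cl_mono (union_sub _) (smul_mem F y hF hy))

theorem exists_rel_pair_eq (hm : S.IsMonodimensional) {k : G} (hk : ¬S.IsBounded k)
    {A R W : Finset V} {x : V} (hx : S.Basic x A) (hAR : A ⊆ R) (hxR : x ∉ S.cl R) (hRW : R ⊆ W)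
    (hkA : k • A ⊆ W) :
    ∃ θ : G, (∀ y ∈ R, θ • y = y) ∧ S.rel ({k • θ • x} ∪ {θ • x}) W = 2 * S.rel {x} A := by
  have hAW : A ⊆ S.cl W := (hAR.trans hRW).trans (S.subset_cl _)
  obtain ⟨ρ, fix_ρ, hρ⟩ := S.exists_smul_notMem_cl hxR W
  replace fix_ρ : ∀ y ∈ R, ρ • y = y := fun y hy => fix_ρ y (S.subset_cl _ hy)
  have basic_of_fix : ∀ θ : G, (∀ y ∈ R, θ • y = y) →
      S.Basic (θ • x) A ∧ S.rel {θ • x} A = S.rel {x} A := by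
    intro θ fix
    have θA : θ • A = A := smul_finset_eq_self fun y hy => fix y (hAR hy)
    constructor
    · simpa only [θA] using hx.smul θ
    · rw [← S.rel_smul θ {x}, θA, Finset.smul_finset_singleton]
  obtain ⟨τ, fix_τ, hτ⟩ := hm.exists_notMem hk (S.cl_cl W)
    ((basic_of_fix ρ fix_ρ).1.of_subset hAW hρ)
  rw [← mul_smul τ] at hτ
  have hτρ : (τ * ρ) • x ∉ S.cl W := by
    rwa [← smul_finset_eq_self fix_τ, mul_smul, Finset.smul_mem_smul_finset_iff]
  have fix : ∀ y ∈ R, (τ * ρ) • y = y := fun y hy => by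
    rw [mul_smul, fix_ρ y hy, fix_τ y (S.subset_cl _ (hRW hy))]
  generalize τ * ρ = θ at hτ hτρ fix
  obtain ⟨basic, rel_eq⟩ := basic_of_fix θ fix
  have rel_θ : S.rel {θ • x} W = S.rel {x} A := by rw [basic.rel_eq hAW hτρ, rel_eq]
  have rel_k : S.rel {k • θ • x} ({θ • x} ∪ W) = S.rel {x} A := by
    have basic_k := basic.smul k
    rw [basic_k.rel_eq (hkA.trans S.subset_cl_union_right) fun h => hτ ?_, ← rel_eq,
      ← S.rel_smul k {θ • x}, Finset.smul_finset_singleton]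
    rw [Finset.insert_eq]
    exact S.cl_mono (Finset.union_subset_union_right (S.subset_cl _)) h
  refine ⟨θ, fix, ?_⟩
  rw [S.rel_union, rel_θ, rel_k]
  ring

theorem exists_rel_le (hm : S.IsMonodimensional) {k : G} (hk : ¬S.IsBounded k)
    {A C : Finset V} (hAC : A ⊆ C) {F : Finset V} (hF : ∀ y ∈ F, S.Basic y A) :
    ∃ σ : G, (∀ x ∈ C, σ • x = x) ∧
      2 * S.rel F C ≤ S.rel (σ • F ∪ k • σ • F) (C ∪ k • C) := by
  induction F using Finset.induction_on with
  | empty =>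
    refine ⟨1, fun x _ => one_smul _ x, ?_⟩
    rw [S.rel_eq_zero_of_subset (Finset.empty_subset _)]
    simpa using S.rel_nonneg _ _
  | insert x F _ ih =>
    obtain ⟨σ, fix_σ, le⟩ := ih fun y hy => hF y (Finset.mem_insert_of_mem hy)
    have rel_insert : S.rel (insert x F) C = S.rel F C + S.rel {x} (F ∪ C) := by
      rw [Finset.insert_eq, S.rel_union]
    by_cases hx : x ∈ S.cl (F ∪ C)
    · refine ⟨σ, fix_σ, ?_⟩
      rw [rel_insert, S.rel_eq_zero_of_subset (Finset.singleton_subset_iff.2 hx), add_zero]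
      refine le.trans (S.rel_mono _ ?_)
      gcongr <;> exact Finset.subset_insert _ _
    have σ_union : σ • (F ∪ C) = σ • F ∪ C := by
      rw [Finset.smul_finset_union, smul_finset_eq_self fix_σ]
    have σA : σ • A = A := smul_finset_eq_self fun y hy => fix_σ y (hAC hy)
    have basic : S.Basic (σ • x) A := by
      simpa only [σA] using (hF x (Finset.mem_insert_self _ _)).smul σ
    obtain ⟨θ, fix_θ, rel_eq⟩ := hm.exists_rel_pair_eq hk
      (W := σ • F ∪ k • σ • F ∪ (C ∪ k • C)) basic
      (hAC.trans Finset.subset_union_right)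
      (by rwa [← σ_union, ← S.smul_cl, Finset.smul_mem_smul_finset_iff])
      (Finset.union_subset_union Finset.subset_union_left Finset.subset_union_left)
      ((Finset.smul_finset_subset_smul_finset hAC).trans
        (Finset.subset_union_right.trans Finset.subset_union_right))
    have θF : (θ * σ) • F = σ • F := by
      rw [mul_smul, smul_finset_eq_self fun z hz => fix_θ z (Finset.mem_union_left _ hz)]
    have union_eq : (θ * σ) • insert x F ∪ k • (θ * σ) • insert x F =
        {k • θ • σ • x} ∪ {θ • σ • x} ∪ (σ • F ∪ k • σ • F) := by
      rw [Finset.smul_finset_insert, θF, Finset.smul_finset_insert, mul_smul, Finset.insert_eq,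
        Finset.insert_eq]
      ac_rfl
    refine ⟨θ * σ, fun z hz => by rw [mul_smul, fix_σ z hz, fix_θ z (by simp [hz])], ?_⟩
    have rel_x : S.rel {x} (F ∪ C) = S.rel {σ • x} A := by
      rw [(hF x (Finset.mem_insert_self _ _)).rel_eq (hAC.trans S.subset_cl_union_right) hx,
        ← S.rel_smul σ, σA, Finset.smul_finset_singleton]
    rw [rel_insert, union_eq, S.rel_union, rel_eq, rel_x]
    linarith

theorem exists_dimIndep (hm : S.IsMonodimensional) {k : G} (hk : ¬S.IsBounded k)
    {A C : Finset V} (hAC : A ⊆ C) {F : Finset V} (hF : ∀ y ∈ F, S.Basic y A) :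
    ∃ σ : G, (∀ x ∈ C, σ • x = x) ∧ S.DimIndep (σ • F) C (k • C ∪ k • σ • F) := by
  obtain ⟨σ, fix, le⟩ := hm.exists_rel_le hk hAC hF
  have rel_σ : S.rel (σ • F) C = S.rel F C := by
    rw [← S.rel_smul σ F C, smul_finset_eq_self fix]
  have rel_k : S.rel (k • σ • F) (C ∪ k • C) ≤ S.rel F C := by
    rw [← rel_σ, ← S.rel_smul k (σ • F)]
    exact S.rel_anti _ Finset.subset_union_right
  refine ⟨σ, fix, DimGeometry.dimIndep_of_le ?_⟩
  rw [S.rel_union] at le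
  rw [show C ∪ (k • C ∪ k • σ • F) = k • σ • F ∪ (C ∪ k • C) by ac_rfl]
  linarith

theorem dimMoves (hm : S.IsMonodimensional) {k : G} (hk : ¬S.IsBounded k) {A : Finset V} {b : V}
    (hA : S.cl A = A) (hb : S.Basic b A) : S.DimMoves k := by
  intro X T hX
  obtain ⟨B, hAB, hspan⟩ := hm A b hA hb
  choose F hF hmem using hspan
  set C := X ∪ B
  have X_sub : X ⊆ C := Finset.subset_union_left
  have B_sub : B ⊆ C := Finset.subset_union_right
  obtain ⟨ρ, fix_ρ, ind⟩ := S.ind_exists T X C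
  rw [hX] at fix_ρ
  set F₀ := (ρ • T).biUnion F
  obtain ⟨σ, fix_σ, dimIndep⟩ := hm.exists_dimIndep hk (hAB.trans B_sub) (F := F₀)
    fun y hy => by
      obtain ⟨z, -, hz⟩ := Finset.mem_biUnion.1 hy
      exact hb.of_mem_orbit (hF z y hz)
  have T_sub : ρ • T ⊆ S.cl (F₀ ∪ C) := fun z hz => by
    refine S.cl_mono ?_ (hmem z)
    rw [Finset.union_comm]
    exact Finset.union_subset_union (Finset.subset_biUnion_of_mem F hz) B_sub
  have σT_sub : σ • ρ • T ⊆ S.cl (σ • F₀ ∪ C) := by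
    have := Finset.smul_finset_subset_smul_finset (a := σ) T_sub
    rwa [S.smul_cl, Finset.smul_finset_union, smul_finset_eq_self fix_σ] at this
  have kσT_sub : k • σ • ρ • T ⊆ S.cl (k • C ∪ k • σ • F₀ ∪ C) := by
    have := Finset.smul_finset_subset_smul_finset (a := k) σT_sub
    rw [S.smul_cl, Finset.smul_finset_union, Finset.union_comm (k • σ • F₀)] at this
    exact this.trans (S.cl_mono Finset.subset_union_left)
  have indep_X : S.DimIndep (σ • ρ • T) X C := by
    have := (S.dimIndep_of_ind ind).smul σ
    rwa [smul_finset_eq_self fix_σ, smul_finset_eq_self fun x hx => fix_σ x (X_sub hx)] at this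
  refine ⟨σ * ρ, fun x hx => by rw [mul_smul, fix_ρ x hx, fix_σ x (X_sub hx)], ?_⟩
  rw [mul_smul]
  exact indep_X.between (dimIndep.mono σT_sub kσT_sub) subset_rfl (X_sub.trans (S.subset_cl _))

end IsMonodimensional

end IndepGeometry

/-- `x` is a product of `N` conjugates of `g` and `g⁻¹`. -/
def IsConjProd {G : Type*} [Group G] (g : G) (N : ℕ) (x : G) : Prop :=
  ∃ l : List G, l.length = N ∧ (∀ y ∈ l, IsConj g y ∨ IsConj g⁻¹ y) ∧ l.prod = x

namespace IsConjProd

variable {G : Type*} [Group G] {g x y : G} {M N : ℕ}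

theorem self (g : G) : IsConjProd g 1 g :=
  ⟨[g], rfl, fun y hy => Or.inl (by rw [List.mem_singleton.1 hy]), List.prod_singleton⟩

theorem mul (hx : IsConjProd g M x) (hy : IsConjProd g N y) : IsConjProd g (M + N) (x * y) := by
  obtain ⟨l, hl, isConj, rfl⟩ := hx
  obtain ⟨l', hl', isConj', rfl⟩ := hy
  refine ⟨l ++ l', by rw [List.length_append, hl, hl'], fun z hz => ?_, List.prod_append⟩
  exact (List.mem_append.1 hz).elim (isConj z) (isConj' z)

theorem conj (hx : IsConjProd g N x) (u : G) : IsConjProd g N (u * x * u⁻¹) := by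
  obtain ⟨l, hl, isConj, rfl⟩ := hx
  refine ⟨l.map (MulAut.conj u), by rw [List.length_map, hl], fun z hz => ?_, ?_⟩
  · obtain ⟨y, hy, rfl⟩ := List.mem_map.1 hz
    have isConj_y : IsConj y (MulAut.conj u y) := isConj_iff.2 ⟨u, rfl⟩
    exact (isConj y hy).imp (·.trans isConj_y) (·.trans isConj_y)
  · rw [← map_list_prod, MulAut.conj_apply]

theorem inv_conj (hx : IsConjProd g N x) (u : G) : IsConjProd g N (u⁻¹ * x * u) := by
  simpa only [inv_inv] using hx.conj u⁻¹

theorem inv (hx : IsConjProd g N x) : IsConjProd g N x⁻¹ := by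
  obtain ⟨l, hl, isConj, rfl⟩ := hx
  have isConj_inv : ∀ {a b : G}, IsConj a b → IsConj a⁻¹ b⁻¹ :=
    fun ⟨c, hc⟩ => ⟨c, hc.inv_right⟩
  refine ⟨(l.map (·⁻¹)).reverse, by rw [List.length_reverse, List.length_map, hl],
    fun z hz => ?_, (List.prod_inv_reverse l).symm⟩
  obtain ⟨y, hy, rfl⟩ := List.mem_map.1 (List.mem_reverse.1 hz)
  rcases isConj y hy with h | h
  · exact Or.inr (isConj_inv h)
  · exact Or.inl (by simpa only [inv_inv] using isConj_inv h)

theorem one (g : G) (j : ℕ) : IsConjProd g (2 * j) 1 := by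
  induction j with
  | zero => exact ⟨[], rfl, by simp, rfl⟩
  | succ j ih => simpa [mul_add] using ih.mul ((self g).mul (self g).inv)

theorem mem_normal (hx : IsConjProd g N x) {K : Subgroup G} [K.Normal] (hg : g ∈ K) : x ∈ K := by
  obtain ⟨l, -, isConj, rfl⟩ := hx
  refine K.list_prod_mem fun y hy => ?_
  rcases isConj y hy with h | h <;> obtain ⟨c, rfl⟩ := isConj_iff.1 h
  · exact ‹K.Normal›.conj_mem _ hg c
  · exact ‹K.Normal›.conj_mem _ (K.inv_mem hg) c

end IsConjProd

theorem isSimpleGroup_of_isConjProd {G : Type*} [Group G] [Nontrivial G] {N : ℕ}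
    (h : ∀ g : G, g ≠ 1 → ∀ x, IsConjProd g N x) : IsSimpleGroup G where
  eq_bot_or_eq_top_of_normal K _ := by
    refine K.bot_or_exists_ne_one.imp_right fun ⟨g, hgK, hg⟩ => ?_
    exact (Subgroup.eq_top_iff' K).2 fun x => (h g hg x).mem_normal hgK

namespace IndepGeometry

theorem Chain.isConjProd_prod {G V : Type*} [Group G] {g k : G} {M : ℕ} (hk : IsConjProd g M k)
    (c : Chain G V) : IsConjProd g (4 * M) (c.prod k) := by
  have h : ∀ i, IsConjProd g M (c.conj k i) := fun i => hk.inv_conj (c.w i)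
  rw [c.prod_eq_mul, show 4 * M = M + M + M + M by ring]
  exact (((h 3).mul (h 2)).mul (h 1)).mul (h 0)

variable {G V : Type*} [Group G] [MulAction G V] [DecidableEq V] {S : IndepGeometry G V}

variable (S) in
theorem exists_basic [Nonempty V] : ∃ A b, S.cl A = A ∧ S.Basic b A := by
  obtain ⟨v⟩ := ‹Nonempty V›
  have exists_notMem : ∃ p : Finset V × V, S.cl p.1 = p.1 ∧ p.2 ∉ p.1 :=
    ⟨(∅, v), S.cl_empty, Finset.notMem_empty v⟩
  obtain ⟨⟨A, b⟩, ⟨hA, hb⟩, le⟩ :=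
    exists_minimalFor_of_wellFoundedLT _ (fun p : Finset V × V => (S.rel {p.2} p.1).toNat)
      exists_notMem
  refine ⟨A, b, hA, hb, fun C hC _ hlt => ?_⟩
  by_contra hbC
  have := le (j := (C, b)) ⟨hC, hbC⟩
  have := S.rel_nonneg {b} C
  grind

theorem IsMonodimensional.isConjProd (hm : S.IsMonodimensional) (hG : ClosedAction G V)
    [Countable V] [FaithfulSMul G V] {g : G} (hg : ¬S.IsBounded g) (h : G) :
    IsConjProd g 16 h := by
  have hV : Nonempty V := by
    by_contra! hV
    exact hg ⟨∅, fun x => hV.elim x⟩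
  obtain ⟨A, b, hA, hb⟩ := S.exists_basic
  obtain ⟨u, hu⟩ := (hm.dimMoves hg hA hb).exists_movesMax hG
  have hk : IsConjProd g 2 (u⁻¹ * g⁻¹ * u * g) :=
    ((IsConjProd.self g).inv.inv_conj u).mul (IsConjProd.self g)
  obtain ⟨α, β, rfl⟩ := hu.exists_eq_prod hG h
  exact (β.isConjProd_prod hk).mul (α.isConjProd_prod hk).inv

end IndepGeometry

/-! ### Predimension and dimension -/

namespace UHypergraph

section Predimension

variable {r n m : ℕ} {V W : Type*} {H : UHypergraph r V} {K : UHypergraph r W}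

open Classical in
/-- The set `R[X]` of the edges contained in the finite set `X`. -/
noncomputable def edgesIn (H : UHypergraph r V) (X : Finset V) : Finset (Finset V) :=
  X.powerset.filter (· ∈ H.edges)

theorem mem_edgesIn {X e : Finset V} : e ∈ H.edgesIn X ↔ e ⊆ X ∧ e ∈ H.edges := by
  simp only [edgesIn, Finset.mem_filter, Finset.mem_powerset]

theorem predim_eq (X : Finset V) :
    predim n m H X = n * (X.card : ℤ) - m * ((H.edgesIn X).card : ℤ) :=
  rfl

theorem predim_eq_of_card_lt {X : Finset V} (h : X.card < r) : predim n m H X = n * X.card := by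
  have hX : H.edgesIn X = ∅ := by
    refine Finset.eq_empty_of_forall_notMem fun e he => ?_
    obtain ⟨heX, he⟩ := mem_edgesIn.1 he
    exact (H.card_eq e he ▸ Finset.card_le_card heX).not_gt h
  rw [predim_eq, hX, Finset.card_empty, Nat.cast_zero, mul_zero, sub_zero]

variable [DecidableEq V]

theorem predim_union_add_predim_inter (X Y : Finset V) :
    predim n m H (X ∪ Y) + predim n m H (X ∩ Y) =
      predim n m H X + predim n m H Y -
        m * ((H.edgesIn (X ∪ Y)).card - (H.edgesIn X ∪ H.edgesIn Y).card) := by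
  have hinter : H.edgesIn (X ∩ Y) = H.edgesIn X ∩ H.edgesIn Y := by
    ext e
    simp only [mem_edgesIn, Finset.mem_inter, Finset.subset_inter_iff]
    tauto
  have hpts := Finset.card_union_add_card_inter X Y
  have hedges := Finset.card_union_add_card_inter (H.edgesIn X) (H.edgesIn Y)
  rw [← hinter] at hedges
  simp only [predim_eq]
  zify at hpts hedges
  linear_combination (n : ℤ) * hpts - (m : ℤ) * hedges

theorem predim_submod (X Y : Finset V) :
    predim n m H (X ∪ Y) + predim n m H (X ∩ Y) ≤ predim n m H X + predim n m H Y := by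
  have hsub : H.edgesIn X ∪ H.edgesIn Y ⊆ H.edgesIn (X ∪ Y) := by
    intro e
    simp only [Finset.mem_union, mem_edgesIn]
    rintro (⟨h, he⟩ | ⟨h, he⟩)
    exacts [⟨h.trans Finset.subset_union_left, he⟩, ⟨h.trans Finset.subset_union_right, he⟩]
  have hcard : ((H.edgesIn X ∪ H.edgesIn Y).card : ℤ) ≤ (H.edgesIn (X ∪ Y)).card :=
    Int.ofNat_le.2 (Finset.card_le_card hsub)
  rw [predim_union_add_predim_inter, sub_le_self_iff]
  exact mul_nonneg (Int.natCast_nonneg m) (sub_nonneg.2 hcard)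

/-- Every edge of the substructure on `X ∪ Y` is an edge of `X` or of `Y`, that is, `X ∪ Y` is the
free amalgam of `X` and `Y` over `X ∩ Y`. -/
def FreelyJoined (H : UHypergraph r V) (X Y : Finset V) : Prop :=
  ∀ e ∈ H.edges, e ⊆ X ∪ Y → e ⊆ X ∨ e ⊆ Y

namespace FreelyJoined

variable {X Y : Finset V}

theorem symm (h : FreelyJoined H X Y) : FreelyJoined H Y X :=
  fun e he hs => (h e he (Finset.union_comm Y X ▸ hs)).symm

theorem predim_union_add_predim_inter (h : FreelyJoined H X Y) :
    predim n m H (X ∪ Y) + predim n m H (X ∩ Y) = predim n m H X + predim n m H Y := by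
  have hedges : H.edgesIn (X ∪ Y) = H.edgesIn X ∪ H.edgesIn Y := by
    ext e
    simp only [Finset.mem_union, mem_edgesIn]
    constructor
    · exact fun ⟨heXY, he⟩ => (h e he heXY).imp (⟨·, he⟩) (⟨·, he⟩)
    · rintro (⟨h, he⟩ | ⟨h, he⟩)
      exacts [⟨h.trans Finset.subset_union_left, he⟩, ⟨h.trans Finset.subset_union_right, he⟩]
  rw [UHypergraph.predim_union_add_predim_inter, hedges, sub_self, mul_zero, sub_zero]

theorem inter_left (h : FreelyJoined H X Y) (S : Finset V) : FreelyJoined H (S ∩ X) (S ∩ Y) := by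
  intro e he hs
  rw [← Finset.inter_union_distrib_left, Finset.subset_inter_iff] at hs
  exact (h e he hs.2).imp (Finset.subset_inter hs.1) (Finset.subset_inter hs.1)

theorem mono_right (h : FreelyJoined H X Y) {Z : Finset V} (hXZ : X ∩ Y ⊆ Z) (hZ : Z ⊆ Y) :
    FreelyJoined H X Z := by
  refine fun e he hs => (h e he (hs.trans (Finset.union_subset_union_right hZ))).imp_right
    fun heY x hx => (Finset.mem_union.1 (hs hx)).elim (fun hxX => ?_) id
  exact hXZ (Finset.mem_inter.2 ⟨hxX, heY hx⟩)

end FreelyJoined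

theorem image_filter_mem {φ : W → V} {X : Finset W} {e : Finset V} (he : e ⊆ X.image φ) :
    (X.filter (φ · ∈ e)).image φ = e := by
  ext y
  simp only [Finset.mem_image, Finset.mem_filter]
  constructor
  · rintro ⟨x, ⟨-, hx⟩, rfl⟩
    exact hx
  · intro hy
    obtain ⟨x, hx, rfl⟩ := Finset.mem_image.1 (he hy)
    exact ⟨x, ⟨hx, hy⟩, rfl⟩

/-- The map `φ` is an embedding of the substructure of `K` on `X` into `H`. -/
structure LocEmb (K : UHypergraph r W) (H : UHypergraph r V) (φ : W → V) (X : Finset W) : Prop where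
  injOn : Set.InjOn φ X
  iff : ∀ e ⊆ X, e ∈ K.edges ↔ e.image φ ∈ H.edges

theorem LocEmb.mono {φ : W → V} {X Y : Finset W} (h : LocEmb K H φ X) (hY : Y ⊆ X) :
    LocEmb K H φ Y :=
  ⟨h.injOn.mono hY, fun e he => h.iff e (he.trans hY)⟩

theorem LocEmb.comp {T : Type*} [DecidableEq W] {L : UHypergraph r T} {g : T → W} {φ : W → V}
    {X : Finset T} (hφ : LocEmb K H φ (X.image g)) (hg : LocEmb L K g X) :
    LocEmb L H (φ ∘ g) X := by
  refine ⟨hφ.injOn.comp hg.injOn fun x hx => ?_, fun e he => ?_⟩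
  · exact Finset.mem_coe.2 (Finset.mem_image_of_mem g hx)
  · rw [hg.iff e he, hφ.iff _ (Finset.image_subset_image he), Finset.image_image]

theorem LocEmb.congr {φ ψ : W → V} {X : Finset W} (h : LocEmb K H φ X)
    (hψ : ∀ x ∈ X, ψ x = φ x) : LocEmb K H ψ X := by
  refine ⟨h.injOn.congr fun x hx => (hψ x hx).symm, fun e he => ?_⟩
  rw [Finset.image_congr fun x hx => hψ x (he hx)]
  exact h.iff e he

theorem LocEmb.union [DecidableEq W] {φ : W → V} {X Y : Finset W} (hX : LocEmb K H φ X)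
    (hY : LocEmb K H φ Y) (hfree : FreelyJoined K X Y)
    (hfree' : FreelyJoined H (X.image φ) (Y.image φ))
    (hinter : X.image φ ∩ Y.image φ ⊆ (X ∩ Y).image φ) : LocEmb K H φ (X ∪ Y) := by
  have mem_left : ∀ y ∈ X ∪ Y, φ y ∈ X.image φ → y ∈ X := by
    intro y hy hφy
    refine (Finset.mem_union.1 hy).elim id fun hyY => ?_
    obtain ⟨z, hz, hzy⟩ := Finset.mem_image.1
      (hinter (Finset.mem_inter.2 ⟨hφy, Finset.mem_image_of_mem φ hyY⟩))
    obtain ⟨hzX, hzY⟩ := Finset.mem_inter.1 hz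
    exact hY.injOn hzY hyY hzy ▸ hzX
  have mem_right : ∀ x ∈ X ∪ Y, φ x ∈ Y.image φ → x ∈ Y := by
    intro x hx hφx
    refine (Finset.mem_union.1 hx).elim (fun hxX => ?_) id
    obtain ⟨z, hz, hzx⟩ := Finset.mem_image.1
      (hinter (Finset.mem_inter.2 ⟨Finset.mem_image_of_mem φ hxX, hφx⟩))
    obtain ⟨hzX, hzY⟩ := Finset.mem_inter.1 hz
    exact hX.injOn hzX hxX hzx ▸ hzY
  refine ⟨fun x hx y hy hxy => ?_, fun e he => ⟨fun hK => ?_, fun hH => ?_⟩⟩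
  · rcases Finset.mem_union.1 hx with hxX | hxY
    · exact hX.injOn hxX (mem_left y hy (hxy ▸ Finset.mem_image_of_mem φ hxX)) hxy
    · exact hY.injOn hxY (mem_right y hy (hxy ▸ Finset.mem_image_of_mem φ hxY)) hxy
  · exact (hfree e hK he).elim (fun h => (hX.iff e h).1 hK) fun h => (hY.iff e h).1 hK
  · have hsub := Finset.image_subset_image (f := φ) he
    rw [Finset.image_union] at hsub
    rcases hfree' _ hH hsub with h | h
    · exact (hX.iff e fun x hx => mem_left x (he hx) (h (Finset.mem_image_of_mem φ hx))).2 hH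
    · exact (hY.iff e fun x hx => mem_right x (he hx) (h (Finset.mem_image_of_mem φ hx))).2 hH

theorem LocEmb.predim_image {φ : W → V} {X : Finset W} (h : LocEmb K H φ X) :
    predim n m H (X.image φ) = predim n m K X := by
  have hedges : (H.edgesIn (X.image φ)).card = (K.edgesIn X).card := by
    symm
    refine Finset.card_bij (fun e _ => e.image φ) (fun e he => ?_) (fun e he e' he' hee => ?_)
      fun e he => ?_
    · obtain ⟨heX, he⟩ := mem_edgesIn.1 he
      exact mem_edgesIn.2 ⟨Finset.image_subset_image heX, (h.iff e heX).1 he⟩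
    · have hcoe := congrArg (fun s : Finset V => (s : Set V)) hee
      simp only [Finset.coe_image] at hcoe
      exact Finset.coe_injective ((h.injOn.image_eq_image_iff
        (Finset.coe_subset.2 (mem_edgesIn.1 he).1)
        (Finset.coe_subset.2 (mem_edgesIn.1 he').1)).1 hcoe)
    · obtain ⟨heX, he⟩ := mem_edgesIn.1 he
      have hfilter := Finset.filter_subset (φ · ∈ e) X
      exact ⟨_, mem_edgesIn.2 ⟨hfilter, (h.iff _ hfilter).2 (by rwa [image_filter_mem heX])⟩,
        image_filter_mem heX⟩
  rw [predim_eq, predim_eq, Finset.card_image_of_injOn h.injOn, hedges]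

theorem locEmb_induce (H : UHypergraph r V) (S : Set V) (X : Finset S) :
    LocEmb (H.induce S) H Subtype.val X := by
  refine ⟨Subtype.val_injective.injOn, fun e _ => ?_⟩
  change e.map (Function.Embedding.subtype (· ∈ S)) ∈ H.edges ↔ _
  rw [Finset.map_eq_image]
  rfl

end Predimension

section Dimension

variable {r n m : ℕ} {V : Type*} {H : UHypergraph r V}

/-- Every finite substructure has non-negative predimension; this is what makes `dim` a minimum
rather than a junk value. -/
def Nonneg (n m : ℕ) (H : UHypergraph r V) : Prop := ∀ X, 0 ≤ predim n m H X

/-- A finite set is strong if every proper finite superset has larger predimension. In a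
structure with non-negative predimension these are the finite `d`-closed sets. -/
def Strong (n m : ℕ) (H : UHypergraph r V) (Z : Finset V) : Prop :=
  ∀ Y, Z ⊂ Y → predim n m H Z < predim n m H Y

/-- The set `Z` has smaller predimension than its proper supersets in `U`; for `Z ⊆ U` this says
that `Z` is `d`-closed in the substructure on `U`. -/
def StrongIn (n m : ℕ) (H : UHypergraph r V) (Z U : Finset V) : Prop :=
  ∀ Y, Y ⊆ U → Z ⊂ Y → predim n m H Z < predim n m H Y

theorem Strong.le {Z : Finset V} (hZ : Strong n m H Z) {Y : Finset V} (h : Z ⊆ Y) :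
    predim n m H Z ≤ predim n m H Y := by
  rcases h.eq_or_ssubset with rfl | h
  exacts [le_rfl, (hZ Y h).le]

theorem Strong.eq_of_le {Z Y : Finset V} (hZ : Strong n m H Z) (h : Z ⊆ Y)
    (hle : predim n m H Y ≤ predim n m H Z) : Y = Z := by
  rcases h.eq_or_ssubset with rfl | h
  exacts [rfl, absurd (hZ Y h) (not_lt.2 hle)]

theorem Strong.of_subset {Z S : Finset V} (hS : Strong n m H S)
    (h : StrongIn n m H Z S) (hZS : Z ⊆ S) : Strong n m H Z := by
  classical
  intro Y hY
  by_cases hYS : Y ⊆ S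
  · exact h Y hYS hY
  have hunion : predim n m H S < predim n m H (Y ∪ S) :=
    hS _ ⟨Finset.subset_union_right, fun h => hYS (Finset.subset_union_left.trans h)⟩
  have hinter : predim n m H Z ≤ predim n m H (Y ∩ S) := by
    rcases (Finset.subset_inter hY.1 hZS).eq_or_ssubset with e | e
    exacts [e ▸ le_rfl, (h _ Finset.inter_subset_right e).le]
  linarith [predim_submod (n := n) (m := m) (H := H) Y S]

theorem FreelyJoined.strongIn_union [DecidableEq V] {X Y Z : Finset V} (h : FreelyJoined H X Y)
    (hXZ : X ∩ Y ⊆ Z) (hZY : Z ⊆ Y) (hZ : StrongIn n m H Z Y) :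
    StrongIn n m H (X ∪ Z) (X ∪ Y) := by
  intro S hS hlt
  have hXS : X ⊆ S := Finset.subset_union_left.trans hlt.1
  have hZS : Z ⊆ S ∩ Y := Finset.subset_inter (Finset.subset_union_right.trans hlt.1) hZY
  have hunion : X ∪ S ∩ Y = S := by
    rw [Finset.union_inter_distrib_left, Finset.union_eq_right.2 hXS, Finset.inter_eq_left.2 hS]
  have hinter : ∀ T, X ∩ Y ⊆ T → T ⊆ Y → X ∩ T = X ∩ Y := fun T hT hTY =>
    (Finset.inter_subset_inter_left hTY).antisymm
      (Finset.subset_inter Finset.inter_subset_left hT)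
  have hlt' : predim n m H Z < predim n m H (S ∩ Y) :=
    hZ _ Finset.inter_subset_right ⟨hZS, fun hSZ => hlt.2 <| by
      rw [← hunion]
      exact Finset.union_subset_union_right hSZ⟩
  have hS := (h.mono_right (hXZ.trans hZS) Finset.inter_subset_right).predim_union_add_predim_inter
    (n := n) (m := m)
  have hZ := (h.mono_right hXZ hZY).predim_union_add_predim_inter (n := n) (m := m)
  rw [hunion, hinter _ (hXZ.trans hZS) Finset.inter_subset_right] at hS
  rw [hinter Z hXZ hZY] at hZ
  linarith

theorem FreelyJoined.strongIn_left [DecidableEq V] {X Y : Finset V} (h : FreelyJoined H X Y)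
    (hY : StrongIn n m H (X ∩ Y) Y) : StrongIn n m H X (X ∪ Y) := by
  simpa only [Finset.union_eq_left.2 Finset.inter_subset_left]
    using h.strongIn_union subset_rfl Finset.inter_subset_right hY

theorem Nonneg.bddBelow_dim (hH : Nonneg n m H) (X : Finset V) :
    BddBelow {k | ∃ Y : Finset V, X ⊆ Y ∧ k = predim n m H Y} :=
  ⟨0, by rintro _ ⟨Y, -, rfl⟩; exact hH Y⟩

theorem Nonneg.dim_le (hH : Nonneg n m H) {X Y : Finset V} (h : X ⊆ Y) :
    dim n m H X ≤ predim n m H Y :=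
  csInf_le (hH.bddBelow_dim X) ⟨Y, h, rfl⟩

theorem Nonneg.exists_dim (hH : Nonneg n m H) (X : Finset V) :
    ∃ Y, X ⊆ Y ∧ predim n m H Y = dim n m H X := by
  obtain ⟨Y, hXY, hY⟩ :=
    Int.csInf_mem (s := {k | ∃ Y : Finset V, X ⊆ Y ∧ k = predim n m H Y})
      ⟨_, X, subset_rfl, rfl⟩ (hH.bddBelow_dim X)
  exact ⟨Y, hXY, hY.symm⟩

theorem Nonneg.dim_mono (hH : Nonneg n m H) {X Y : Finset V} (h : X ⊆ Y) :
    dim n m H X ≤ dim n m H Y := by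
  obtain ⟨Z, hYZ, hZ⟩ := hH.exists_dim Y
  exact hZ ▸ hH.dim_le (h.trans hYZ)

theorem Strong.dim_eq (hH : Nonneg n m H) {Z : Finset V} (hZ : Strong n m H Z) :
    dim n m H Z = predim n m H Z := by
  obtain ⟨Y, hZY, hY⟩ := hH.exists_dim Z
  exact le_antisymm (hH.dim_le subset_rfl) (hY ▸ hZ.le hZY)

theorem Nonneg.dim_submod [DecidableEq V] (hH : Nonneg n m H) (X Y : Finset V) :
    dim n m H (X ∪ Y) + dim n m H (X ∩ Y) ≤ dim n m H X + dim n m H Y := by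
  obtain ⟨X', hX, hdX⟩ := hH.exists_dim X
  obtain ⟨Y', hY, hdY⟩ := hH.exists_dim Y
  calc dim n m H (X ∪ Y) + dim n m H (X ∩ Y)
      ≤ predim n m H (X' ∪ Y') + predim n m H (X' ∩ Y') :=
        add_le_add (hH.dim_le (Finset.union_subset_union hX hY))
          (hH.dim_le (Finset.inter_subset_inter hX hY))
    _ ≤ predim n m H X' + predim n m H Y' := predim_submod X' Y'
    _ = dim n m H X + dim n m H Y := by rw [hdX, hdY]

theorem relDim_eq_sInf [DecidableEq V] (X : Finset V) (Z : Set V) :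
    relDim n m H X Z =
      sInf {k | ∃ Y : Finset V, (Y : Set V) ⊆ Z ∧ k = dim n m H (X ∪ Y) - dim n m H Y} := by
  unfold relDim
  congr!

theorem Nonneg.bddBelow_relDim [DecidableEq V] (hH : Nonneg n m H) (X : Finset V) (Z : Set V) :
    BddBelow {k | ∃ Y : Finset V, (Y : Set V) ⊆ Z ∧ k = dim n m H (X ∪ Y) - dim n m H Y} :=
  ⟨0, by
    rintro _ ⟨Y, -, rfl⟩
    exact sub_nonneg.2 (hH.dim_mono Finset.subset_union_right)⟩

theorem Nonneg.exists_relDim [DecidableEq V] (hH : Nonneg n m H) (X : Finset V) (Z : Set V) :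
    ∃ Y : Finset V, (Y : Set V) ⊆ Z ∧ relDim n m H X Z = dim n m H (X ∪ Y) - dim n m H Y := by
  rw [relDim_eq_sInf]
  exact Int.csInf_mem (s := {k | ∃ Y : Finset V, (Y : Set V) ⊆ Z ∧
    k = dim n m H (X ∪ Y) - dim n m H Y}) ⟨_, ∅, by simp, rfl⟩ (hH.bddBelow_relDim X Z)

theorem Nonneg.relDim_coe [DecidableEq V] (hH : Nonneg n m H) (X Z : Finset V) :
    relDim n m H X Z = dim n m H (X ∪ Z) - dim n m H Z := by
  apply le_antisymm
  · exact relDim_eq_sInf (H := H) X Z ▸ csInf_le (hH.bddBelow_relDim X Z) ⟨Z, subset_rfl, rfl⟩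
  · obtain ⟨Y, hYZ, hY⟩ := hH.exists_relDim X Z
    have hsubmod := hH.dim_submod (X ∪ Y) Z
    rw [Finset.union_assoc, Finset.union_eq_right.2 (Finset.coe_subset.1 hYZ)] at hsubmod
    have hinter : dim n m H Y ≤ dim n m H ((X ∪ Y) ∩ Z) :=
      hH.dim_mono (Finset.subset_inter Finset.subset_union_right (Finset.coe_subset.1 hYZ))
    linarith

theorem Nonneg.mem_dcl_coe [DecidableEq V] (hH : Nonneg n m H) {a : V} {Z : Finset V} :
    a ∈ dcl n m H Z ↔ dim n m H (insert a Z) = dim n m H Z := by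
  change relDim n m H {a} Z = 0 ↔ _
  rw [hH.relDim_coe, ← Finset.insert_eq, sub_eq_zero]

theorem Nonneg.dclosed_iff (hH : Nonneg n m H) {Z : Finset V} :
    DClosed n m H Z ↔ Strong n m H Z := by
  classical
  constructor
  · intro h
    have key : ∀ Y, Z ⊆ Y → predim n m H Y ≤ dim n m H Z → Y ⊆ Z := by
      intro Y hY hle a ha
      rw [← Finset.mem_coe, ← h, hH.mem_dcl_coe]
      exact le_antisymm ((hH.dim_le (Finset.insert_subset ha hY)).trans hle)
        (hH.dim_mono (Finset.subset_insert _ _))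
    obtain ⟨Y, hZY, hY⟩ := hH.exists_dim Z
    obtain rfl : Y = Z := (key Y hZY hY.le).antisymm hZY
    intro Y' hY'
    by_contra! hle
    exact hY'.2 (key Y' hY'.1 (hY ▸ hle))
  · intro h
    ext a
    rw [hH.mem_dcl_coe, Finset.mem_coe]
    refine ⟨fun ha => ?_, fun ha => by rw [Finset.insert_eq_of_mem ha]⟩
    obtain ⟨Y, haY, hY⟩ := hH.exists_dim (insert a Z)
    rw [ha, h.dim_eq hH] at hY
    exact h.eq_of_le ((Finset.subset_insert _ _).trans haY) hY.le ▸
      haY (Finset.mem_insert_self _ _)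

end Dimension

section Extension

variable {r n m : ℕ} {f : ℝ≥0 → ℝ≥0} {V W T : Type*} [DecidableEq W]
  {H : UHypergraph r V} {K : UHypergraph r W} {L : UHypergraph r T}

theorem exists_locEmb_fin (K : UHypergraph r W) (U : Finset W) :
    ∃ (N : ℕ) (L : UHypergraph r (Fin N)) (g : Fin N → W),
      LocEmb L K g Finset.univ ∧ Finset.univ.image g = U := by
  have hg : Function.Injective fun i => (U.equivFin.symm i : W) :=
    Subtype.val_injective.comp U.equivFin.symm.injective
  refine ⟨U.card, ⟨{e | e.image _ ∈ K.edges}, fun e he => ?_⟩, _,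
    ⟨hg.injOn, fun _ _ => Iff.rfl⟩, ?_⟩
  · rw [← K.card_eq _ he, Finset.card_image_of_injective e hg]
  · ext w
    simp only [Finset.mem_image, Finset.mem_univ, true_and]
    constructor
    · rintro ⟨i, rfl⟩
      exact (U.equivFin.symm i).2
    · exact fun hw => ⟨U.equivFin ⟨w, hw⟩, by simp⟩

/-- The predimensions of the subsets of `U` are bounded from below as in the class `C_f`. -/
def FBound (n m : ℕ) (f : ℝ≥0 → ℝ≥0) (K : UHypergraph r W) (U : Finset W) : Prop :=
  ∀ Y, Y ⊆ U → (f (Y.card : ℝ≥0) : ℝ) ≤ (predim n m K Y : ℝ)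

theorem LocEmb.injective [Fintype T] {g : T → W} (hg : LocEmb L K g Finset.univ) :
    Function.Injective g := by
  simpa only [Finset.coe_univ, Set.injOn_univ] using hg.injOn

theorem LocEmb.inCf [Fintype T] {g : T → W} (hg : LocEmb L K g Finset.univ)
    (hb : FBound n m f K (Finset.univ.image g)) : InCf n m f L := by
  have bound : ∀ X : Finset T, (f (X.card : ℝ≥0) : ℝ) ≤ (predim n m L X : ℝ) := by
    intro X
    have hX := hb (X.image g) (Finset.image_subset_image (Finset.subset_univ X))
    rwa [Finset.card_image_of_injective X hg.injective,
      (hg.mono (Finset.subset_univ X)).predim_image] at hX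
  refine ⟨⟨inferInstance, fun X => ?_⟩, bound⟩
  exact_mod_cast (f (X.card : ℝ≥0)).2.trans (bound X)

theorem LocEmb.dclosed [Fintype T] {g : T → W} (hg : LocEmb L K g Finset.univ)
    (hL : Nonneg n m L) {Z : Finset T}
    (h : StrongIn n m K (Z.image g) (Finset.univ.image g)) : DClosed n m L Z := by
  refine hL.dclosed_iff.2 fun Y hY => ?_
  rw [← (hg.mono (Finset.subset_univ Z)).predim_image,
    ← (hg.mono (Finset.subset_univ Y)).predim_image]
  exact h _ (Finset.image_subset_image (Finset.subset_univ Y))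
    ((Finset.image_ssubset_image hg.injective).2 hY)

theorem LocEmb.induce_preimage [Fintype T] {g : T → W} (hg : LocEmb L K g Finset.univ)
    {A B : Finset W} (hA : A ⊆ Finset.univ.image g) (hBA : B ⊆ A) (hb : FBound n m f K A)
    (hs : StrongIn n m K B A) :
    InCf n m f (L.induce (g ⁻¹' A)) ∧
      DClosed n m (L.induce (g ⁻¹' A)) (Subtype.val ⁻¹' (g ⁻¹' (B : Set W))) := by
  classical
  let _ : Fintype (g ⁻¹' (A : Set W)) := Fintype.ofFinite _
  have hA' : LocEmb (L.induce (g ⁻¹' A)) K (g ∘ Subtype.val) Finset.univ :=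
    (hg.mono (Finset.subset_univ _)).comp (locEmb_induce L _ _)
  have image_eq : ∀ C ⊆ A, (Finset.univ.filter fun t : g ⁻¹' (A : Set W) => g t ∈ C).image
      (g ∘ Subtype.val) = C := by
    intro C hC
    refine image_filter_mem fun w hw => ?_
    obtain ⟨t, -, rfl⟩ := Finset.mem_image.1 (hA (hC hw))
    exact Finset.mem_image.2 ⟨⟨t, hC hw⟩, Finset.mem_univ _, rfl⟩
  have huniv : Finset.univ.image (g ∘ Subtype.val : g ⁻¹' (A : Set W) → W) = A := by
    have hA := image_eq A subset_rfl
    rwa [Finset.filter_true_of_mem fun t _ => t.2] at hA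
  have hin := hA'.inCf (huniv.symm ▸ hb)
  refine ⟨hin, ?_⟩
  have hcl := hA'.dclosed (Z := Finset.univ.filter fun t => g t ∈ B) hin.1.2
    (by rwa [huniv, image_eq B hBA])
  rwa [Finset.coe_filter_univ] at hcl

/-- `HasFreeAmalgamation` only speaks of structures in `Type`, hence the passage to a copy on
`Fin N`. -/
theorem HasFreeAmalgamation.fBound (hf : HasFreeAmalgamation r n m f) {A₁ A₂ : Finset W}
    (hfree : FreelyJoined K A₁ A₂) (h₁ : FBound n m f K A₁) (h₂ : FBound n m f K A₂)
    (s₁ : StrongIn n m K (A₁ ∩ A₂) A₁) (s₂ : StrongIn n m K (A₁ ∩ A₂) A₂) :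
    FBound n m f K (A₁ ∪ A₂) := by
  obtain ⟨N, L, g, hg, hU⟩ := exists_locEmb_fin K (A₁ ∪ A₂)
  have mem : ∀ t, g t ∈ A₁ ∪ A₂ := fun t => hU ▸ Finset.mem_image_of_mem g (Finset.mem_univ t)
  obtain ⟨i₁, d₁⟩ := hg.induce_preimage (hU ▸ Finset.subset_union_left)
    Finset.inter_subset_left h₁ s₁
  obtain ⟨i₂, d₂⟩ := hg.induce_preimage (hU ▸ Finset.subset_union_right)
    Finset.inter_subset_right h₂ s₂
  rw [Finset.coe_inter, Set.preimage_inter] at d₁ d₂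
  have hamalgam : L.IsFreeAmalgam (g ⁻¹' A₁) (g ⁻¹' A₂) := by
    constructor
    · ext t
      simpa using mem t
    · intro e he
      have hsub : e.image g ⊆ A₁ ∪ A₂ := Finset.image_subset_iff.2 fun t _ => mem t
      exact (hfree _ ((hg.iff e (Finset.subset_univ e)).1 he) hsub).imp
        (fun h t ht => h (Finset.mem_image_of_mem g ht))
        fun h t ht => h (Finset.mem_image_of_mem g ht)
  obtain ⟨hL, -, -⟩ := hf (Fin N) L _ _ hamalgam i₁ i₂ d₁ d₂
  intro Y hY
  have hYg : (Finset.univ.filter (g · ∈ Y)).image g = Y := image_filter_mem (hU ▸ hY)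
  have hbound := hL.2 (Finset.univ.filter (g · ∈ Y))
  rwa [← (hg.mono (Finset.subset_univ _)).predim_image,
    ← Finset.card_image_of_injective _ hg.injective, hYg] at hbound

theorem LocEmb.exists_extend [Fintype T] [DecidableEq V] [Nonempty V] {g : T → W}
    (hg : LocEmb L K g Finset.univ) {φ : T ↪ V} (hφ : L.IsEmb H φ) :
    ∃ ψ : W → V, ψ ∘ g = φ ∧ LocEmb K H ψ (Finset.univ.image g) := by
  have hψ : Function.extend g φ (fun _ => Classical.arbitrary V) ∘ g = φ :=
    Function.extend_comp hg.injective _ _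
  refine ⟨_, hψ, ?_, fun e he => ?_⟩
  · rw [Finset.coe_image, Finset.coe_univ, ← hg.injective.injOn.comp_iff, hψ]
    exact φ.injective.injOn
  · rw [← image_filter_mem he, ← hg.iff _ (Finset.subset_univ _), Finset.image_image, hψ,
      ← Finset.map_eq_image]
    exact hφ _

theorem LocEmb.exists_lift [Fintype T] {g : T → W} (hg : LocEmb L K g Finset.univ) {ι : V → W}
    {X : Finset V} (hι : LocEmb H K ι X) (hX : X.image ι ⊆ Finset.univ.image g) :
    ∃ j : (X : Set V) ↪ T, (∀ x, g (j x) = ι x) ∧ (H.induce (X : Set V)).IsEmb L j := by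
  classical
  have hex : ∀ x : (X : Set V), ∃ t, g t = ι x := fun x => by
    obtain ⟨t, -, ht⟩ := Finset.mem_image.1 (hX (Finset.mem_image_of_mem ι x.2))
    exact ⟨t, ht⟩
  choose j hj using hex
  have hinj : Function.Injective j := fun x y h =>
    Subtype.ext (hι.injOn x.2 y.2 (by rw [← hj, ← hj, h]))
  refine ⟨⟨j, hinj⟩, hj, fun e => ?_⟩
  have hsub : e.image Subtype.val ⊆ X := Finset.image_subset_iff.2 fun x _ => x.2
  have hcomp : ι ∘ Subtype.val = g ∘ j := funext fun x => (hj x).symm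
  rw [(locEmb_induce H _ e).iff e subset_rfl, hι.iff _ hsub, Finset.map_eq_image,
    hg.iff _ (Finset.subset_univ _), Finset.image_image, Finset.image_image, hcomp]
  rfl

namespace IsGeneric

theorem fBound (hgen : IsGeneric n m f H) (X : Finset V) :
    (f (X.card : ℝ≥0) : ℝ) ≤ (predim n m H X : ℝ) := by
  classical
  have h := (hgen.age X X.finite_toSet).2 Finset.univ
  have himage : (Finset.univ : Finset (X : Set V)).image Subtype.val = X := by
    ext x
    simp
  rwa [← (locEmb_induce H _ _).predim_image,
    ← Finset.card_image_of_injective _ Subtype.val_injective, himage] at h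

theorem nonneg (hgen : IsGeneric n m f H) : Nonneg n m H := fun X => by
  exact_mod_cast (f (X.card : ℝ≥0)).2.trans (hgen.fBound X)

/-- `IsGeneric.extension` only speaks of structures in `Type`, hence the passage to a copy on
`Fin N`. -/
theorem exists_locEmb [DecidableEq V] [Nonempty V] (hgen : IsGeneric n m f H) {X : Finset V}
    (hX : Strong n m H X) {U : Finset W} (hU : FBound n m f K U) {ι : V → W}
    (hι : LocEmb H K ι X) (hιU : X.image ι ⊆ U) (hs : StrongIn n m K (X.image ι) U) :
    ∃ φ : W → V, LocEmb K H φ U ∧ Strong n m H (U.image φ) ∧ ∀ x ∈ X, φ (ι x) = x := by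
  obtain ⟨N, L, g, hg, rfl⟩ := exists_locEmb_fin K U
  obtain ⟨j, hj, hjemb⟩ := hg.exists_lift hι hιU
  have hL : InCf n m f L := hg.inCf hU
  have hcl : DClosed n m L (Set.range j) := by
    have himage : (Finset.univ.image j).image g = X.image ι := by
      ext w
      simp [hj]
    simpa using hg.dclosed (Z := Finset.univ.image j) hL.1.2 (himage ▸ hs)
  obtain ⟨φ, hφ, hφcl, hφj⟩ := hgen.extension X X.finite_toSet (hgen.nonneg.dclosed_iff.2 hX)
    (Fin N) L hL j hjemb hcl
  obtain ⟨ψ, hψg, hψ⟩ := hg.exists_extend hφ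
  refine ⟨ψ, hψ, ?_, fun x hx => ?_⟩
  · rw [Finset.image_image, hψg, ← hgen.nonneg.dclosed_iff]
    simpa using hφcl
  · rw [← hj ⟨x, hx⟩]
    exact (congrFun hψg _).trans (hφj ⟨x, hx⟩)

end IsGeneric

end Extension

/-! ### Closures and automorphisms of the generic structure -/

section Closure

variable {r n m : ℕ} {f : ℝ≥0 → ℝ≥0} {V : Type*} {H : UHypergraph r V}

theorem Strong.subset_of_predim_le (hH : Nonneg n m H) {X Y S : Finset V} (hS : Strong n m H S)
    (hXS : X ⊆ S) (hXY : X ⊆ Y) (hY : predim n m H Y ≤ dim n m H X) : Y ⊆ S := by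
  classical
  have hsubmod := predim_submod (n := n) (m := m) (H := H) Y S
  have hinter := hH.dim_le (Finset.subset_inter hXY hXS)
  exact Finset.union_eq_right.1
    (hS.eq_of_le (Y := Y ∪ S) Finset.subset_union_right (by linarith))

namespace IsGeneric

theorem exists_strong_superset (hgen : IsGeneric n m f H) (X : Finset V) :
    ∃ S, X ⊆ S ∧ Strong n m H S := by
  obtain ⟨S, hmono, hS, hU⟩ := hgen.chain
  have hcover : ∀ x, ∃ i, x ∈ S i := fun x => Set.mem_iUnion.1 (hU ▸ Set.mem_univ x)
  choose i hi using hcover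
  refine ⟨(hS (X.sup i)).1.toFinset, fun x hx => ?_, ?_⟩
  · rw [Set.Finite.mem_toFinset]
    exact hmono (Finset.le_sup hx) (hi x)
  · rw [← hgen.nonneg.dclosed_iff, Set.Finite.coe_toFinset]
    exact (hS _).2

theorem exists_closure (hgen : IsGeneric n m f H) (X : Finset V) :
    ∃ Y, X ⊆ Y ∧ Strong n m H Y ∧ predim n m H Y = dim n m H X := by
  obtain ⟨S, hXS, hS⟩ := hgen.exists_strong_superset X
  have sub : ∀ Y, X ⊆ Y → predim n m H Y = dim n m H X → Y ⊆ S := fun Y hY e =>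
    hS.subset_of_predim_le hgen.nonneg hXS hY e.le
  have hfin : {Y : Finset V | X ⊆ Y ∧ predim n m H Y = dim n m H X}.Finite :=
    S.powerset.finite_toSet.subset fun Y hY => Finset.mem_powerset.2 (sub Y hY.1 hY.2)
  obtain ⟨Y, ⟨hXY, hY⟩, hmax⟩ := hfin.exists_maximal (hgen.nonneg.exists_dim X)
  refine ⟨Y, hXY, fun Y' hY' => ?_, hY⟩
  by_contra! hle
  have hXY' := hXY.trans hY'.1
  exact hY'.2 (hmax ⟨hXY', le_antisymm (hY ▸ hle) (hgen.nonneg.dim_le hXY')⟩ hY'.1)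

/-- The `d`-closure of a finite set, as a finite set; `coe_clos` compares it with `dcl`. -/
noncomputable def clos (hgen : IsGeneric n m f H) (X : Finset V) : Finset V :=
  (hgen.exists_closure X).choose

variable (hgen : IsGeneric n m f H)

theorem subset_clos (X : Finset V) : X ⊆ hgen.clos X :=
  (hgen.exists_closure X).choose_spec.1

theorem strong_clos (X : Finset V) : Strong n m H (hgen.clos X) :=
  (hgen.exists_closure X).choose_spec.2.1

theorem predim_clos (X : Finset V) : predim n m H (hgen.clos X) = dim n m H X :=
  (hgen.exists_closure X).choose_spec.2.2

theorem clos_subset {X S : Finset V} (hS : Strong n m H S) (h : X ⊆ S) : hgen.clos X ⊆ S :=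
  hS.subset_of_predim_le hgen.nonneg h (hgen.subset_clos X) (hgen.predim_clos X).le

theorem clos_subset_clos {X Y : Finset V} (h : X ⊆ hgen.clos Y) : hgen.clos X ⊆ hgen.clos Y :=
  hgen.clos_subset (hgen.strong_clos Y) h

theorem clos_mono {X Y : Finset V} (h : X ⊆ Y) : hgen.clos X ⊆ hgen.clos Y :=
  hgen.clos_subset_clos (h.trans (hgen.subset_clos Y))

theorem clos_eq_iff {S : Finset V} : hgen.clos S = S ↔ Strong n m H S :=
  ⟨fun hS => hS ▸ hgen.strong_clos S,
    fun hS => (hgen.clos_subset hS subset_rfl).antisymm (hgen.subset_clos S)⟩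

theorem dim_clos (X : Finset V) : dim n m H (hgen.clos X) = dim n m H X := by
  rw [(hgen.strong_clos X).dim_eq hgen.nonneg, hgen.predim_clos]

theorem mem_clos_iff [DecidableEq V] {x : V} {X : Finset V} :
    x ∈ hgen.clos X ↔ dim n m H (insert x X) = dim n m H X := by
  constructor
  · intro h
    refine le_antisymm ?_ (hgen.nonneg.dim_mono (Finset.subset_insert _ _))
    rw [← hgen.dim_clos X]
    exact hgen.nonneg.dim_mono (Finset.insert_subset h (hgen.subset_clos X))
  · intro h
    obtain ⟨Y, hxY, hY⟩ := hgen.nonneg.exists_dim (insert x X)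
    have hYX : Y ⊆ hgen.clos X := (hgen.strong_clos X).subset_of_predim_le hgen.nonneg
      (hgen.subset_clos X) ((Finset.subset_insert _ _).trans hxY) (hY.trans h).le
    exact hYX (hxY (Finset.mem_insert_self _ _))

theorem coe_clos (X : Finset V) : (hgen.clos X : Set V) = dcl n m H X := by
  classical
  ext x
  rw [Finset.mem_coe, hgen.mem_clos_iff, hgen.nonneg.mem_dcl_coe]

end IsGeneric

end Closure

section Homogeneity

variable {r n m : ℕ} {f : ℝ≥0 → ℝ≥0} {V : Type*} [DecidableEq V] {H : UHypergraph r V}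

theorem locEmb_smul (σ : H.Aut) (X : Finset V) : LocEmb H H (σ • ·) X :=
  ⟨(MulAction.injective σ).injOn, fun e _ => by
    rw [σ.2 e, Finset.map_eq_image]
    rfl⟩

theorem smul_mem_edges_iff (σ : H.Aut) {e : Finset V} : σ • e ∈ H.edges ↔ e ∈ H.edges :=
  ((locEmb_smul σ e).iff e subset_rfl).symm

theorem predim_smul (σ : H.Aut) (X : Finset V) : predim n m H (σ • X) = predim n m H X :=
  (locEmb_smul σ X).predim_image

theorem Strong.smul {X : Finset V} (hX : Strong n m H X) (σ : H.Aut) : Strong n m H (σ • X) := by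
  intro Y hY
  rw [predim_smul, ← predim_smul σ⁻¹ Y]
  refine hX _ ?_
  rw [← inv_smul_smul σ X]
  exact ⟨Finset.smul_finset_subset_smul_finset hY.1,
    fun h => hY.2 (Finset.smul_finset_subset_smul_finset_iff.1 h)⟩

theorem Nonneg.dim_smul (hH : Nonneg n m H) (σ : H.Aut) (X : Finset V) :
    dim n m H (σ • X) = dim n m H X := by
  have le : ∀ (σ : H.Aut) X, dim n m H (σ • X) ≤ dim n m H X := by
    intro σ X
    obtain ⟨Y, hXY, hY⟩ := hH.exists_dim X
    rw [← hY, ← predim_smul σ]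
    exact hH.dim_le (Finset.smul_finset_subset_smul_finset hXY)
  exact (le σ X).antisymm (by simpa only [inv_smul_smul] using le σ⁻¹ (σ • X))

theorem exists_aut_limit (u : ℕ → V → V) (F : ℕ → Finset V) (hF : Monotone F)
    (hu : ∀ k, ∀ x ∈ F k, u (k + 1) x = u k x) (hemb : ∀ k, LocEmb H H (u k) (F k))
    (hcov : ∀ x, ∃ k, x ∈ F k) (hsurj : ∀ y, ∃ k, ∃ x ∈ F k, u k x = y) :
    ∃ σ : H.Aut, ∀ k, ∀ x ∈ F k, σ • x = u k x := by
  have agree : ∀ k l, k ≤ l → ∀ x ∈ F k, u l x = u k x := by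
    intro k l hkl
    induction l, hkl using Nat.le_induction with
    | base => exact fun _ _ => rfl
    | succ l hkl ih => exact fun x hx => by rw [hu l x (hF hkl hx), ih x hx]
  choose κ hκ using hcov
  let v : V → V := fun x => u (κ x) x
  have hv : ∀ k, ∀ x ∈ F k, v x = u k x := by
    intro k x hx
    rcases le_total k (κ x) with h | h
    exacts [agree k _ h x hx, (agree _ k h x (hκ x)).symm]
  have hfin : ∀ e : Finset V, ∃ k, e ⊆ F k := fun e =>
    ⟨e.sup κ, fun x hx => hF (Finset.le_sup hx) (hκ x)⟩
  have hinj : Function.Injective v := by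
    intro x y hxy
    obtain ⟨k, hk⟩ := hfin {x, y}
    have hx : x ∈ F k := hk (by simp)
    have hy : y ∈ F k := hk (by simp)
    rw [hv k x hx, hv k y hy] at hxy
    exact (hemb k).injOn hx hy hxy
  have hsurj : Function.Surjective v := by
    intro y
    obtain ⟨k, x, hx, rfl⟩ := hsurj y
    exact ⟨x, hv k x hx⟩
  refine ⟨⟨Equiv.ofBijective v ⟨hinj, hsurj⟩, fun e => ?_⟩, hv⟩
  obtain ⟨k, hk⟩ := hfin e
  rw [(hemb k).iff e hk, Finset.map_eq_image,
    ← Finset.image_congr (f := v) fun x hx => hv k x (hk hx)]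
  rfl

variable (H) in
omit [DecidableEq V] in
theorem closedAction_aut : ClosedAction H.Aut V := by
  classical
  intro u F hF hu hcov hsurj
  exact exists_aut_limit (fun k => (u k • ·)) F hF hu (fun k => locEmb_smul (u k) (F k)) hcov
    fun y => (hsurj y).imp fun _ hk => ⟨_, hk, smul_inv_smul _ _⟩

theorem image_image_of_leftInvOn {W : Type*} [DecidableEq W] {p : V → W} {q : W → V}
    {X : Finset V} (hq : Set.LeftInvOn q p X) : (X.image p).image q = X := by
  rw [Finset.image_image, Finset.image_congr (f := q ∘ p) (g := id) hq, Finset.image_id]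

theorem LocEmb.inv {W : Type*} [DecidableEq W] {K : UHypergraph r W} {p : V → W} {q : W → V}
    {X : Finset V} (h : LocEmb H K p X) (hq : Set.LeftInvOn q p X) :
    LocEmb K H q (X.image p) := by
  refine ⟨?_, fun e he => ?_⟩
  · rw [Finset.coe_image]
    rintro _ ⟨x, hx, rfl⟩ _ ⟨x', hx', rfl⟩ hxx'
    rw [hq hx, hq hx'] at hxx'
    rw [hxx']
  · have hfilter := Finset.filter_subset (p · ∈ e) X
    rw [← image_filter_mem he, ← h.iff _ hfilter,
      image_image_of_leftInvOn (hq.mono (Finset.coe_subset.2 hfilter))]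

namespace IsGeneric

variable (hgen : IsGeneric n m f H)
include hgen

theorem exists_extend {p : V → V} {X : Finset V} (hp : LocEmb H H p X) (hX : Strong n m H X)
    (hX' : Strong n m H (X.image p)) (y : V) :
    ∃ (p' : V → V) (X' : Finset V), X ⊆ X' ∧ y ∈ X' ∧ (∀ x ∈ X, p' x = p x) ∧
      LocEmb H H p' X' ∧ Strong n m H X' ∧ Strong n m H (X'.image p') := by
  have : Nonempty V := ⟨y⟩
  have hq : Set.LeftInvOn (Function.invFunOn p X) p X := hp.injOn.leftInvOn_invFunOn
  have hXY : X ⊆ hgen.clos (insert y X) := (Finset.subset_insert _ _).trans (hgen.subset_clos _)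
  obtain ⟨φ, hφ, hφY, hφq⟩ := hgen.exists_locEmb hX' (U := hgen.clos (insert y X)) (K := H)
    (fun Y _ => hgen.fBound Y) (hp.inv hq) (by rwa [image_image_of_leftInvOn hq])
    (by rw [image_image_of_leftInvOn hq]; exact fun Y _ hY => hX Y hY)
  refine ⟨φ, _, hXY, hgen.subset_clos _ (Finset.mem_insert_self _ _), fun x hx => ?_, hφ,
    hgen.strong_clos _, hφY⟩
  have hφp := hφq (p x) (Finset.mem_image_of_mem p hx)
  rwa [hq hx] at hφp

theorem exists_extend_range {p : V → V} {X : Finset V} (hp : LocEmb H H p X)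
    (hX : Strong n m H X) (hX' : Strong n m H (X.image p)) (y : V) :
    ∃ (p' : V → V) (X' : Finset V), X ⊆ X' ∧ y ∈ X'.image p' ∧ (∀ x ∈ X, p' x = p x) ∧
      LocEmb H H p' X' ∧ Strong n m H X' ∧ Strong n m H (X'.image p') := by
  have : Nonempty V := ⟨y⟩
  have hq : Set.LeftInvOn (Function.invFunOn p X) p X := hp.injOn.leftInvOn_invFunOn
  obtain ⟨q', Y, hXY, hyY, hq'q, hq', hY, hY'⟩ := hgen.exists_extend (hp.inv hq) hX'
    (by rwa [image_image_of_leftInvOn hq]) y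
  have hp' : Set.LeftInvOn (Function.invFunOn q' Y) q' Y := hq'.injOn.leftInvOn_invFunOn
  have hq'p : ∀ x ∈ X, q' (p x) = x := fun x hx => by
    rw [hq'q _ (Finset.mem_image_of_mem p hx), hq hx]
  refine ⟨Function.invFunOn q' Y, Y.image q', fun x hx => ?_, ?_, fun x hx => ?_, hq'.inv hp',
    hY', ?_⟩
  · exact Finset.mem_image.2 ⟨p x, hXY (Finset.mem_image_of_mem p hx), hq'p x hx⟩
  · rwa [image_image_of_leftInvOn hp']
  · have hpx := hp' (hXY (Finset.mem_image_of_mem p hx))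
    rwa [hq'p x hx] at hpx
  · rwa [image_image_of_leftInvOn hp']

theorem exists_aut {p : V → V} {X : Finset V} (hp : LocEmb H H p X) (hX : Strong n m H X)
    (hX' : Strong n m H (X.image p)) : ∃ σ : H.Aut, ∀ x ∈ X, σ • x = p x := by
  rcases isEmpty_or_nonempty V with hV | hV
  · exact ⟨1, fun x => hV.elim x⟩
  have := hgen.countable
  obtain ⟨y, hy⟩ := exists_surjective_nat V
  let Stage := {s : (V → V) × Finset V // LocEmb H H s.1 s.2 ∧ Strong n m H s.2 ∧
    Strong n m H (s.2.image s.1)}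
  have step : ∀ (s : Stage) (y : V), ∃ s' : Stage, s.1.2 ⊆ s'.1.2 ∧
      (∀ x ∈ s.1.2, s'.1.1 x = s.1.1 x) ∧ y ∈ s'.1.2 ∧ y ∈ s'.1.2.image s'.1.1 := by
    rintro ⟨⟨p, X⟩, hp, hX, hX'⟩ y
    obtain ⟨p₁, X₁, sub₁, mem₁, eq₁, hp₁, hX₁, hX₁'⟩ := hgen.exists_extend hp hX hX' y
    obtain ⟨p₂, X₂, sub₂, mem₂, eq₂, hp₂, hX₂, hX₂'⟩ := hgen.exists_extend_range hp₁ hX₁ hX₁' y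
    exact ⟨⟨⟨p₂, X₂⟩, hp₂, hX₂, hX₂'⟩, sub₁.trans sub₂,
      fun x hx => (eq₂ x (sub₁ hx)).trans (eq₁ x hx), sub₂ mem₁, mem₂⟩
  choose next next_sub next_eq mem_next mem_image_next using step
  let stage : ℕ → Stage := fun j => Nat.rec ⟨(p, X), hp, hX, hX'⟩ (fun i s => next s (y i)) j
  obtain ⟨σ, hσ⟩ := exists_aut_limit (H := H) (fun j => (stage j).1.1) (fun j => (stage j).1.2)
    (monotone_nat_of_le_succ fun j => next_sub _ _) (fun j => next_eq _ _)
    (fun j => (stage j).2.1)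
    (fun x => by
      obtain ⟨j, rfl⟩ := hy x
      exact ⟨j + 1, mem_next _ _⟩)
    (fun x => by
      obtain ⟨j, rfl⟩ := hy x
      exact ⟨j + 1, Finset.mem_image.1 (mem_image_next (stage j) (y j))⟩)
  exact ⟨σ, hσ 0⟩

end IsGeneric

end Homogeneity

/-! ### Free amalgams in the generic structure -/

section FreeAmalgams

variable {r n m : ℕ} {f : ℝ≥0 → ℝ≥0} {V W : Type*} [DecidableEq V] {H : UHypergraph r V}
  {K : UHypergraph r W}

/-- The set `P ∪ Q` is strong, and is the free amalgam of `P` and `Q` over `B`. -/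
structure FreeOver (n m : ℕ) (H : UHypergraph r V) (P Q B : Finset V) : Prop where
  inter : P ∩ Q = B
  strong : Strong n m H (P ∪ Q)
  free : FreelyJoined H P Q

namespace FreeOver

variable {P Q B : Finset V}

theorem symm (h : FreeOver n m H P Q B) : FreeOver n m H Q P B :=
  ⟨Finset.inter_comm Q P ▸ h.inter, Finset.union_comm P Q ▸ h.strong, h.free.symm⟩

theorem subset_left (h : FreeOver n m H P Q B) : B ⊆ P := h.inter ▸ Finset.inter_subset_left

theorem subset_right (h : FreeOver n m H P Q B) : B ⊆ Q := h.inter ▸ Finset.inter_subset_right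

theorem predim_inter_add (h : FreeOver n m H P Q B) {Y : Finset V} (hY : Y ⊆ P ∪ Q) :
    predim n m H Y + predim n m H (Y ∩ B) = predim n m H (Y ∩ P) + predim n m H (Y ∩ Q) := by
  have hadd := (h.free.inter_left Y).predim_union_add_predim_inter (n := n) (m := m)
  rwa [← Finset.inter_union_distrib_left, Finset.inter_eq_left.2 hY,
    ← Finset.inter_inter_distrib_left, h.inter] at hadd

theorem image [DecidableEq W] {φ : W → V} {X Y : Finset W} (hφ : LocEmb K H φ (X ∪ Y))
    (hfree : FreelyJoined K X Y) (hstrong : Strong n m H ((X ∪ Y).image φ)) :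
    FreeOver n m H (X.image φ) (Y.image φ) ((X ∩ Y).image φ) := by
  rw [Finset.image_union] at hstrong
  refine ⟨(Finset.image_inter_of_injOn _ _ ?_).symm, hstrong, fun e he hs => ?_⟩
  · rw [← Finset.coe_union]
    exact hφ.injOn
  rw [← Finset.image_union] at hs
  rw [← image_filter_mem hs] at he ⊢
  have hsub := Finset.filter_subset (φ · ∈ e) (X ∪ Y)
  exact (hfree _ ((hφ.iff _ hsub).2 he) hsub).imp Finset.image_subset_image
    Finset.image_subset_image

theorem smul (h : FreeOver n m H P Q B) (σ : H.Aut) :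
    FreeOver n m H (σ • P) (σ • Q) (σ • B) :=
  h.inter ▸ image (locEmb_smul σ _) h.free (h.strong.smul σ)

theorem mono_right (h : FreeOver n m H P Q B) {Q' : Finset V} (hQ' : Strong n m H Q')
    (hB : B ⊆ Q') (hQ : Q' ⊆ Q) : FreeOver n m H P Q' B := by
  have hPQ : P ∩ Q ⊆ Q' := h.inter ▸ hB
  refine ⟨?_, h.strong.of_subset ?_ (Finset.union_subset_union_right hQ), h.free.mono_right hPQ hQ⟩
  · rw [← h.inter]
    exact (Finset.inter_subset_inter_left hQ).antisymm
      (Finset.subset_inter Finset.inter_subset_left hPQ)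
  · exact h.free.strongIn_union hPQ hQ fun Y _ => hQ' Y

theorem trans (h : FreeOver n m H P Q B) {Q₁ : Finset V} (h' : FreeOver n m H (P ∪ Q) Q₁ Q) :
    FreeOver n m H P Q₁ B := by
  have hunion : P ∪ Q ∪ Q₁ = P ∪ Q₁ := by
    rw [Finset.union_assoc, Finset.union_eq_right.2 h'.subset_right]
  refine ⟨?_, hunion ▸ h'.strong, fun e he hs => ?_⟩
  · calc P ∩ Q₁ = P ∩ (P ∪ Q) ∩ Q₁ := by rw [Finset.inter_eq_left.2 Finset.subset_union_left]
      _ = B := by rw [Finset.inter_assoc, h'.inter, h.inter]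
  · rcases h'.free e he (hunion ▸ hs) with hPQ | hQ₁
    exacts [(h.free e he hPQ).imp_right fun hQ => hQ.trans h'.subset_right, Or.inr hQ₁]

end FreeOver

section OfDim

variable {A B D E P Q : Finset V}

theorem Strong.inter_eq_of_le_dim (hH : Nonneg n m H) (hD : Strong n m H D) (hDA : D ⊆ A)
    (hDB : D ⊆ B)
    (h : predim n m H A + predim n m H B ≤ dim n m H (A ∪ B) + predim n m H D) : A ∩ B = D := by
  have hdim := hH.dim_le (X := A ∪ B) subset_rfl
  have hsubmod := predim_submod (n := n) (m := m) (H := H) A B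
  exact hD.eq_of_le (Finset.subset_inter hDA hDB) (by linarith)

theorem Strong.predim_add_predim_inter_le (hH : Nonneg n m H) (hB : Strong n m H B) {Y : Finset V}
    (hAY : A ⊆ Y)
    (h : predim n m H A + predim n m H B ≤ dim n m H (A ∪ B) + predim n m H D) :
    predim n m H A + predim n m H (Y ∩ B) ≤ predim n m H Y + predim n m H D := by
  obtain ⟨Z, hYZ, hZ⟩ := hH.exists_dim (Y ∩ B)
  have hZB : Z ⊆ B := hB.subset_of_predim_le hH Finset.inter_subset_right hYZ hZ.le
  have hYZ_inter : Y ∩ Z = Y ∩ B := (Finset.inter_subset_inter_left hZB).antisymm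
    (Finset.subset_inter Finset.inter_subset_left hYZ)
  have hpredim := predim_submod (n := n) (m := m) (H := H) Y Z
  have hdim := hH.dim_submod (A ∪ Z) B
  have hle : dim n m H (A ∪ Z) ≤ predim n m H (Y ∪ Z) :=
    hH.dim_le (Finset.union_subset_union_left hAY)
  have hle' : dim n m H Z ≤ dim n m H ((A ∪ Z) ∩ B) :=
    hH.dim_mono (Finset.subset_inter Finset.subset_union_right hZB)
  have hZle : predim n m H Z ≤ dim n m H Z := hZ ▸ hH.dim_mono hYZ
  rw [hYZ_inter] at hpredim
  rw [Finset.union_assoc, Finset.union_eq_right.2 hZB, hB.dim_eq hH] at hdim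
  linarith

theorem FreelyJoined.of_inter_eq (h : FreelyJoined H P Q) (hAP : A ⊆ P) (hEQ : E ⊆ Q)
    (hA : A ∩ (P ∩ Q) ⊆ E) (hE : E ∩ (P ∩ Q) ⊆ A) : FreelyJoined H A E := by
  intro e he hs
  refine (h e he (hs.trans (Finset.union_subset_union hAP hEQ))).imp (fun heP x hx => ?_)
    fun heQ x hx => ?_
  · exact (Finset.mem_union.1 (hs hx)).elim id fun hxE =>
      hE (Finset.mem_inter.2 ⟨hxE, Finset.mem_inter.2 ⟨heP hx, hEQ hxE⟩⟩)
  · exact (Finset.mem_union.1 (hs hx)).elim (fun hxA =>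
      hA (Finset.mem_inter.2 ⟨hxA, Finset.mem_inter.2 ⟨hAP hxA, heQ hx⟩⟩)) id

theorem FreeOver.predim_union_lt_of_le_dim (h : FreeOver n m H P Q B) (hfree : FreelyJoined H A E)
    (hAE : A ∩ E = D) (hA : Strong n m H A) (hE : Strong n m H E) (hD : Strong n m H D)
    (hB : Strong n m H B) (hDB : D ⊆ B) (hAP : A ⊆ P) (hEQ : E ⊆ Q) (hH : Nonneg n m H)
    (dA : predim n m H A + predim n m H B ≤ dim n m H (A ∪ B) + predim n m H D)
    (dE : predim n m H E + predim n m H B ≤ dim n m H (E ∪ B) + predim n m H D) {Y : Finset V}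
    (hY : Y ⊆ P ∪ Q) (hlt : A ∪ E ⊂ Y) : predim n m H (A ∪ E) < predim n m H Y := by
  have hYP : A ⊆ Y ∩ P := Finset.subset_inter (Finset.subset_union_left.trans hlt.1) hAP
  have hYQ : E ⊆ Y ∩ Q := Finset.subset_inter (Finset.subset_union_right.trans hlt.1) hEQ
  have hDY : D ⊆ Y := (hAE ▸ Finset.inter_subset_left).trans (hYP.trans Finset.inter_subset_left)
  have hYB : ∀ {S}, B ⊆ S → Y ∩ S ∩ B = Y ∩ B := fun hS => by
    rw [Finset.inter_assoc, Finset.inter_eq_right.2 hS]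
  have hAEadd := hfree.predim_union_add_predim_inter (n := n) (m := m)
  have hYadd := h.predim_inter_add hY
  rw [hAE] at hAEadd
  rcases (Finset.subset_inter hDY hDB).eq_or_ssubset with hDYB | hDYB
  · rw [← hDYB] at hYadd
    by_contra hle
    have leA := hA.le hYP
    have leE := hE.le hYQ
    have eqA := hA.eq_of_le hYP (by linarith)
    have eqE := hE.eq_of_le hYQ (by linarith)
    refine hlt.2 ?_
    rw [← eqA, ← eqE, ← Finset.inter_union_distrib_left, Finset.inter_eq_left.2 hY]
  · have leA := hB.predim_add_predim_inter_le hH hYP dA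
    have leE := hB.predim_add_predim_inter_le hH hYQ dE
    rw [hYB h.subset_left] at leA
    rw [hYB h.subset_right] at leE
    linarith [hD _ hDYB]

/-- The hypotheses `dA` and `dE` say that `A` and `E` are independent from `B` over `D` in the
sense of the dimension. -/
theorem FreeOver.of_le_dim (hH : Nonneg n m H) (h : FreeOver n m H P Q B)
    (hA : Strong n m H A) (hE : Strong n m H E) (hD : Strong n m H D) (hB : Strong n m H B)
    (hDA : D ⊆ A) (hDE : D ⊆ E) (hDB : D ⊆ B) (hAP : A ⊆ P) (hEQ : E ⊆ Q)
    (dA : predim n m H A + predim n m H B ≤ dim n m H (A ∪ B) + predim n m H D)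
    (dE : predim n m H E + predim n m H B ≤ dim n m H (E ∪ B) + predim n m H D) :
    FreeOver n m H A E D := by
  have hAB : A ∩ B = D := hD.inter_eq_of_le_dim hH hDA hDB dA
  have hEB : E ∩ B = D := hD.inter_eq_of_le_dim hH hDE hDB dE
  have hAE : A ∩ E = D := by
    refine Finset.Subset.antisymm ?_ (Finset.subset_inter hDA hDE)
    rw [← hAB, ← h.inter]
    exact Finset.subset_inter Finset.inter_subset_left (Finset.inter_subset_inter hAP hEQ)
  have hfree : FreelyJoined H A E := h.free.of_inter_eq hAP hEQ
    (by rw [h.inter, hAB]; exact hDE) (by rw [h.inter, hEB]; exact hDA)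
  exact ⟨hAE, h.strong.of_subset (fun Y hY hlt => h.predim_union_lt_of_le_dim hfree hAE hA hE hD hB
    hDB hAP hEQ hH dA dE hY hlt) (Finset.union_subset_union hAP hEQ), hfree⟩

end OfDim

namespace IsGeneric

theorem exists_glue (hgen : IsGeneric n m f H) {P Q B : Finset V} (h : FreeOver n m H P Q B)
    {α β : H.Aut} (h' : FreeOver n m H (α • P) (β • Q) (α • B)) (hαβ : ∀ x ∈ B, α • x = β • x) :
    ∃ γ : H.Aut, (∀ x ∈ P, γ • x = α • x) ∧ ∀ x ∈ Q, γ • x = β • x := by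
  let p : V → V := fun x => if x ∈ P then α • x else β • x
  have hpP : ∀ x ∈ P, p x = α • x := fun x hx => if_pos hx
  have hpQ : ∀ x ∈ Q, p x = β • x := fun x hxQ => by
    by_cases hxP : x ∈ P
    · rw [hpP x hxP, hαβ x (h.inter ▸ Finset.mem_inter.2 ⟨hxP, hxQ⟩)]
    · exact if_neg hxP
  have imP : P.image p = α • P := Finset.image_congr hpP
  have imQ : Q.image p = β • Q := Finset.image_congr hpQ
  have imB : (P ∩ Q).image p = α • B :=
    h.inter ▸ Finset.image_congr fun x hx => hpP x (Finset.mem_inter.1 hx).1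
  have hp : LocEmb H H p (P ∪ Q) := by
    refine ((locEmb_smul α P).congr hpP).union ((locEmb_smul β Q).congr hpQ) h.free ?_ ?_
    · rw [imP, imQ]
      exact h'.free
    · rw [imP, imQ, imB, h'.inter]
  obtain ⟨γ, hγ⟩ := hgen.exists_aut hp h.strong (by
    rw [Finset.image_union, imP, imQ]
    exact h'.strong)
  exact ⟨γ, fun x hx => (hγ x (Finset.mem_union_left _ hx)).trans (hpP x hx),
    fun x hx => (hγ x (Finset.mem_union_right _ hx)).trans (hpQ x hx)⟩

end IsGeneric

end FreeAmalgams

section ExistsFreeOver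

variable {r n m : ℕ} {f : ℝ≥0 → ℝ≥0} {V W : Type*} [DecidableEq V]
  {H : UHypergraph r V} {K : UHypergraph r W}

/-- The hypergraph in which the subsets `A₁` and `A₂`, each identified with a substructure of `H`
by means of `p`, are freely joined. -/
def amalgam (H : UHypergraph r V) {p : W → V} {A₁ A₂ : Finset W} (h₁ : Set.InjOn p A₁)
    (h₂ : Set.InjOn p A₂) : UHypergraph r W where
  edges := {e | (e ⊆ A₁ ∨ e ⊆ A₂) ∧ e.image p ∈ H.edges}
  card_eq := by
    rintro e ⟨he, hpe⟩
    have hinj : Set.InjOn p e := he.elim (fun h => h₁.mono h) fun h => h₂.mono h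
    rw [← H.card_eq _ hpe, Finset.card_image_of_injOn hinj]

section Amalgam

variable {p : W → V} {A₁ A₂ : Finset W} (h₁ : Set.InjOn p A₁) (h₂ : Set.InjOn p A₂)

theorem freelyJoined_amalgam [DecidableEq W] : FreelyJoined (amalgam H h₁ h₂) A₁ A₂ :=
  fun _ he _ => he.1

theorem locEmb_amalgam_left : LocEmb (amalgam H h₁ h₂) H p A₁ :=
  ⟨h₁, fun _ he => ⟨fun h => h.2, fun h => ⟨Or.inl he, h⟩⟩⟩

theorem locEmb_amalgam_right : LocEmb (amalgam H h₁ h₂) H p A₂ :=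
  ⟨h₂, fun _ he => ⟨fun h => h.2, fun h => ⟨Or.inr he, h⟩⟩⟩

end Amalgam

theorem LocEmb.strongIn {φ : W → V} {Z U : Finset W} (hφ : LocEmb K H φ U)
    (hZ : Strong n m H (Z.image φ)) (hZU : Z ⊆ U) : StrongIn n m K Z U := by
  intro Y hYU hZY
  rw [← (hφ.mono hZU).predim_image, ← (hφ.mono hYU).predim_image]
  refine hZ _ ?_
  rw [← Finset.coe_ssubset, Finset.coe_image, Finset.coe_image]
  exact (hφ.injOn.image_ssubset_image_iff (Finset.coe_subset.2 hZU) (Finset.coe_subset.2 hYU)).2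
    (Finset.coe_ssubset.2 hZY)

theorem LocEmb.strong_image {φ : W → V} {Z U : Finset W} (hφ : LocEmb K H φ U)
    (hU : Strong n m H (U.image φ)) (hZU : Z ⊆ U) (hZ : StrongIn n m K Z U) :
    Strong n m H (Z.image φ) := by
  refine hU.of_subset (fun Y hY hZY => ?_) (Finset.image_subset_image hZU)
  have hYU := Finset.filter_subset (φ · ∈ Y) U
  rw [← image_filter_mem hY] at hZY ⊢
  rw [(hφ.mono hYU).predim_image, (hφ.mono hZU).predim_image]
  refine hZ _ hYU ⟨fun z hz => ?_, fun h => hZY.2 (Finset.image_subset_image h)⟩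
  rw [image_filter_mem hY] at hZY
  exact Finset.mem_filter.2 ⟨hZU hz, hZY.1 (Finset.mem_image_of_mem φ hz)⟩

namespace IsGeneric

theorem fBound_of_locEmb (hgen : IsGeneric n m f H) {φ : W → V} {U : Finset W}
    (hφ : LocEmb K H φ U) : FBound n m f K U := by
  intro Y hY
  have hbound := hgen.fBound (Y.image φ)
  rwa [(hφ.mono hY).predim_image, Finset.card_image_of_injOn (hφ.mono hY).injOn] at hbound

theorem exists_freeOver_image [DecidableEq W] [Nonempty V] [Nonempty W] (hgen : IsGeneric n m f H)
    (hf : HasFreeAmalgamation r n m f) {p : W → V} {A₁ A₂ : Finset W} (h₁ : Set.InjOn p A₁)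
    (h₂ : Set.InjOn p A₂) (s₁ : Strong n m H (A₁.image p)) (s₂ : Strong n m H (A₂.image p))
    (s : Strong n m H ((A₁ ∩ A₂).image p)) :
    ∃ σ : H.Aut, (∀ x ∈ A₁ ∩ A₂, σ • p x = p x) ∧
      FreeOver n m H (σ • A₁.image p) (A₂.image p) ((A₁ ∩ A₂).image p) := by
  have hq₁ := h₁.leftInvOn_invFunOn
  have hq₂ := h₂.leftInvOn_invFunOn
  have hfree := freelyJoined_amalgam (H := H) h₁ h₂
  have hp₁ := locEmb_amalgam_left (H := H) h₁ h₂
  have hp₂ := locEmb_amalgam_right (H := H) h₁ h₂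
  have t₁ := hp₁.strongIn s Finset.inter_subset_left
  have t₂ := hp₂.strongIn s Finset.inter_subset_right
  have hA₁ : StrongIn n m (amalgam H h₁ h₂) A₁ (A₁ ∪ A₂) := hfree.strongIn_left t₂
  have hA₂ : StrongIn n m (amalgam H h₁ h₂) A₂ (A₁ ∪ A₂) := by
    rw [Finset.union_comm]
    exact hfree.symm.strongIn_left (Finset.inter_comm A₁ A₂ ▸ t₁)
  have im₂ := image_image_of_leftInvOn hq₂
  obtain ⟨φ, hφ, hφA, hφp⟩ := hgen.exists_locEmb s₂
    (hf.fBound hfree (hgen.fBound_of_locEmb hp₁) (hgen.fBound_of_locEmb hp₂) t₁ t₂)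
    (hp₂.inv hq₂) (im₂.le.trans Finset.subset_union_right) (im₂.symm ▸ hA₂)
  have hφ₂ : ∀ x ∈ A₂, φ x = p x := fun x hx => by
    have hx' := hφp _ (Finset.mem_image_of_mem p hx)
    rwa [hq₂ hx] at hx'
  have im₁ := image_image_of_leftInvOn hq₁
  obtain ⟨σ, hσ⟩ := hgen.exists_aut (p := φ ∘ Function.invFunOn p A₁)
    (LocEmb.comp (im₁.symm ▸ hφ.mono Finset.subset_union_left) (hp₁.inv hq₁)) s₁ (by
      rw [← Finset.image_image, im₁]
      exact hφ.strong_image hφA Finset.subset_union_left hA₁)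
  have hσ₁ : ∀ x ∈ A₁, σ • p x = φ x := fun x hx => by
    rw [hσ _ (Finset.mem_image_of_mem p hx), Function.comp_apply, hq₁ hx]
  refine ⟨σ, fun x hx => ?_, ?_⟩
  · obtain ⟨hx₁, hx₂⟩ := Finset.mem_inter.1 hx
    rw [hσ₁ x hx₁, hφ₂ x hx₂]
  · have hσA₁ : σ • A₁.image p = A₁.image φ :=
      Finset.image_image.trans (Finset.image_congr hσ₁)
    rw [hσA₁, ← Finset.image_congr hφ₂,
      ← Finset.image_congr fun x hx => hφ₂ x (Finset.mem_inter.1 hx).2]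
    exact FreeOver.image hφ hfree hφA

theorem exists_freeOver (hgen : IsGeneric n m f H) (hf : HasFreeAmalgamation r n m f)
    {A B C : Finset V} (hA : Strong n m H A) (hB : Strong n m H B) (hC : Strong n m H C)
    (hBA : B ⊆ A) (hBC : B ⊆ C) :
    ∃ σ : H.Aut, (∀ x ∈ B, σ • x = x) ∧ FreeOver n m H (σ • A) C B := by
  rcases isEmpty_or_nonempty V with hV | hV
  · exact ⟨1, fun x => hV.elim x, Subsingleton.elim _ _, fun _ hY =>
      absurd (Subsingleton.elim _ _) hY.ne, fun _ _ _ => Or.inl fun x => hV.elim x⟩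
  let j : V → V ⊕ V := fun x => if x ∈ B then Sum.inl x else Sum.inr x
  let p : V ⊕ V → V := Sum.elim id id
  have hpj : Function.LeftInverse p j := fun x => by
    by_cases hx : x ∈ B <;> simp [p, j, hx]
  have hpl : Function.LeftInverse p Sum.inl := fun _ => rfl
  have injOn_image : ∀ {i : V → V ⊕ V} (X : Finset V), Function.LeftInverse p i →
      Set.InjOn p (X.image i) := by
    intro i X hi
    rw [Finset.coe_image]
    rintro _ ⟨x, -, rfl⟩ _ ⟨y, -, rfl⟩ hxy
    rw [hi, hi] at hxy
    rw [hxy]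
  have image_image : ∀ {i : V → V ⊕ V} (X : Finset V), Function.LeftInverse p i →
      (X.image i).image p = X := fun X hi =>
    image_image_of_leftInvOn (hi.leftInvOn _)
  have hinter : A.image Sum.inl ∩ C.image j = B.image Sum.inl := by
    ext y
    simp only [Finset.mem_inter, Finset.mem_image]
    constructor
    · rintro ⟨⟨x, -, rfl⟩, z, -, hz⟩
      by_cases hzB : z ∈ B <;> grind
    · rintro ⟨x, hx, rfl⟩
      exact ⟨⟨x, hBA hx, rfl⟩, x, hBC hx, if_pos hx⟩
  obtain ⟨σ, hσ, hfree⟩ := hgen.exists_freeOver_image hf (injOn_image A hpl)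
    (injOn_image C hpj) (by rwa [image_image A hpl]) (by rwa [image_image C hpj])
    (by rwa [hinter, image_image B hpl])
  rw [hinter, image_image A hpl, image_image B hpl, image_image C hpj] at hfree
  exact ⟨σ, fun x hx => hσ (Sum.inl x) (hinter ▸ Finset.mem_image_of_mem _ hx), hfree⟩

end IsGeneric

end ExistsFreeOver

section Geometry

variable {r n m : ℕ} {f : ℝ≥0 → ℝ≥0} {V : Type*} [DecidableEq V] {H : UHypergraph r V}

namespace IsGeneric

variable (hgen : IsGeneric n m f H)

theorem clos_union_subset {X Y Z : Finset V} (hX : X ⊆ hgen.clos Z) (hY : Y ⊆ Z) :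
    hgen.clos (X ∪ Y) ⊆ hgen.clos Z :=
  hgen.clos_subset_clos (Finset.union_subset hX (hY.trans (hgen.subset_clos Z)))

theorem clos_union_congr (X : Finset V) {Y Y' : Finset V} (h : hgen.clos Y = hgen.clos Y') :
    hgen.clos (X ∪ Y) = hgen.clos (X ∪ Y') := by
  have le : ∀ {Y Y'}, hgen.clos Y = hgen.clos Y' → hgen.clos (X ∪ Y) ⊆ hgen.clos (X ∪ Y') := by
    intro Y Y' h
    rw [Finset.union_comm X Y]
    exact hgen.clos_union_subset ((h ▸ hgen.subset_clos Y).trans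
      (hgen.clos_mono Finset.subset_union_right)) Finset.subset_union_left
  exact (le h).antisymm (le h.symm)

theorem smul_clos (σ : H.Aut) (X : Finset V) : σ • hgen.clos X = hgen.clos (σ • X) := by
  have le : ∀ (σ : H.Aut) X, hgen.clos (σ • X) ⊆ σ • hgen.clos X := fun σ X =>
    hgen.clos_subset ((hgen.strong_clos X).smul σ)
      (Finset.smul_finset_subset_smul_finset (hgen.subset_clos X))
  refine Finset.Subset.antisymm ?_ (le σ X)
  rw [Finset.smul_finset_subset_iff]
  simpa only [inv_smul_smul] using le σ⁻¹ (σ • X)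

theorem dim_clos_union (X Y : Finset V) :
    dim n m H (hgen.clos X ∪ hgen.clos Y) = dim n m H (X ∪ Y) := by
  refine le_antisymm ?_ (hgen.nonneg.dim_mono
    (Finset.union_subset_union (hgen.subset_clos X) (hgen.subset_clos Y)))
  rw [← hgen.dim_clos (X ∪ Y)]
  exact hgen.nonneg.dim_mono (Finset.union_subset (hgen.clos_mono Finset.subset_union_left)
    (hgen.clos_mono Finset.subset_union_right))

theorem clos_union_eq {X Y B : Finset V} (h : FreeOver n m H (hgen.clos X) (hgen.clos Y) B) :
    hgen.clos (X ∪ Y) = hgen.clos X ∪ hgen.clos Y :=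
  (hgen.clos_subset h.strong (Finset.union_subset_union (hgen.subset_clos X)
    (hgen.subset_clos Y))).antisymm
    (Finset.union_subset (hgen.clos_mono Finset.subset_union_left)
      (hgen.clos_mono Finset.subset_union_right))

/-- The independence relation of the generic structure: the closures of `A ∪ B` and of `C ∪ B`
are freely amalgamated over the closure of `B`. -/
def FreeInd (A B C : Finset V) : Prop :=
  FreeOver n m H (hgen.clos (A ∪ B)) (hgen.clos (C ∪ B)) (hgen.clos B)

variable {hgen} {A B C : Finset V}

namespace FreeInd

theorem symm (h : hgen.FreeInd A B C) : hgen.FreeInd C B A := FreeOver.symm h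

theorem smul (h : hgen.FreeInd A B C) (σ : H.Aut) : hgen.FreeInd (σ • A) (σ • B) (σ • C) := by
  have hσ := FreeOver.smul h σ
  rwa [hgen.smul_clos, hgen.smul_clos, hgen.smul_clos, Finset.smul_finset_union,
    Finset.smul_finset_union] at hσ

theorem mono_right {C' : Finset V} (h : hgen.FreeInd A B C) (hC : C' ⊆ hgen.clos (C ∪ B)) :
    hgen.FreeInd A B C' :=
  FreeOver.mono_right h (hgen.strong_clos (C' ∪ B)) (hgen.clos_mono Finset.subset_union_right)
    (hgen.clos_union_subset hC Finset.subset_union_right)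

theorem mono {A' C' : Finset V} (h : hgen.FreeInd A B C) (hA : A' ⊆ hgen.clos (A ∪ B))
    (hC : C' ⊆ hgen.clos (C ∪ B)) : hgen.FreeInd A' B C' :=
  ((h.mono_right hC).symm.mono_right hA).symm

theorem trans {B₁ D : Finset V} (h : hgen.FreeInd A B C) (h' : hgen.FreeInd A B₁ D)
    (e : hgen.clos B₁ = hgen.clos (B ∪ C)) : hgen.FreeInd A B (C ∪ D) := by
  have eA : hgen.clos (A ∪ B₁) = hgen.clos (A ∪ B) ∪ hgen.clos (C ∪ B) := by
    rw [hgen.clos_union_congr A e, ← hgen.clos_union_eq h]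
    congr 1
    grind
  have eD : hgen.clos (D ∪ B₁) = hgen.clos (C ∪ D ∪ B) := by
    rw [hgen.clos_union_congr D e]
    congr 1
    ac_rfl
  unfold FreeInd at h'
  rw [eA, eD, e, Finset.union_comm B C] at h'
  exact FreeOver.trans h h'

theorem dim_add (h : hgen.FreeInd A B C) :
    dim n m H (A ∪ B ∪ C) + dim n m H B = dim n m H (A ∪ B) + dim n m H (B ∪ C) := by
  have hadd := h.free.predim_union_add_predim_inter (n := n) (m := m)
  rw [h.inter, ← hgen.clos_union_eq h] at hadd
  simp only [hgen.predim_clos] at hadd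
  rwa [Finset.union_comm C B, ← Finset.union_assoc, Finset.union_right_comm A B B,
    Finset.union_assoc A B B, Finset.union_self] at hadd

theorem of_dim_add {D : Finset V}
    (hA : dim n m H (A ∪ B ∪ C) + dim n m H B = dim n m H (A ∪ B) + dim n m H (B ∪ C))
    (hD : dim n m H (D ∪ B ∪ C) + dim n m H B = dim n m H (D ∪ B) + dim n m H (B ∪ C))
    (h : hgen.FreeInd A (B ∪ C) D) : hgen.FreeInd A B D := by
  have clos_le : ∀ {A : Finset V},
      dim n m H (A ∪ B ∪ C) + dim n m H B = dim n m H (A ∪ B) + dim n m H (B ∪ C) →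
      predim n m H (hgen.clos (A ∪ B)) + predim n m H (hgen.clos (B ∪ C)) ≤
        dim n m H (hgen.clos (A ∪ B) ∪ hgen.clos (B ∪ C)) + predim n m H (hgen.clos B) := by
    intro A hA
    have e : A ∪ B ∪ (B ∪ C) = A ∪ B ∪ C := by
      rw [← Finset.union_assoc, Finset.union_assoc A B B, Finset.union_self]
    rw [hgen.dim_clos_union, hgen.predim_clos, hgen.predim_clos, hgen.predim_clos, e, hA]
  have sub : ∀ A : Finset V, hgen.clos (A ∪ B) ⊆ hgen.clos (A ∪ (B ∪ C)) := fun A =>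
    hgen.clos_mono (Finset.union_subset_union_right Finset.subset_union_left)
  exact FreeOver.of_le_dim hgen.nonneg h (hgen.strong_clos _) (hgen.strong_clos _)
    (hgen.strong_clos _) (hgen.strong_clos _) (hgen.clos_mono Finset.subset_union_right)
    (hgen.clos_mono Finset.subset_union_right) (hgen.clos_mono Finset.subset_union_left)
    (sub A) (sub D) (clos_le hA) (clos_le hD)

theorem exists_glue (h : hgen.FreeInd A B C) {α β : H.Aut}
    (h' : hgen.FreeInd (α • A) (α • B) (β • C)) (hαβ : ∀ x ∈ hgen.clos B, α • x = β • x) :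
    ∃ γ : H.Aut, (∀ x ∈ hgen.clos (A ∪ B), γ • x = α • x) ∧
      ∀ x ∈ hgen.clos (C ∪ B), γ • x = β • x := by
  refine IsGeneric.exists_glue hgen h ?_ hαβ
  rw [hgen.smul_clos, hgen.smul_clos, hgen.smul_clos, Finset.smul_finset_union,
    Finset.smul_finset_union, ← smul_finset_congr fun x hx => hαβ x (hgen.subset_clos B hx)]
  exact h'

end FreeInd

variable (hgen)

theorem exists_freeInd (hf : HasFreeAmalgamation r n m f) (A B C : Finset V) :
    ∃ σ : H.Aut, (∀ x ∈ hgen.clos B, σ • x = x) ∧ hgen.FreeInd (σ • A) B C := by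
  obtain ⟨σ, hσ, h⟩ := hgen.exists_freeOver hf (hgen.strong_clos (A ∪ B)) (hgen.strong_clos B)
    (hgen.strong_clos (C ∪ B)) (hgen.clos_mono Finset.subset_union_right)
    (hgen.clos_mono Finset.subset_union_right)
  refine ⟨σ, hσ, ?_⟩
  rwa [hgen.smul_clos, Finset.smul_finset_union,
    smul_finset_eq_self fun x hx => hσ x (hgen.subset_clos B hx)] at h

/-- The dimension of the generic structure, with the action of the automorphism group, as a
dimension geometry. -/
noncomputable def dimGeometry (h0 : Strong n m H ∅) : DimGeometry H.Aut V where
  d := dim n m H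
  cl := hgen.clos
  d_mono := hgen.nonneg.dim_mono
  d_submod := hgen.nonneg.dim_submod
  d_smul := hgen.nonneg.dim_smul
  mem_cl_iff := hgen.mem_clos_iff.trans
    (hgen.nonneg.dim_mono (Finset.subset_insert _ _)).ge_iff_eq'.symm
  cl_empty := hgen.clos_eq_iff.2 h0

/-- The geometry of the generic structure, with free amalgamation as independence. -/
noncomputable def geometry (hf : HasFreeAmalgamation r n m f) (h0 : Strong n m H ∅) :
    IndepGeometry H.Aut V where
  toDimGeometry := hgen.dimGeometry h0
  Ind := hgen.FreeInd
  ind_smul σ _ _ _ h := h.smul σ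
  ind_symm := FreeInd.symm
  ind_mono := FreeInd.mono
  ind_trans := FreeInd.trans
  ind_exists := hgen.exists_freeInd hf
  ind_stationary _ _ h := h.exists_glue
  dimIndep_of_ind h := DimGeometry.dimIndep_iff.2 h.dim_add
  ind_of_dimIndep hA hD :=
    FreeInd.of_dim_add (DimGeometry.dimIndep_iff.1 hA) (DimGeometry.dimIndep_iff.1 hD)

variable {hgen}

theorem isBasic_of_basic {hf : HasFreeAmalgamation r n m f} {h0 : Strong n m H ∅} {b : V}
    (hb : (hgen.geometry hf h0).Basic b A) : IsBasic n m H b A := by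
  refine ⟨hb.1, ?_⟩
  rintro _ ⟨X, rfl⟩ hAC hlt
  rw [← hgen.coe_clos] at hAC hlt ⊢
  rw [hgen.nonneg.relDim_coe, hgen.nonneg.relDim_coe] at hlt
  exact hb.2 _ (hgen.clos_eq_iff.2 (hgen.strong_clos X)) (Finset.coe_subset.1 hAC) hlt

variable (hgen)

theorem exists_finset_of_mem_dcl_union {B Z : Set V} {x : V} (hx : x ∈ dcl n m H (B ∪ Z)) :
    ∃ Y F : Finset V, ↑Y ⊆ B ∧ ↑F ⊆ Z ∧ x ∈ hgen.clos (Y ∪ F) := by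
  classical
  obtain ⟨X, hX, hdim⟩ := hgen.nonneg.exists_relDim {x} (B ∪ Z)
  rw [show relDim n m H {x} (B ∪ Z) = 0 from hx, ← Finset.insert_eq] at hdim
  refine ⟨X.filter (· ∈ B), X.filter (· ∉ B), fun y hy => ?_, fun y hy => ?_, ?_⟩
  · exact (Finset.mem_filter.1 (Finset.mem_coe.1 hy)).2
  · obtain ⟨hyX, hyB⟩ := Finset.mem_filter.1 (Finset.mem_coe.1 hy)
    exact (hX hyX).resolve_left hyB
  · rw [Finset.filter_union_filter_not_eq, hgen.mem_clos_iff]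
    linarith

theorem isMonodimensional_geometry {hf : HasFreeAmalgamation r n m f} {h0 : Strong n m H ∅}
    (hmono : Monodimensional n m H) : (hgen.geometry hf h0).IsMonodimensional := by
  intro A b (hA : hgen.clos A = A) hb
  have hA' : (A : Set V) ∈ closedFam n m H := ⟨A, by rw [← hgen.coe_clos, hA]⟩
  obtain ⟨_, ⟨X, rfl⟩, hAB, huniv⟩ := hmono A hA' b (isBasic_of_basic hb)
  rw [← hgen.coe_clos] at hAB huniv
  refine ⟨hgen.clos X, Finset.coe_subset.1 hAB, fun x => ?_⟩
  obtain ⟨Y, F, hY, hF, hx⟩ := hgen.exists_finset_of_mem_dcl_union (huniv ▸ Set.mem_univ x)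
  refine ⟨F, fun y hy => ?_,
    hgen.clos_mono (Finset.union_subset_union_left (Finset.coe_subset.1 hY)) hx⟩
  obtain ⟨σ, hσ, hσA, rfl⟩ := hF hy
  exact ⟨⟨⟨σ, hσ⟩, fun a => hσA a a.2⟩, rfl⟩

end IsGeneric

end Geometry

/-! ### Bounded automorphisms -/

section Bounded

variable {r n m : ℕ} {f : ℝ≥0 → ℝ≥0} {V : Type*} {H : UHypergraph r V}

theorem predim_empty (hr : 0 < r) : predim n m H ∅ = 0 := by
  rw [predim_eq_of_card_lt (by rwa [Finset.card_empty]), Finset.card_empty, Nat.cast_zero, mul_zero]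

theorem predim_singleton (hr : 2 ≤ r) (x : V) : predim n m H {x} = n := by
  rw [predim_eq_of_card_lt (by rwa [Finset.card_singleton]), Finset.card_singleton, Nat.cast_one,
    mul_one]

theorem IsGeneric.strong_singleton (hgen : IsGeneric n m f H) (hr : 2 ≤ r) (hf : StrictMono f)
    (hf1 : f 1 = n) (x : V) : Strong n m H {x} := by
  intro Y hY
  have hcard : 1 < Y.card := by simpa only [Finset.card_singleton] using Finset.card_lt_card hY
  have hlt : (n : ℝ≥0) < f Y.card := hf1 ▸ hf (by exact_mod_cast hcard)
  have hbound : (n : ℝ) < predim n m H Y :=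
    lt_of_lt_of_le (by exact_mod_cast hlt) (hgen.fBound Y)
  rw [predim_singleton hr]
  exact_mod_cast hbound

theorem IsGeneric.strong_empty (hgen : IsGeneric n m f H) (hr : 2 ≤ r) (hf : StrictMono f)
    (hf1 : f 1 = n) : Strong n m H ∅ := by
  intro Y hY
  obtain ⟨x, hx⟩ := Finset.empty_ssubset.1 hY
  have hn : 0 < n := by
    have hf0 : (0 : ℝ≥0) < n := hf1 ▸ pos_of_gt (hf zero_lt_one)
    exact_mod_cast hf0
  calc predim n m H ∅ = 0 := predim_empty (by omega)
    _ < predim n m H {x} := by rw [predim_singleton hr]; exact_mod_cast hn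
    _ ≤ predim n m H Y :=
      (hgen.strong_singleton hr hf hf1 x).le (Finset.singleton_subset_iff.2 hx)

theorem locEmb_singleton {K : UHypergraph r V} [DecidableEq V] (hr : 2 ≤ r) (φ : V → V) (x : V) :
    LocEmb K H φ {x} := by
  have card_le : ∀ e ⊆ ({x} : Finset V), e.card ≤ 1 := fun e he =>
    Finset.card_le_card he
  refine ⟨by simp, fun e he => ⟨fun h => ?_, fun h => ?_⟩⟩
  · have := K.card_eq e h
    have := card_le e he
    omega
  · have := H.card_eq _ h
    have := (Finset.card_image_le (f := φ)).trans (card_le e he)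
    omega

variable [DecidableEq V] {P Q B E : Finset V} {y z : V}

namespace FreeOver

theorem notMem_right (h : FreeOver n m H P Q {y}) (hz : z ∈ P) (hzy : z ≠ y) : z ∉ Q := fun hzQ =>
  hzy (Finset.mem_singleton.1 (h.inter ▸ Finset.mem_inter.2 ⟨hz, hzQ⟩))

theorem dim_insert_lt_predim (hH : Nonneg n m H) (h : FreeOver n m H P Q {y})
    (hst : Strong n m H {y}) (hBQ : B ⊆ Q) (hz : z ∈ P) (hzy : z ≠ y) {Y : Finset V}
    (hY : Y ⊆ P ∪ Q) (hBY : insert z B ⊆ Y) (hy : y ∈ Y) :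
    dim n m H (insert y B) < predim n m H Y := by
  have hadd := h.predim_inter_add hY
  have hyP : y ∈ P := h.subset_left (Finset.mem_singleton_self y)
  have hyQ : y ∈ Q := h.subset_right (Finset.mem_singleton_self y)
  have hle : dim n m H (insert y B) ≤ predim n m H (Y ∩ Q) := hH.dim_le (by grind)
  have hlt : predim n m H {y} < predim n m H (Y ∩ P) := hst _ <|
    (Finset.ssubset_iff_of_subset (by grind)).2 ⟨z, by grind, by simpa using hzy⟩
  rw [Finset.inter_singleton_of_mem hy] at hadd
  linarith

theorem predim_eq_of_notMem (hr : 0 < r) (h : FreeOver n m H P Q {y}) {Y : Finset V}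
    (hY : Y ⊆ P ∪ Q) (hy : y ∉ Y) :
    predim n m H Y = predim n m H (Y ∩ P) + predim n m H (Y ∩ Q) := by
  rw [← h.predim_inter_add hY, Finset.inter_singleton_of_notMem hy, predim_empty hr, add_zero]

theorem dim_insert_lt_or (hr : 2 ≤ r) (hH : Nonneg n m H) (hpt : ∀ x, Strong n m H {x})
    (h : FreeOver n m H P Q {y}) (hB : Strong n m H B) (hBQ : B ⊆ Q) (hz : z ∈ P) (hzy : z ≠ y) :
    dim n m H (insert y B) < dim n m H (insert z B) ∨
      dim n m H B + n ≤ dim n m H (insert z B) := by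
  obtain ⟨Y, hzY, hY⟩ := hH.exists_dim (insert z B)
  have hYPQ : Y ⊆ P ∪ Q := h.strong.subset_of_predim_le hH
    (Finset.insert_subset (Finset.mem_union_left _ hz) (hBQ.trans Finset.subset_union_right))
    hzY hY.le
  rw [← hY]
  by_cases hy : y ∈ Y
  · exact Or.inl (h.dim_insert_lt_predim hH (hpt y) hBQ hz hzy hYPQ hzY hy)
  · have hleB : predim n m H B ≤ predim n m H (Y ∩ Q) := hB.le (by grind)
    have hlez : predim n m H {z} ≤ predim n m H (Y ∩ P) := (hpt z).le (by grind)
    rw [predim_singleton hr] at hlez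
    rw [h.predim_eq_of_notMem (by omega) hYPQ hy, hB.dim_eq hH]
    exact Or.inr (by linarith)

theorem strong_insert (hr : 2 ≤ r) (hH : Nonneg n m H) (hpt : ∀ x, Strong n m H {x})
    (h : FreeOver n m H P Q {y}) (hB : Strong n m H B) (hBQ : B ⊆ Q) (hz : z ∈ P) (hzy : z ≠ y)
    (hy : dim n m H B + n ≤ dim n m H (insert y B)) : Strong n m H (insert z B) := by
  have hzB : z ∉ B := fun hzB => h.notMem_right hz hzy (hBQ hzB)
  have hle : predim n m H (insert z B) ≤ predim n m H B + predim n m H {z} := by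
    have hsubmod := predim_submod (n := n) (m := m) (H := H) {z} B
    rw [Finset.singleton_inter_of_notMem hzB, predim_empty (by omega), ← Finset.insert_eq]
      at hsubmod
    linarith
  refine h.strong.of_subset (fun Y hY hlt => ?_)
    (Finset.insert_subset (Finset.mem_union_left _ hz) (hBQ.trans Finset.subset_union_right))
  by_cases hyY : y ∈ Y
  · have hdim := h.dim_insert_lt_predim hH (hpt y) hBQ hz hzy hY hlt.1 hyY
    rw [hB.dim_eq hH] at hy
    rw [predim_singleton hr] at hle
    linarith
  · have hsubB : B ⊆ Y ∩ Q := by grind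
    have hsubz : {z} ⊆ Y ∩ P := by grind
    have hadd := h.predim_eq_of_notMem (by omega) hY hyY
    by_contra hcon
    have eqB := hB.eq_of_le hsubB (by linarith [(hpt z).le hsubz])
    have eqz := (hpt z).eq_of_le hsubz (by linarith [hB.le hsubB])
    refine hlt.2 ?_
    rw [Finset.insert_eq, ← eqB, ← eqz, ← Finset.inter_union_distrib_left,
      Finset.inter_eq_left.2 hY]

theorem smul_eq_of_edge (hr : 2 ≤ r) {g : H.Aut} (h : FreeOver n m H P Q {y}) (hE : E ∈ H.edges)
    (hyE : y ∈ E) (hEP : E ⊆ P) (hg : g • y ∈ Q) (hfix : ∀ z ∈ E, z ≠ y → g • z = z) :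
    g • y = y := by
  obtain ⟨z, hz, hzy⟩ := Finset.exists_mem_ne (s := E) (by rw [H.card_eq E hE]; omega) y
  have hgE : g • E ⊆ P ∪ Q := by
    intro w hw
    obtain ⟨x, hx, rfl⟩ := Finset.mem_smul_finset.1 hw
    by_cases hxy : x = y
    · exact Finset.mem_union_right _ (hxy ▸ hg)
    · rw [hfix x hx hxy]
      exact Finset.mem_union_left _ (hEP hx)
  rcases h.free _ ((smul_mem_edges_iff g).2 hE) hgE with hgP | hgQ
  · by_contra hne
    exact h.notMem_right (hgP (Finset.smul_mem_smul_finset hyE)) hne hg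
  · have hzQ := hgQ (Finset.smul_mem_smul_finset (a := g) hz)
    rw [hfix z hz hzy] at hzQ
    exact absurd hzQ (h.notMem_right (hEP hz) hzy)

end FreeOver

namespace IsGeneric

variable (hgen : IsGeneric n m f H)
include hgen

omit [DecidableEq V] in
theorem exists_smul_eq (hr : 2 ≤ r) (hpt : ∀ x, Strong n m H {x}) (x y : V) :
    ∃ σ : H.Aut, σ • x = y := by
  classical
  obtain ⟨σ, hσ⟩ := hgen.exists_aut (locEmb_singleton hr (fun _ => y) x) (hpt x)
    (by simpa only [Finset.image_singleton] using hpt y)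
  exact ⟨σ, hσ x (Finset.mem_singleton_self x)⟩

omit [DecidableEq V] in
theorem nontrivial_aut (hr : 2 ≤ r) (hpt : ∀ x, Strong n m H {x}) (hedge : H.edges.Nonempty) :
    Nontrivial H.Aut := by
  obtain ⟨e, he⟩ := hedge
  obtain ⟨x, -, y, -, hxy⟩ := Finset.one_lt_card.1 (by rw [H.card_eq e he]; omega : 1 < e.card)
  obtain ⟨σ, rfl⟩ := hgen.exists_smul_eq hr hpt x y
  exact ⟨σ, 1, fun h => hxy (by rw [h, one_smul])⟩

theorem exists_edge_freeOver (hf : HasFreeAmalgamation r n m f) (hr : 2 ≤ r)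
    (hpt : ∀ x, Strong n m H {x}) (hedge : H.edges.Nonempty) (hQ : Strong n m H Q) (hy : y ∈ Q) :
    ∃ E ∈ H.edges, ∃ P, y ∈ E ∧ E ⊆ P ∧ FreeOver n m H P Q {y} := by
  obtain ⟨e, he⟩ := hedge
  obtain ⟨x, hx⟩ : e.Nonempty := Finset.card_pos.1 (by rw [H.card_eq e he]; omega)
  obtain ⟨τ, rfl⟩ := hgen.exists_smul_eq hr hpt x y
  have hxe : τ • x ∈ τ • e := Finset.smul_mem_smul_finset hx
  have sub := hgen.subset_clos (τ • e)
  obtain ⟨σ, hσ, hfree⟩ := hgen.exists_freeOver hf (hgen.strong_clos (τ • e)) (hpt (τ • x)) hQ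
    (Finset.singleton_subset_iff.2 (sub hxe)) (Finset.singleton_subset_iff.2 hy)
  refine ⟨σ • τ • e, ?_, σ • hgen.clos (τ • e), ?_, Finset.smul_finset_subset_smul_finset sub,
    hfree⟩
  · rwa [smul_mem_edges_iff, smul_mem_edges_iff]
  · rw [← hσ _ (Finset.mem_singleton_self _)]
    exact Finset.smul_mem_smul_finset hxe

theorem smul_eq_of_forall_freeOver (hf : HasFreeAmalgamation r n m f) (hr : 2 ≤ r)
    (hpt : ∀ x, Strong n m H {x}) (hedge : H.edges.Nonempty) {g : H.Aut} (X : Finset V)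
    (h : ∀ P Q z, FreeOver n m H P Q {y} → X ⊆ Q → z ∈ P → z ≠ y → g • z = z) :
    g • y = y := by
  have sub := hgen.subset_clos (X ∪ {y, g • y})
  obtain ⟨E, hE, P, hyE, hEP, hfree⟩ := hgen.exists_edge_freeOver hf hr hpt hedge
    (hgen.strong_clos (X ∪ {y, g • y})) (y := y) (sub (by simp))
  exact hfree.smul_eq_of_edge hr hE hyE hEP (sub (by simp)) fun z hz hzy =>
    h P _ z hfree (Finset.subset_union_left.trans sub) (hEP hz) hzy

/-- Downward induction on the dimension of `y` over `B`: `y` lies on an edge that is free from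
`B`, the other points of which have larger dimension over `B` or are generic over `B`. -/
theorem eq_one_of_forall_smul_mem_clos (hf : HasFreeAmalgamation r n m f) (hr : 2 ≤ r)
    (hpt : ∀ x, Strong n m H {x}) (hedge : H.edges.Nonempty) {g : H.Aut} (hB : Strong n m H B)
    (hg : ∀ x, g • x ∈ hgen.clos (insert x B)) : g = 1 := by
  have smul_eq : ∀ (j : ℕ) (y : V), dim n m H B + n ≤ dim n m H (insert y B) + j →
      g • y = y := by
    intro j
    induction j with
    | zero =>
      intro y hy
      refine hgen.smul_eq_of_forall_freeOver hf hr hpt hedge (B ∪ g⁻¹ • B)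
        fun P Q z hfree hQ hz hzy => ?_
      rw [Finset.union_subset_iff] at hQ
      have hst := hfree.strong_insert hr hgen.nonneg hpt hB hQ.1 hz hzy (by simpa using hy)
      have hgz := hg z
      rw [hgen.clos_eq_iff.2 hst] at hgz
      exact (Finset.mem_insert.1 hgz).resolve_right fun hgB =>
        hfree.notMem_right hz hzy (hQ.2 (Finset.mem_inv_smul_finset_iff.2 hgB))
    | succ j ih =>
      intro y hy
      refine hgen.smul_eq_of_forall_freeOver hf hr hpt hedge B
        fun P Q z hfree hQ hz hzy => ih z ?_
      push_cast at hy
      rcases hfree.dim_insert_lt_or hr hgen.nonneg hpt hB hQ hz hzy with hlt | hle <;> omega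
  refine FaithfulSMul.eq_of_smul_eq_smul (α := V) fun y => ?_
  rw [one_smul]
  exact smul_eq n y (by linarith [hgen.nonneg.dim_mono (Finset.subset_insert y B)])

theorem eq_one_of_isBounded {hf : HasFreeAmalgamation r n m f}
    {h0 : Strong n m H ∅} (hr : 2 ≤ r) (hpt : ∀ x, Strong n m H {x}) (hedge : H.edges.Nonempty)
    {g : H.Aut} (hg : (hgen.geometry hf h0).IsBounded g) : g = 1 := by
  obtain ⟨B, hg⟩ := hg
  exact hgen.eq_one_of_forall_smul_mem_clos hf hr hpt hedge (hgen.strong_clos B) fun x =>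
    hgen.clos_mono (Finset.insert_subset_insert x (hgen.subset_clos B)) (hg x)

end IsGeneric

end Bounded

end UHypergraph

open UHypergraph in
theorem theorem5p11_general {r n m : ℕ} (hr : 2 ≤ r) {f : ℝ≥0 → ℝ≥0} (hf : StrictMono f)
    (hfree : HasFreeAmalgamation r n m f) (hf1 : f 1 = n) {M : Type*} {H : UHypergraph r M}
    (hgen : IsGeneric n m f H) (hedge : H.edges.Nonempty) (hmono : Monodimensional n m H) :
    (∀ g : H.Aut, g ≠ 1 → ∀ h : H.Aut, IsConjProd g 16 h) ∧ IsSimpleGroup H.Aut := by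
  classical
  have := hgen.countable
  have hpt := hgen.strong_singleton hr hf hf1
  have := hgen.nontrivial_aut hr hpt hedge
  have hprod : ∀ g : H.Aut, g ≠ 1 → ∀ h : H.Aut, IsConjProd g 16 h := fun g hg h =>
    (hgen.isMonodimensional_geometry (hf := hfree) (h0 := hgen.strong_empty hr hf hf1)
      hmono).isConjProd (closedAction_aut H)
      (fun hb => hg (hgen.eq_one_of_isBounded hr hpt hedge hb)) h
  exact ⟨hprod, isSimpleGroup_of_isConjProd hprod⟩

theorem theorem5p11 {r n m : ℕ} (hr : 2 ≤ r) (hn : 1 ≤ n) (hm : 1 ≤ m) (hnm : n.Coprime m)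
    (h2 : r = 2 → m < n) (h3 : 3 ≤ r → m ≤ n)
    (f : ℝ≥0 → ℝ≥0) (hf : UHypergraph.IsGood r n m f) (hf0 : f 0 = 0) (hf1 : f 1 = n)
    {M : Type*} (H : UHypergraph r M) (hgen : UHypergraph.IsGeneric n m f H)
    (hedge : H.edges.Nonempty) (hmono : UHypergraph.Monodimensional n m H) :
    (∀ g : H.Aut, g ≠ 1 → ∀ h : H.Aut, ∃ l : List H.Aut,
      l.length = 192 ∧ (∀ x ∈ l, IsConj g x ∨ IsConj g⁻¹ x) ∧ l.prod = h) ∧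
    IsSimpleGroup H.Aut :=
  (theorem5p11_general hr hf.strictMono hf.amalgamation hf1 hgen hedge hmono).imp_left
    fun hprod g hg h => mul_one h ▸ (hprod g hg h).mul (IsConjProd.one g 88)
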